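/- **Conventions.** Composition is written in applicative order ($g\circ f$ is "first $f$, then $g$"). *Tangent categories.* A tangent category $(\mathbb X,\mathbb T)$ is a category with an endofunctor $T$, natural transformations $p\colon T\Rightarrow \mathrm{id}$, $z\colon\mathrm{id}\Rightarrow T$, $s\colon T_2\Rightarrow T$, $l\colon T\Rightarrow T^2$, $c\colon T^2\Rightarrow T^2$, where $T_nA$ is a chosen $n$-fold pullback of $p_A$ along itself, preserved by all $T^m$; each $(p_A,z_A,s_A)$ is a (commutative) additive bundle; $(z,l)\colon (p,z,s)\to(Tp,Tz,Ts)$ and $(\mathrm{id},c)\colon(Tp,Tz,Ts)\to(p_T,z_T,s_T)$ are additive bundle morphisms; $Tl\circ l=l_T\circ l$, $c\circ c=\mathrm{id}$, $Tc\circ c_T\circ Tc=c_T\circ Tc\circ c_T$, $c\circ l=l$, $c_T\circ Tc\circ l_T=Tl\circ c$; and for every $A$ the square with top $Ts\circ\langle l\pi_1,z_T\pi_2\rangle\colon T_2A\to T^2A$, left side $T_2A\to A$, right side $Tp\colon T^2A\to TA$ and bottom $z\colon A\to TA$ is a pullback. A strong tangent morphism $(F,\alpha)\colon(\mathbb X',\mathbb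 T')\to(\mathbb X,\mathbb T)$ is a functor $F\colon\mathbb X'\to\mathbb X$ which preserves the $n$-fold pullbacks $T'_n$ of the projection and the pullback squares of the vertical lift, with a natural isomorphism $\alpha\colon FT'\Rightarrow TF$ such that each $(\mathrm{id},\alpha)$ is an additive bundle morphism, $T\alpha\circ\alpha_{T'}\circ Fl'=l_F\circ\alpha$ and $T\alpha\circ\alpha_{T'}\circ Fc'=c_F\circ T\alpha\circ\alpha_{T'}$; it is strict if $\alpha$ is the identity (so $FT'=TF$). A 2-morphism $(F,\alpha)\Rightarrow(G,\beta)$ is a natural transformation $\tau\colon F\Rightarrow G$ with $\beta\circ\tau_{T'}=T\tau\circ\alpha$. Let $\mathrm{TNGCAT}_{\cong}$ be the resulting 2-category, and $\mathrm{TNGCAT}_{\cong}/(\mathbb X,\mathbb T)$ its slice 2-category (strictly commuting triangles; 2-morphisms that become identities over $\mathbb X$). *The comma 2-monad.* For a strong tangent morphism $(\Pi,\alpha)\colon(\mathbb X',\mathbb T')\to(\mathbb X,\mathbb T)$ the comma category $\mathbb X\downarrow\Pi$, with objects $f\colon A\to\Pi E$, is a tangent category with tangent functor $\bar T(f\colon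 A\to\Pi E)=(\alpha^{-1}\circ Tf\colon TA\to \Pi T'E)$ and all other data taken componentwise from $(\mathbb X,\mathbb T)$ and $(\mathbb X',\mathbb T')$; its projection to $\mathbb X$, $(f\colon A\to\Pi E)\mapsto A$, is a strict tangent morphism. The 2-monad $M$ on $\mathrm{TNGCAT}_{\cong}/(\mathbb X,\mathbb T)$ sends $(\Pi,\alpha)$ to this projection, and acts on 1- and 2-morphisms by the functoriality of the comma construction; its unit is $E\mapsto \mathrm{id}_{\Pi E}$ and its multiplication sends $(g\colon B\to A,\ f\colon A\to\Pi E)$ to $f\circ g$. *Pseudoalgebras.* A pseudoalgebra of a 2-monad $(M,\eta,\gamma)$ is an object $A$ with a 1-morphism $c\colon MA\to A$ and invertible 2-morphisms $\zeta\colon\mathrm{id}_A\Rightarrow c\circ\eta_A$ and $\theta\colon c\circ Mc\Rightarrow c\circ\gamma_A$ such that $(\theta\,\eta_{MA})\cdot(\zeta\, c)=\mathrm{id}_c$, $(\theta\,M\eta_A)\cdot(c\,M\zeta)=\mathrm{id}_c$ and $(\theta\,M\gamma_A)\cdot(c\,M\theta)=(\theta\,\gamma_{MA})\cdot(\theta\,M^2c)$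 (with $\cdot$ vertical composition). *Tangent fibrations.* A (cloven) tangent fibration over $(\mathbb X,\mathbb T)$ is a strict tangent morphism $\Pi\colon(\mathbb X',\mathbb T')\to(\mathbb X,\mathbb T)$ together with a cleavage, i.e. a choice, for all $E\in\mathbb X'$ and $f\colon A\to\Pi E$, of a cartesian lift $\varphi^f_E\colon f^*E\to E$ of $f$, such that the distributors are invertible: the distributor $\kappa^f_E\colon T'(f^*E)\to(Tf)^*(T'E)$ is the unique morphism over $\mathrm{id}_{TA}$ with $\varphi^{Tf}_{T'E}\circ\kappa^f_E=T'\varphi^f_E$. **Theorem.** Let $(\mathbb X,\mathbb T)$ be a tangent category. Tangent fibrations over $(\mathbb X,\mathbb T)$ are precisely the pseudoalgebras of the 2-monad $M$ on $\mathrm{TNGCAT}_{\cong}/(\mathbb X,\mathbb T)$ whose underlying tangent morphism is strict. That is, there is a bijection between tangent fibrations over $(\mathbb X,\mathbb T)$ and pseudoalgebras $(\Pi,c,\zeta,\theta)$ of $M$ with $\Pi$ a strict tangent morphism, which keeps the underlying tangent morphism $\Pi$, and under which, for all $f\colon A\to\Pi E$: - $f^*E=c(f)$, and the cartesian lift is $\varphi^f_E=\zeta_E^{-1}\circ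 c(f,\mathrm{id}_E)$, where $(f,\mathrm{id}_E)$ is the morphism from $f$ to $\mathrm{id}_{\Pi E}$ in $\mathbb X\downarrow\Pi$; - the distributor $\kappa^f_E$ is the inverse of the component $c(\bar Tf)\to T'(c(f))$ at $f$ of the distributive law of the strong tangent morphism $c\colon\mathbb X\downarrow\Pi\to\mathbb X'$. -/

import Mathlib

open CategoryTheory CategoryTheory.Limits

universe v u v₁ u₁ v₂ u₂ v₃ u₃

namespace TangentCat

section FibrePowers

variable {C : Type u₁} [Category.{v₁} C] {D : Type u₂} [Category.{v₂} D]

/-- `P`, with `base : P ⟶ B` and the projections `proj i : P ⟶ E`, is the `n`-fold pullback of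
`q : E ⟶ B` along itself. -/
def IsFibrePower {E B P : C} {n : ℕ} (q : E ⟶ B) (base : P ⟶ B) (proj : Fin n → (P ⟶ E)) : Prop :=
  ∃ h : ∀ i, proj i ≫ q = base, Nonempty (IsLimit (WidePullbackCone.mk base proj h))

theorem isFibrePower_iff {E B P : C} {n : ℕ} (q : E ⟶ B) (base : P ⟶ B)
    (proj : Fin n → (P ⟶ E)) :
    IsFibrePower q base proj ↔ (∀ i, proj i ≫ q = base) ∧
      ∀ (X : C) (b : X ⟶ B) (a : Fin n → (X ⟶ E)), (∀ i, a i ≫ q = b) →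
        ∃! w : X ⟶ P, w ≫ base = b ∧ ∀ i, w ≫ proj i = a i := by
  constructor
  · rintro ⟨h, ⟨hl⟩⟩
    refine ⟨h, fun X b a ha => ?_⟩
    refine ⟨WidePullbackCone.IsLimit.lift hl b a ha,
      ⟨WidePullbackCone.IsLimit.lift_base hl _ _ _,
        fun i => WidePullbackCone.IsLimit.lift_π hl _ _ _ i⟩, ?_⟩
    rintro w ⟨h1, h2⟩
    refine WidePullbackCone.IsLimit.hom_ext hl ?_ ?_
    · exact h1.trans (WidePullbackCone.IsLimit.lift_base hl _ _ _).symm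
    · exact fun i => (h2 i).trans (WidePullbackCone.IsLimit.lift_π hl _ _ _ i).symm
  · rintro ⟨h, hu⟩
    choose l hl hl' using hu
    refine ⟨h, ⟨WidePullbackCone.IsLimit.mk _ (fun t => l t.pt t.base t.π t.condition) ?_ ?_ ?_⟩⟩
    · exact fun t => (hl _ _ _ t.condition).1
    · exact fun t i => (hl _ _ _ t.condition).2 i
    · intro t m h1 h2
      exact hl' _ _ _ t.condition m ⟨h1, h2⟩

namespace IsFibrePower

variable {E B P : C} {n : ℕ} {q : E ⟶ B} {base : P ⟶ B} {proj : Fin n → (P ⟶ E)}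

theorem condition (h : IsFibrePower q base proj) (i : Fin n) : proj i ≫ q = base :=
  ((isFibrePower_iff _ _ _).1 h).1 i

theorem exists_lift (h : IsFibrePower q base proj) {X : C} (b : X ⟶ B) (a : Fin n → (X ⟶ E))
    (ha : ∀ i, a i ≫ q = b) : ∃ w : X ⟶ P, w ≫ base = b ∧ ∀ i, w ≫ proj i = a i :=
  (((isFibrePower_iff _ _ _).1 h).2 X b a ha).exists

theorem hom_ext (h : IsFibrePower q base proj) {X : C} {w w' : X ⟶ P}
    (hb : w ≫ base = w' ≫ base) (hp : ∀ i, w ≫ proj i = w' ≫ proj i) : w = w' :=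
  (((isFibrePower_iff _ _ _).1 h).2 X (w' ≫ base) (fun i => w' ≫ proj i)
    (fun i => by rw [Category.assoc, h.condition])).unique ⟨hb, hp⟩ ⟨rfl, fun _ => rfl⟩

theorem mk' (h : ∀ i, proj i ≫ q = base)
    (hl : ∀ (X : C) (b : X ⟶ B) (a : Fin n → (X ⟶ E)), (∀ i, a i ≫ q = b) →
      ∃ w : X ⟶ P, w ≫ base = b ∧ ∀ i, w ≫ proj i = a i)
    (hu : ∀ (X : C) (w w' : X ⟶ P), w ≫ base = w' ≫ base →
      (∀ i, w ≫ proj i = w' ≫ proj i) → w = w') : IsFibrePower q base proj := by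
  rw [isFibrePower_iff]
  refine ⟨h, fun X b a ha => ?_⟩
  obtain ⟨w, hw⟩ := hl X b a ha
  exact ⟨w, hw, fun w' hw' => hu _ _ _ (hw'.1.trans hw.1.symm)
    (fun i => (hw'.2 i).trans (hw.2 i).symm)⟩

theorem of_iso (h : IsFibrePower q base proj) {E' B' P' : C} {q' : E' ⟶ B'} {base' : P' ⟶ B'}
    {proj' : Fin n → (P' ⟶ E')} (eP : P' ≅ P) (eE : E' ≅ E) (eB : B' ≅ B)
    (hq : q' ≫ eB.hom = eE.hom ≫ q) (hb : base' ≫ eB.hom = eP.hom ≫ base)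
    (hp : ∀ i, proj' i ≫ eE.hom = eP.hom ≫ proj i) : IsFibrePower q' base' proj' := by
  refine mk' (fun i => ?_) (fun X b a ha => ?_) (fun X w w' h1 h2 => ?_)
  · rw [← cancel_mono eB.hom, Category.assoc, hq, reassoc_of% (hp i), h.condition, hb]
  · obtain ⟨w, hw1, hw2⟩ := h.exists_lift (b ≫ eB.hom) (fun i => a i ≫ eE.hom)
      (fun i => by rw [Category.assoc, ← hq, ← Category.assoc, ha])
    refine ⟨w ≫ eP.inv, ?_, fun i => ?_⟩
    · rw [← cancel_mono eB.hom, Category.assoc, Category.assoc, hb, Iso.inv_hom_id_assoc, hw1]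
    · rw [← cancel_mono eE.hom, Category.assoc, Category.assoc, hp, Iso.inv_hom_id_assoc, hw2]
  · rw [← cancel_mono eP.hom]
    refine h.hom_ext ?_ (fun i => ?_)
    · rw [Category.assoc, ← hb, Category.assoc, ← hb, reassoc_of% h1]
    · rw [Category.assoc, ← hp, Category.assoc, ← hp, reassoc_of% (h2 i)]

theorem exists_iso (h : IsFibrePower q base proj) {E' B' P' : C} {q' : E' ⟶ B'} {base' : P' ⟶ B'}
    {proj' : Fin n → (P' ⟶ E')} (h' : IsFibrePower q' base' proj') (eE : E' ≅ E) (eB : B' ≅ B)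
    (hq : q' ≫ eB.hom = eE.hom ≫ q) :
    ∃ eP : P' ≅ P, eP.hom ≫ base = base' ≫ eB.hom ∧
      ∀ i, eP.hom ≫ proj i = proj' i ≫ eE.hom := by
  obtain ⟨w, hw1, hw2⟩ := h.exists_lift (base' ≫ eB.hom) (fun i => proj' i ≫ eE.hom)
    (fun i => by rw [Category.assoc, ← hq, ← Category.assoc, h'.condition])
  obtain ⟨w', hw1', hw2'⟩ := h'.exists_lift (base ≫ eB.inv) (fun i => proj i ≫ eE.inv)
    (fun i => by
      rw [← cancel_mono eB.hom]
      simp only [Category.assoc, hq, Iso.inv_hom_id_assoc, h.condition, Iso.inv_hom_id,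
        Category.comp_id])
  refine ⟨⟨w, w', h'.hom_ext ?_ (fun i => ?_), h.hom_ext ?_ (fun i => ?_)⟩, hw1, hw2⟩
  · simp [hw1', reassoc_of% hw1]
  · simp [hw2', reassoc_of% (hw2 i)]
  · simp [hw1, reassoc_of% hw1']
  · simp [hw2, reassoc_of% (hw2' i)]

end IsFibrePower

end FibrePowers

section AdditiveBundles

variable {C : Type u₁} [Category.{v₁} C] {D : Type u₂} [Category.{v₂} D]
  {C' : Type u₃} [Category.{v₃} C']

/-- A choice of all `n`-fold pullbacks of `q : E ⟶ B` along itself. -/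
structure FibrePowers {E B : C} (q : E ⟶ B) where
  pow : ℕ → C
  base (n : ℕ) : pow n ⟶ B
  proj (n : ℕ) (i : Fin n) : pow n ⟶ E
  isFibrePower (n : ℕ) : IsFibrePower q (base n) (proj n)

namespace FibrePowers

variable {E B : C} {q : E ⟶ B} (P : FibrePowers q)

/-- The functor `F` preserves the `n`-fold pullbacks of `q` along itself. -/
def PreservedBy (F : C ⥤ D) : Prop :=
  ∀ n, IsFibrePower (F.map q) (F.map (P.base n)) (fun i => F.map (P.proj n i))

/-- The image of the `n`-fold pullbacks under a functor which preserves them. -/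
abbrev map (F : C ⥤ D) (h : P.PreservedBy F) : FibrePowers (F.map q) where
  pow n := F.obj (P.pow n)
  base n := F.map (P.base n)
  proj n i := F.map (P.proj n i)
  isFibrePower n := h n

theorem exists_pair {X : C} (a b : X ⟶ E) (h : a ≫ q = b ≫ q) :
    ∃ w : X ⟶ P.pow 2, w ≫ P.proj 2 0 = a ∧ w ≫ P.proj 2 1 = b := by
  obtain ⟨w, -, hw⟩ := (P.isFibrePower 2).exists_lift (a ≫ q) ![a, b]
    (by intro i; fin_cases i <;> simp [h])
  exact ⟨w, hw 0, hw 1⟩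

/-- The morphism `⟨a, b⟩ : X ⟶ E₂`. -/
noncomputable def pair {X : C} (a b : X ⟶ E) (h : a ≫ q = b ≫ q) : X ⟶ P.pow 2 :=
  (P.exists_pair a b h).choose

@[simp]
theorem pair_fst {X : C} (a b : X ⟶ E) (h : a ≫ q = b ≫ q) : P.pair a b h ≫ P.proj 2 0 = a :=
  (P.exists_pair a b h).choose_spec.1

@[simp]
theorem pair_snd {X : C} (a b : X ⟶ E) (h : a ≫ q = b ≫ q) : P.pair a b h ≫ P.proj 2 1 = b :=
  (P.exists_pair a b h).choose_spec.2

theorem condition {n : ℕ} (i j : Fin n) : P.proj n i ≫ q = P.proj n j ≫ q := by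
  rw [(P.isFibrePower n).condition, (P.isFibrePower n).condition]

theorem hom_ext₂ {X : C} {w w' : X ⟶ P.pow 2} (h0 : w ≫ P.proj 2 0 = w' ≫ P.proj 2 0)
    (h1 : w ≫ P.proj 2 1 = w' ≫ P.proj 2 1) : w = w' := by
  refine (P.isFibrePower 2).hom_ext ?_ (fun i => ?_)
  · rw [← (P.isFibrePower 2).condition 0, reassoc_of% h0]
  · fin_cases i
    · exact h0
    · exact h1

theorem eq_pair {X : C} (a b : X ⟶ E) (h : a ≫ q = b ≫ q) (w : X ⟶ P.pow 2)
    (h0 : w ≫ P.proj 2 0 = a) (h1 : w ≫ P.proj 2 1 = b) : w = P.pair a b h :=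
  P.hom_ext₂ (by simp [h0]) (by simp [h1])

theorem comp_pair {X Y : C} (w : Y ⟶ X) (a b : X ⟶ E) (h : a ≫ q = b ≫ q) :
    w ≫ P.pair a b h = P.pair (w ≫ a) (w ≫ b) (by simp [h]) :=
  P.eq_pair _ _ _ _ (by simp) (by simp)

theorem map_fibre (F : C ⥤ D) {X : C} {a b : X ⟶ E} (h : a ≫ q = b ≫ q) :
    F.map a ≫ F.map q = F.map b ≫ F.map q := by
  rw [← F.map_comp, h, F.map_comp]

theorem map_pair (F : C ⥤ D) (hF : P.PreservedBy F) {X : C} (a b : X ⟶ E) (h : a ≫ q = b ≫ q) :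
    F.map (P.pair a b h) = (P.map F hF).pair (F.map a) (F.map b) (map_fibre F h) := by
  refine (P.map F hF).eq_pair _ _ _ _ ?_ ?_
  · exact (F.map_comp _ _).symm.trans (by rw [pair_fst])
  · exact (F.map_comp _ _).symm.trans (by rw [pair_snd])

end FibrePowers

/-- An additive bundle with projection `q`. -/
structure AdditiveBundle {E B : C} (q : E ⟶ B) extends FibrePowers q where
  zero : B ⟶ E
  sum : pow 2 ⟶ E
  zero_proj : zero ≫ q = 𝟙 B
  sum_proj (i : Fin 2) : sum ≫ q = proj 2 i ≫ q
  sum_assoc :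
    toFibrePowers.pair
        (toFibrePowers.pair (proj 3 0) (proj 3 1) (toFibrePowers.condition 0 1) ≫ sum) (proj 3 2)
        (by
          rw [Category.assoc, sum_proj 0, ← Category.assoc, FibrePowers.pair_fst]
          exact toFibrePowers.condition 0 2) ≫ sum =
      toFibrePowers.pair (proj 3 0)
        (toFibrePowers.pair (proj 3 1) (proj 3 2) (toFibrePowers.condition 1 2) ≫ sum)
        (by
          rw [Category.assoc, sum_proj 0, ← Category.assoc, FibrePowers.pair_fst]
          exact toFibrePowers.condition 0 1) ≫ sum
  zero_sum : toFibrePowers.pair (q ≫ zero) (𝟙 E)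
    (by rw [Category.assoc, zero_proj, Category.comp_id, Category.id_comp]) ≫ sum = 𝟙 E
  sum_comm : toFibrePowers.pair (proj 2 1) (proj 2 0) (toFibrePowers.condition 1 0) ≫ sum = sum

namespace AdditiveBundle

variable {E B : C} {q : E ⟶ B} (P : AdditiveBundle q)

/-- The sum of two generalised elements of `E` in the same fibre. -/
noncomputable def plus {X : C} (a b : X ⟶ E) (h : a ≫ q = b ≫ q) : X ⟶ E :=
  P.pair a b h ≫ P.sum

theorem comp_plus {X Y : C} (w : Y ⟶ X) (a b : X ⟶ E) (h : a ≫ q = b ≫ q) :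
    w ≫ P.plus a b h = P.plus (w ≫ a) (w ≫ b) (by simp [h]) := by
  rw [plus, ← Category.assoc, FibrePowers.comp_pair]
  rfl

theorem sum_eq_plus : P.sum = P.plus (P.proj 2 0) (P.proj 2 1) (P.condition 0 1) := by
  rw [plus, ← P.eq_pair _ _ _ (𝟙 _) (Category.id_comp _) (Category.id_comp _), Category.id_comp]

theorem plus_proj {X : C} (a b : X ⟶ E) (h : a ≫ q = b ≫ q) : P.plus a b h ≫ q = a ≫ q := by
  rw [plus, Category.assoc, P.sum_proj 0, ← Category.assoc, FibrePowers.pair_fst]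

/-- The image of an additive bundle under a functor which preserves its `n`-fold pullbacks. -/
abbrev map (F : C ⥤ D) (hF : P.PreservedBy F) : AdditiveBundle (F.map q) where
  toFibrePowers := P.toFibrePowers.map F hF
  zero := F.map P.zero
  sum := F.map P.sum
  zero_proj := by rw [← F.map_comp, P.zero_proj, F.map_id]
  sum_proj i := by rw [← F.map_comp, P.sum_proj i, F.map_comp]
  sum_assoc := by
    have := congrArg F.map P.sum_assoc
    simp only [F.map_comp, P.map_pair F hF] at this
    exact this
  zero_sum := by
    have := congrArg F.map P.zero_sum
    simp only [F.map_comp, F.map_id, P.map_pair F hF] at this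
    exact this
  sum_comm := by
    have := congrArg F.map P.sum_comm
    simp only [F.map_comp, P.map_pair F hF] at this
    exact this

theorem map_plus (F : C ⥤ D) (hF : P.PreservedBy F) {X : C} (a b : X ⟶ E) (h : a ≫ q = b ≫ q) :
    F.map (P.plus a b h) =
      (P.map F hF).plus (F.map a) (F.map b) (FibrePowers.map_fibre F h) := by
  rw [plus, F.map_comp, P.map_pair F hF]
  rfl

end AdditiveBundle

/-- The pair `(f, g)` is a morphism of additive bundles from `P` to `P'`. -/
structure IsAdditiveBundleHom {E B E' B' : C} {q : E ⟶ B} {q' : E' ⟶ B'} (P : AdditiveBundle q)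
    (P' : AdditiveBundle q') (f : B ⟶ B') (g : E ⟶ E') : Prop where
  proj : g ≫ q' = q ≫ f
  zero : P.zero ≫ g = f ≫ P'.zero
  sum : P.sum ≫ g = P'.pair (P.proj 2 0 ≫ g) (P.proj 2 1 ≫ g)
    (by rw [Category.assoc, Category.assoc, proj, ← Category.assoc, ← Category.assoc,
      P.condition 0 1]) ≫ P'.sum

namespace IsAdditiveBundleHom

variable {E B E' B' E'' B'' : C} {q : E ⟶ B} {q' : E' ⟶ B'} {q'' : E'' ⟶ B''}
  {P : AdditiveBundle q} {P' : AdditiveBundle q'} {P'' : AdditiveBundle q''}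
  {f : B ⟶ B'} {g : E ⟶ E'} {f' : B' ⟶ B''} {g' : E' ⟶ E''}

theorem fibre (h : IsAdditiveBundleHom P P' f g) {X : C} {a b : X ⟶ E} (w : a ≫ q = b ≫ q) :
    (a ≫ g) ≫ q' = (b ≫ g) ≫ q' := by
  rw [Category.assoc, h.proj, Category.assoc, h.proj, reassoc_of% w]

theorem plus (h : IsAdditiveBundleHom P P' f g) {X : C} (a b : X ⟶ E) (w : a ≫ q = b ≫ q) :
    P.plus a b w ≫ g = P'.plus (a ≫ g) (b ≫ g) (h.fibre w) := by
  rw [AdditiveBundle.plus, Category.assoc, h.sum, ← Category.assoc, FibrePowers.comp_pair]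
  simp only [← Category.assoc, FibrePowers.pair_fst, FibrePowers.pair_snd]
  rfl

theorem of_plus (hp : g ≫ q' = q ≫ f) (hz : P.zero ≫ g = f ≫ P'.zero)
    (hs : ∀ h, P.sum ≫ g = P'.plus (P.proj 2 0 ≫ g) (P.proj 2 1 ≫ g) h) :
    IsAdditiveBundleHom P P' f g := ⟨hp, hz, hs _⟩

theorem comp (h : IsAdditiveBundleHom P P' f g) (h' : IsAdditiveBundleHom P' P'' f' g') :
    IsAdditiveBundleHom P P'' (f ≫ f') (g ≫ g') := by
  refine of_plus ?_ ?_ (fun w => ?_)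
  · rw [Category.assoc, h'.proj, reassoc_of% h.proj]
  · rw [reassoc_of% h.zero, h'.zero, Category.assoc]
  · rw [P.sum_eq_plus, ← Category.assoc, h.plus, h'.plus]
    simp only [Category.assoc]

theorem id : IsAdditiveBundleHom P P (𝟙 B) (𝟙 E) := by
  refine of_plus (by simp) (by simp) (fun w => ?_)
  rw [P.sum_eq_plus]
  simp only [Category.comp_id]

theorem map (h : IsAdditiveBundleHom P P' f g) (F : C ⥤ D) (hP : P.PreservedBy F)
    (hP' : P'.PreservedBy F) :
    IsAdditiveBundleHom (P.map F hP) (P'.map F hP') (F.map f) (F.map g) := by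
  refine of_plus ?_ ?_ (fun w => ?_)
  · rw [← F.map_comp, h.proj, F.map_comp]
  · exact (F.map_comp _ _).symm.trans ((congrArg F.map h.zero).trans (F.map_comp _ _))
  · have := congrArg F.map h.sum
    simp only [F.map_comp, P'.map_pair F hP'] at this
    exact this

end IsAdditiveBundleHom

end AdditiveBundles

section TangentStructures

variable {C : Type u₁} [Category.{v₁} C] {D : Type u₂} [Category.{v₂} D]
  {C' : Type u₃} [Category.{v₃} C']

/-- The `m`-fold composite of an endofunctor with itself. -/
def iterate (T : C ⥤ C) : ℕ → (C ⥤ C)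
  | 0 => 𝟭 C
  | m + 1 => T ⋙ iterate T m

/-- A tangent structure on a category. The naturality of the projection, of the zero morphism and
of the sum morphism (and the functoriality of the `n`-fold pullbacks `T_n`) are contained in
`bundle_natural`. -/
structure TangentStructure (C : Type u₁) [Category.{v₁} C] where
  T : C ⥤ C
  p (A : C) : T.obj A ⟶ A
  bundle (A : C) : AdditiveBundle (p A)
  preserved (m : ℕ) (A : C) : (bundle A).PreservedBy (iterate T (m + 1))
  bundle_natural {A B : C} (f : A ⟶ B) : IsAdditiveBundleHom (bundle A) (bundle B) f (T.map f)
  l (A : C) : T.obj A ⟶ T.obj (T.obj A)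
  l_natural {A B : C} (f : A ⟶ B) : T.map f ≫ l B = l A ≫ T.map (T.map f)
  c (A : C) : T.obj (T.obj A) ⟶ T.obj (T.obj A)
  c_natural {A B : C} (f : A ⟶ B) : T.map (T.map f) ≫ c B = c A ≫ T.map (T.map f)
  lift_additive (A : C) : IsAdditiveBundleHom (bundle A) ((bundle A).map T (preserved 0 A))
    (bundle A).zero (l A)
  flip_additive (A : C) : IsAdditiveBundleHom ((bundle A).map T (preserved 0 A))
    (bundle (T.obj A)) (𝟙 (T.obj A)) (c A)
  lift_coassoc (A : C) : l A ≫ T.map (l A) = l A ≫ l (T.obj A)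
  flip_flip (A : C) : c A ≫ c A = 𝟙 (T.obj (T.obj A))
  flip_braid (A : C) : T.map (c A) ≫ c (T.obj A) ≫ T.map (c A) =
    c (T.obj A) ≫ T.map (c A) ≫ c (T.obj A)
  lift_flip (A : C) : l A ≫ c A = l A
  lift_flip_flip (A : C) : l (T.obj A) ≫ T.map (c A) ≫ c (T.obj A) = c A ≫ T.map (l A)
  /-- universality of the vertical lift -/
  universal (A : C) : IsPullback
    (((bundle A).map T (preserved 0 A)).plus ((bundle A).proj 2 0 ≫ l A)
      ((bundle A).proj 2 1 ≫ (bundle (T.obj A)).zero)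
      (by
        rw [Category.assoc, (lift_additive A).proj, Category.assoc,
          (bundle_natural (p A)).zero, ← Category.assoc, ← Category.assoc,
          (bundle A).condition 0 1]))
    ((bundle A).base 2) (T.map (p A)) (bundle A).zero

namespace TangentStructure

variable (S : TangentStructure C)

theorem preservedT (A : C) : (S.bundle A).PreservedBy S.T := S.preserved 0 A

/-- The additive bundle `T p : T² A ⟶ T A`. -/
abbrev mapBundle (A : C) : AdditiveBundle (S.T.map (S.p A)) :=
  (S.bundle A).map S.T (S.preservedT A)

/-- The zero morphism. -/
abbrev zero (A : C) : A ⟶ S.T.obj A := (S.bundle A).zero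

theorem lift_fibre (A : C) : ((S.bundle A).proj 2 0 ≫ S.l A) ≫ S.T.map (S.p A) =
    ((S.bundle A).proj 2 1 ≫ S.zero (S.T.obj A)) ≫ S.T.map (S.p A) := by
  rw [Category.assoc, (S.lift_additive A).proj, Category.assoc,
    (S.bundle_natural (S.p A)).zero, ← Category.assoc, ← Category.assoc,
    (S.bundle A).condition 0 1]

/-- The morphism `T₂ A ⟶ T² A` in the universality of the vertical lift. -/
noncomputable def phi (A : C) : (S.bundle A).pow 2 ⟶ S.T.obj (S.T.obj A) :=
  (S.mapBundle A).plus ((S.bundle A).proj 2 0 ≫ S.l A)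
    ((S.bundle A).proj 2 1 ≫ S.zero (S.T.obj A)) (S.lift_fibre A)

theorem isPullback (A : C) : IsPullback (S.phi A) ((S.bundle A).base 2) (S.T.map (S.p A))
    (S.zero A) := S.universal A

end TangentStructure

/-- A strong tangent morphism: a functor with an invertible distributive law, compatible with
the tangent structures, which preserves the `n`-fold pullbacks of the projection and the
universality of the vertical lift. -/
structure StrongTangentMorphism (S : TangentStructure C) (S' : TangentStructure D) where
  F : C ⥤ D
  α (A : C) : F.obj (S.T.obj A) ≅ S'.T.obj (F.obj A)
  α_natural {A B : C} (f : A ⟶ B) :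
    F.map (S.T.map f) ≫ (α B).hom = (α A).hom ≫ S'.T.map (F.map f)
  preserved (A : C) : (S.bundle A).PreservedBy F
  preserved_lift (A : C) : IsPullback (F.map (S.phi A)) (F.map ((S.bundle A).base 2))
    (F.map (S.T.map (S.p A))) (F.map (S.zero A))
  additive (A : C) : IsAdditiveBundleHom ((S.bundle A).map F (preserved A))
    (S'.bundle (F.obj A)) (𝟙 (F.obj A)) (α A).hom
  lift (A : C) : F.map (S.l A) ≫ (α (S.T.obj A)).hom ≫ S'.T.map (α A).hom =
    (α A).hom ≫ S'.l (F.obj A)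
  flip (A : C) : F.map (S.c A) ≫ (α (S.T.obj A)).hom ≫ S'.T.map (α A).hom =
    (α (S.T.obj A)).hom ≫ S'.T.map (α A).hom ≫ S'.c (F.obj A)

theorem FibrePowers.exists_powIso {E B E' B' : C} {q : E ⟶ B} {q' : E' ⟶ B'} (P : FibrePowers q)
    (P' : FibrePowers q') (f : B ≅ B') (g : E ≅ E') (h : q ≫ f.hom = g.hom ≫ q') (n : ℕ) :
    ∃ e : P.pow n ≅ P'.pow n, e.hom ≫ P'.base n = P.base n ≫ f.hom ∧
      ∀ i, e.hom ≫ P'.proj n i = P.proj n i ≫ g.hom :=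
  (P'.isFibrePower n).exists_iso (P.isFibrePower n) g f h

theorem FibrePowers.PreservedBy.of_iso {E B E' B' : C} {q : E ⟶ B} {q' : E' ⟶ B'}
    {P' : FibrePowers q'} {G : C ⥤ D} (h : P'.PreservedBy G) (P : FibrePowers q) (f : B ≅ B')
    (g : E ≅ E') (w : q ≫ f.hom = g.hom ≫ q') : P.PreservedBy G := by
  intro n
  obtain ⟨e, he, he'⟩ := P.exists_powIso P' f g w n
  refine (h n).of_iso (G.mapIso e) (G.mapIso g) (G.mapIso f) ?_ ?_ (fun i => ?_)
  · simp only [Functor.mapIso_hom, ← G.map_comp, w]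
  · simp only [Functor.mapIso_hom, ← G.map_comp, he]
  · simp only [Functor.mapIso_hom, ← G.map_comp, he']

theorem FibrePowers.PreservedBy.of_natIso {E B : C} {q : E ⟶ B} {P : FibrePowers q} {G H : C ⥤ D}
    (h : P.PreservedBy H) (e : ∀ A, G.obj A ≅ H.obj A)
    (he : ∀ {A B : C} (f : A ⟶ B), G.map f ≫ (e B).hom = (e A).hom ≫ H.map f) :
    P.PreservedBy G :=
  fun n => (h n).of_iso (e _) (e _) (e _) (he _) (he _) (fun _ => he _)

theorem IsAdditiveBundleHom.of_nat {E B : C} {q : E ⟶ B} (P : AdditiveBundle q) {G H : C ⥤ D}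
    (hG : P.PreservedBy G) (hH : P.PreservedBy H) (e : ∀ A, G.obj A ⟶ H.obj A)
    (he : ∀ {A B : C} (f : A ⟶ B), G.map f ≫ e B = e A ≫ H.map f) :
    IsAdditiveBundleHom (P.map G hG) (P.map H hH) (e B) (e E) := by
  refine .of_plus (he _).symm (he _) (fun w => ?_)
  rw [he, AdditiveBundle.plus]
  congr 1
  exact (P.map H hH).eq_pair _ _ _ _ (he _).symm (he _).symm

namespace StrongTangentMorphism

variable {S : TangentStructure C} {S' : TangentStructure D} {S'' : TangentStructure C'}

theorem α_proj (M : StrongTangentMorphism S S') (A : C) :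
    (M.α A).hom ≫ S'.p (M.F.obj A) = M.F.map (S.p A) := by
  simpa using (M.additive A).proj

theorem α_zero (M : StrongTangentMorphism S S') (A : C) :
    M.F.map (S.zero A) ≫ (M.α A).hom = S'.zero (M.F.obj A) := by
  simpa using (M.additive A).zero

/-- The preservation of the universality of the vertical lift follows from the other data. -/
theorem preserved_lift_of (F : C ⥤ D) (α : ∀ A, F.obj (S.T.obj A) ≅ S'.T.obj (F.obj A))
    (α_natural : ∀ {A B : C} (f : A ⟶ B),
      F.map (S.T.map f) ≫ (α B).hom = (α A).hom ≫ S'.T.map (F.map f))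
    (preserved : ∀ A, (S.bundle A).PreservedBy F)
    (additive : ∀ A, IsAdditiveBundleHom ((S.bundle A).map F (preserved A))
      (S'.bundle (F.obj A)) (𝟙 (F.obj A)) (α A).hom)
    (lift : ∀ A, F.map (S.l A) ≫ (α (S.T.obj A)).hom ≫ S'.T.map (α A).hom =
      (α A).hom ≫ S'.l (F.obj A)) (A : C) :
    IsPullback (F.map (S.phi A)) (F.map ((S.bundle A).base 2))
      (F.map (S.T.map (S.p A))) (F.map (S.zero A)) := by
  have hw : F.map (S.p A) ≫ 𝟙 (F.obj A) = (α A).hom ≫ S'.p (F.obj A) := (additive A).proj.symm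
  obtain ⟨e, he, he'⟩ := ((S.bundle A).map F (preserved A)).toFibrePowers.exists_powIso
    (S'.bundle (F.obj A)).toFibrePowers (Iso.refl _) (α A) hw 2
  have hz (A : C) : F.map (S.zero A) ≫ (α A).hom = S'.zero (F.obj A) := by
    simpa using (additive A).zero
  have hp : (α A).hom ≫ S'.p (F.obj A) = F.map (S.p A) := by
    simpa using (additive A).proj
  have h1 : ((S.bundle A).map F (preserved A)).PreservedBy S'.T :=
    (S'.preservedT (F.obj A)).of_iso _ (Iso.refl _) (α A) hw
  have h2 : (S.bundle A).PreservedBy (S.T ⋙ F) :=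
    FibrePowers.PreservedBy.of_natIso (H := F ⋙ S'.T) h1 α α_natural
  let β : F.obj (S.T.obj (S.T.obj A)) ≅ S'.T.obj (S'.T.obj (F.obj A)) :=
    α (S.T.obj A) ≪≫ S'.T.mapIso (α A)
  have hadd : IsAdditiveBundleHom ((S.mapBundle A).map F h2) (S'.mapBundle (F.obj A))
      ((α A).hom ≫ S'.T.map (𝟙 (F.obj A))) β.hom :=
    (IsAdditiveBundleHom.of_nat (S.bundle A) (G := S.T ⋙ F) (H := F ⋙ S'.T) h2 h1
      (fun A => (α A).hom) α_natural).comp ((additive A).map S'.T h1 (S'.preservedT _))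
  have hphi : F.map (S.phi A) ≫ β.hom = e.hom ≫ S'.phi (F.obj A) := by
    rw [TangentStructure.phi, (S.mapBundle A).map_plus F h2, hadd.plus, TangentStructure.phi,
      AdditiveBundle.comp_plus]
    have e1 : F.map ((S.bundle A).proj 2 0 ≫ S.l A) ≫ β.hom =
        e.hom ≫ (S'.bundle (F.obj A)).proj 2 0 ≫ S'.l (F.obj A) := by
      rw [reassoc_of% (he' 0), F.map_comp, Category.assoc, ← lift]
      rfl
    have e2 : F.map ((S.bundle A).proj 2 1 ≫ S.zero (S.T.obj A)) ≫ β.hom =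
        e.hom ≫ (S'.bundle (F.obj A)).proj 2 1 ≫ S'.zero (S'.T.obj (F.obj A)) := by
      rw [reassoc_of% (he' 1), F.map_comp, Category.assoc, ← (S'.bundle_natural (α A).hom).zero,
        show (S'.bundle (F.obj (S.T.obj A))).zero = _ from (hz (S.T.obj A)).symm]
      simp [β]
    congr 1
  refine (S'.isPullback (F.obj A)).of_iso e.symm β.symm (Iso.refl _) (α A).symm ?_ ?_ ?_ ?_
  · rw [Iso.symm_hom, Iso.symm_hom, Iso.eq_inv_comp, ← reassoc_of% hphi, Iso.hom_inv_id,
      Category.comp_id]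
  · rw [Iso.symm_hom, Iso.eq_inv_comp, Iso.refl_hom, Category.comp_id, he]
    exact Category.comp_id _
  · rw [Iso.symm_hom, Iso.symm_hom, Iso.eq_inv_comp, ← Category.assoc, Iso.comp_inv_eq,
      α_natural, ← hp, S'.T.map_comp]
    simp [β]
  · rw [Iso.symm_hom, Iso.refl_hom, Category.id_comp, Iso.comp_inv_eq, hz]

/-- A strong tangent morphism from all the data but the preservation of the universality of the
vertical lift, which is automatic. -/
abbrev mk' (F : C ⥤ D) (α : ∀ A, F.obj (S.T.obj A) ≅ S'.T.obj (F.obj A))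
    (α_natural : ∀ {A B : C} (f : A ⟶ B),
      F.map (S.T.map f) ≫ (α B).hom = (α A).hom ≫ S'.T.map (F.map f))
    (preserved : ∀ A, (S.bundle A).PreservedBy F)
    (additive : ∀ A, IsAdditiveBundleHom ((S.bundle A).map F (preserved A))
      (S'.bundle (F.obj A)) (𝟙 (F.obj A)) (α A).hom)
    (lift : ∀ A, F.map (S.l A) ≫ (α (S.T.obj A)).hom ≫ S'.T.map (α A).hom =
      (α A).hom ≫ S'.l (F.obj A))
    (flip : ∀ A, F.map (S.c A) ≫ (α (S.T.obj A)).hom ≫ S'.T.map (α A).hom =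
      (α (S.T.obj A)).hom ≫ S'.T.map (α A).hom ≫ S'.c (F.obj A)) :
    StrongTangentMorphism S S' where
  F := F
  α := α
  α_natural := α_natural
  preserved := preserved
  preserved_lift := preserved_lift_of F α α_natural preserved additive lift
  additive := additive
  lift := lift
  flip := flip

/-- Two strong tangent morphisms are equal as soon as their functors and their distributive laws
agree. -/
theorem ext_of (M N : StrongTangentMorphism S S') (hF : M.F = N.F)
    (hα : ∀ A, (M.α A).hom = eqToHom (by rw [hF]) ≫ (N.α A).hom ≫ eqToHom (by rw [hF])) :
    M = N := by
  obtain ⟨F, α, _, _, _, _, _, _⟩ := M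
  obtain ⟨G, β, _, _, _, _, _, _⟩ := N
  dsimp only at hF
  subst hF
  obtain rfl : α = β := by
    funext A
    ext
    simpa using hα A
  rfl

/-- The identity tangent morphism. -/
abbrev id (S : TangentStructure C) : StrongTangentMorphism S S :=
  mk' (𝟭 C) (fun _ => Iso.refl _) (fun _ => by simp) (fun A n => (S.bundle A).isFibrePower n)
    (fun A => IsAdditiveBundleHom.id) (fun A => by simp) (fun A => by simp)

/-- The composite of two strong tangent morphisms. -/
abbrev comp (M : StrongTangentMorphism S S') (N : StrongTangentMorphism S' S'') :
    StrongTangentMorphism S S'' :=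
  have h (A : C) : ((S.bundle A).map M.F (M.preserved A)).PreservedBy N.F :=
    (N.preserved (M.F.obj A)).of_iso _ (Iso.refl _) (M.α A) (M.additive A).proj.symm
  mk' (M.F ⋙ N.F) (fun A => N.F.mapIso (M.α A) ≪≫ N.α (M.F.obj A))
    (fun f => by
      simp only [Functor.comp_map, Iso.trans_hom, Functor.mapIso_hom, Category.assoc,
        ← N.α_natural]
      rw [← N.F.map_comp_assoc, M.α_natural, N.F.map_comp_assoc])
    h
    (fun A => by
      have := ((M.additive A).map N.F (h A) (N.preserved _)).comp (N.additive (M.F.obj A))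
      rw [Category.comp_id, N.F.map_id] at this
      exact this)
    (fun A => by
      simp only [Functor.comp_map, Functor.comp_obj, Iso.trans_hom, Functor.mapIso_hom,
        Category.assoc, S''.T.map_comp]
      rw [← N.lift, ← reassoc_of% (N.α_natural (M.α A).hom), ← N.F.map_comp_assoc, ← N.F.map_comp_assoc,
        Category.assoc, M.lift, N.F.map_comp_assoc])
    (fun A => by
      simp only [Functor.comp_map, Functor.comp_obj, Iso.trans_hom, Functor.mapIso_hom,
        Category.assoc, S''.T.map_comp]
      rw [← reassoc_of% (N.α_natural (M.α A).hom), ← reassoc_of% (N.α_natural (M.α A).hom),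
        ← N.flip, ← N.F.map_comp_assoc,
        ← N.F.map_comp_assoc, Category.assoc, M.flip]
      simp only [N.F.map_comp, Category.assoc])

/-- A strong tangent morphism is strict if its distributive law is the identity. -/
def IsStrict (M : StrongTangentMorphism S S') : Prop :=
  ∀ A, ∃ h : M.F.obj (S.T.obj A) = S'.T.obj (M.F.obj A), (M.α A).hom = eqToHom h

end StrongTangentMorphism

/-- A 2-morphism of tangent categories: a natural transformation compatible with the distributive
laws. -/
@[ext]
structure TangentTransformation {S : TangentStructure C} {S' : TangentStructure D}
    (M N : StrongTangentMorphism S S') where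
  τ : M.F ⟶ N.F
  compat (A : C) : τ.app (S.T.obj A) ≫ (N.α A).hom = (M.α A).hom ≫ S'.T.map (τ.app A)

end TangentStructures

set_option linter.checkUnivs false in
/-- A tangent category, bundled. -/
structure TngCat : Type (max (u + 1) (v + 1)) where
  carrier : Type u
  [cat : Category.{v} carrier]
  str : TangentStructure carrier

attribute [instance] TngCat.cat

namespace TangentTransformation

variable {C : Type u₁} [Category.{v₁} C] {D : Type u₂} [Category.{v₂} D]
  {C' : Type u₃} [Category.{v₃} C'] {S : TangentStructure C} {S' : TangentStructure D}
  {S'' : TangentStructure C'}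

abbrev id (M : StrongTangentMorphism S S') : TangentTransformation M M :=
  ⟨𝟙 M.F, fun A => by simp⟩

abbrev comp {M N P : StrongTangentMorphism S S'} (σ : TangentTransformation M N)
    (τ : TangentTransformation N P) : TangentTransformation M P :=
  ⟨σ.τ ≫ τ.τ, fun A => by
    rw [NatTrans.comp_app, NatTrans.comp_app, Category.assoc, τ.compat, reassoc_of% (σ.compat A),
      S'.T.map_comp]⟩

abbrev whiskerLeft (M : StrongTangentMorphism S S') {N P : StrongTangentMorphism S' S''}
    (σ : TangentTransformation N P) : TangentTransformation (M.comp N) (M.comp P) :=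
  ⟨Functor.whiskerLeft M.F σ.τ, fun A => by
    have h : σ.τ.app (M.F.obj (S.T.obj A)) ≫ P.F.map (M.α A).hom ≫ (P.α (M.F.obj A)).hom =
        (N.F.map (M.α A).hom ≫ (N.α (M.F.obj A)).hom) ≫ S''.T.map (σ.τ.app (M.F.obj A)) := by
      rw [Category.assoc, ← σ.compat, NatTrans.naturality_assoc]
    exact h⟩

abbrev whiskerRight {M N : StrongTangentMorphism S S'} (σ : TangentTransformation M N)
    (P : StrongTangentMorphism S' S'') : TangentTransformation (M.comp P) (N.comp P) :=
  ⟨Functor.whiskerRight σ.τ P.F, fun A => by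
    have h : P.F.map (σ.τ.app (S.T.obj A)) ≫ P.F.map (N.α A).hom ≫ (P.α (N.F.obj A)).hom =
        (P.F.map (M.α A).hom ≫ (P.α (M.F.obj A)).hom) ≫ S''.T.map (P.F.map (σ.τ.app A)) := by
      rw [Category.assoc, ← P.α_natural, ← P.F.map_comp_assoc, ← P.F.map_comp_assoc, σ.compat]
    exact h⟩

end TangentTransformation

/-- The category of strong tangent morphisms between two tangent categories. -/
instance {C : Type u₁} [Category.{v₁} C] {D : Type u₂} [Category.{v₂} D]
    (S : TangentStructure C) (S' : TangentStructure D) : Category (StrongTangentMorphism S S') where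
  Hom := TangentTransformation
  id := TangentTransformation.id
  comp := TangentTransformation.comp

section

variable {C : Type u₁} [Category.{v₁} C] {D : Type u₂} [Category.{v₂} D]
  {S : TangentStructure C} {S' : TangentStructure D}

@[simp]
theorem id_τ (M : StrongTangentMorphism S S') : TangentTransformation.τ (𝟙 M) = 𝟙 M.F := rfl

@[simp]
theorem comp_τ {M N P : StrongTangentMorphism S S'} (σ : M ⟶ N) (τ : N ⟶ P) :
    TangentTransformation.τ (σ ≫ τ) = TangentTransformation.τ σ ≫ TangentTransformation.τ τ := rfl

theorem eqToHom_τ {M N : StrongTangentMorphism S S'} (h : M = N) :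
    TangentTransformation.τ (eqToHom h) = eqToHom (by rw [h]) := by
  subst h
  rfl

theorem eqToHom_τ_app {M N : StrongTangentMorphism S S'} (h : M = N) (A : C) :
    (TangentTransformation.τ (eqToHom h)).app A = eqToHom (by rw [h]) := by
  subst h
  rfl

theorem hom_ext_τ {M N : StrongTangentMorphism S S'} {σ τ : M ⟶ N}
    (h : ∀ A, (TangentTransformation.τ σ).app A = (TangentTransformation.τ τ).app A) : σ = τ :=
  TangentTransformation.ext (NatTrans.ext (funext h))

end

theorem StrongTangentMorphism.id_comp' {C : Type u₁} [Category.{v₁} C] {D : Type u₂}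
    [Category.{v₂} D] {S : TangentStructure C} {S' : TangentStructure D}
    (M : StrongTangentMorphism S S') : (StrongTangentMorphism.id S).comp M = M :=
  StrongTangentMorphism.ext_of _ _ rfl (fun A => by simp)

theorem StrongTangentMorphism.comp_id' {C : Type u₁} [Category.{v₁} C] {D : Type u₂}
    [Category.{v₂} D] {S : TangentStructure C} {S' : TangentStructure D}
    (M : StrongTangentMorphism S S') : M.comp (StrongTangentMorphism.id S') = M :=
  StrongTangentMorphism.ext_of _ _ rfl (fun A => by simp)

theorem StrongTangentMorphism.assoc' {A B C D : TngCat.{v, u}}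
    (M : StrongTangentMorphism A.str B.str) (N : StrongTangentMorphism B.str C.str)
    (P : StrongTangentMorphism C.str D.str) :
    (M.comp N).comp P = M.comp (N.comp P) :=
  StrongTangentMorphism.ext_of _ _ rfl (fun A => by simp)

/-- The 2-category of tangent categories, strong tangent morphisms and tangent transformations. -/
instance : Bicategory TngCat.{v, u} where
  Hom A B := StrongTangentMorphism A.str B.str
  id A := StrongTangentMorphism.id A.str
  comp M N := M.comp N
  homCategory A B := inferInstance
  whiskerLeft M _ _ σ := TangentTransformation.whiskerLeft M σ
  whiskerRight σ P := TangentTransformation.whiskerRight σ P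
  associator M N P := eqToIso (M.assoc' N P)
  leftUnitor M := eqToIso M.id_comp'
  rightUnitor M := eqToIso M.comp_id'
  whiskerLeft_id _ _ := hom_ext_τ fun _ => rfl
  whiskerLeft_comp _ _ _ _ _ _ := hom_ext_τ fun _ => rfl
  id_whiskerLeft σ := hom_ext_τ fun A => by simp [eqToHom_τ_app]
  comp_whiskerLeft _ _ _ _ σ := hom_ext_τ fun A => by simp [eqToHom_τ_app]
  id_whiskerRight _ P := hom_ext_τ fun _ => P.F.map_id _
  comp_whiskerRight _ _ P := hom_ext_τ fun _ => P.F.map_comp _ _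
  whiskerRight_id σ := hom_ext_τ fun A => by simp [eqToHom_τ_app]
  whiskerRight_comp σ _ _ := hom_ext_τ fun A => by simp [eqToHom_τ_app]
  whisker_assoc _ _ _ _ _ := hom_ext_τ fun A => by simp [eqToHom_τ_app]
  whisker_exchange σ τ := hom_ext_τ fun A => (τ.τ.naturality (σ.τ.app A)).symm
  pentagon _ _ _ _ := hom_ext_τ fun A => by simp [eqToHom_τ_app]
  triangle _ _ := hom_ext_τ fun A => by simp [eqToHom_τ_app]

instance : Bicategory.Strict TngCat.{v, u} where
  id_comp M := StrongTangentMorphism.id_comp' M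
  comp_id M := StrongTangentMorphism.comp_id' M
  assoc M N P := StrongTangentMorphism.assoc' M N P
  leftUnitor_eqToIso _ := rfl
  rightUnitor_eqToIso _ := rfl
  associator_eqToIso _ _ _ := rfl

section TwoMonads

open Bicategory

variable {K : Type u} [Bicategory.{v₂, v} K] [Bicategory.Strict K]

/-- An object of the slice of a 2-category over `X`. -/
structure Slice {K : Type u} [Bicategory.{v₂, v} K] (X : K) where
  dom : K
  hom : dom ⟶ X

namespace Slice

variable {X : K}

/-- A 1-morphism of the slice: a strictly commutative triangle. -/
@[ext]
structure Hom (A B : Slice X) where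
  f : A.dom ⟶ B.dom
  w : f ≫ B.hom = A.hom

/-- A 2-morphism of the slice: a 2-morphism which becomes an identity over `X`. -/
@[ext]
structure Hom₂ {A B : Slice X} (f g : Hom A B) where
  τ : f.f ⟶ g.f
  w : τ ▷ B.hom = eqToHom (f.w.trans g.w.symm)

instance (A B : Slice X) : Category (Hom A B) where
  Hom f g := Hom₂ f g
  id f := ⟨𝟙 f.f, by simp⟩
  comp σ τ := ⟨σ.τ ≫ τ.τ, by rw [comp_whiskerRight, σ.w, τ.w, eqToHom_trans]⟩

@[simp]
theorem id_τ {A B : Slice X} (f : Hom A B) : Hom₂.τ (𝟙 f) = 𝟙 f.f := rfl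

@[simp]
theorem comp_τ {A B : Slice X} {f g h : Hom A B} (σ : f ⟶ g) (τ : g ⟶ h) :
    Hom₂.τ (σ ≫ τ) = Hom₂.τ σ ≫ Hom₂.τ τ := rfl

@[ext]
theorem hom₂_ext {A B : Slice X} {f g : Hom A B} {σ τ : f ⟶ g} (h : Hom₂.τ σ = Hom₂.τ τ) :
    σ = τ := Hom₂.ext h

@[simp]
theorem eqToHom_τ {A B : Slice X} {f g : Hom A B} (h : f = g) :
    Hom₂.τ (eqToHom h) = eqToHom (congrArg Hom.f h) := by
  subst h
  rfl

/-- Composition of 1-morphisms of the slice. -/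
abbrev Hom.comp {A B C : Slice X} (f : Hom A B) (g : Hom B C) : Hom A C :=
  ⟨f.f ≫ g.f, by rw [Strict.assoc, g.w, f.w]⟩

theorem whiskerRight_eq {A B : K} {h h' : B ⟶ X} (e : h = h') {f g : A ⟶ B} {w : f ≫ h' = g ≫ h'}
    (τ : f ⟶ g) (hτ : τ ▷ h' = eqToHom w) : τ ▷ h = eqToHom (by rw [e, w]) := by
  subst e
  exact hτ

/-- The slice 2-category `K / X`. -/
instance : Bicategory (Slice X) where
  Hom := Hom
  id A := ⟨𝟙 A.dom, Strict.id_comp _⟩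
  comp f g := f.comp g
  homCategory A B := inferInstance
  whiskerLeft f _ _ σ := ⟨f.f ◁ σ.τ, by
    rw [whisker_assoc, σ.w]
    simp [Strict.associator_eqToIso]⟩
  whiskerRight {_ _ _ f g} σ h := ⟨σ.τ ▷ h.f, by
    have := whiskerRight_eq h.w σ.τ σ.w
    rw [whiskerRight_comp] at this
    rw [← cancel_epi (α_ _ _ _).inv, ← cancel_mono (α_ _ _ _).hom, Category.assoc, this]
    simp [Strict.associator_eqToIso]⟩
  associator f g h := eqToIso (Hom.ext (Strict.assoc f.f g.f h.f))
  leftUnitor f := eqToIso (Hom.ext (Strict.id_comp f.f))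
  rightUnitor f := eqToIso (Hom.ext (Strict.comp_id f.f))
  whiskerLeft_id _ _ := by ext; simp
  whiskerLeft_comp _ _ _ _ _ _ := by ext; simp
  id_whiskerLeft _ := by ext; simp [Strict.leftUnitor_eqToIso]
  comp_whiskerLeft _ _ _ _ _ := by ext; simp [Strict.associator_eqToIso]
  id_whiskerRight _ _ := by ext; simp
  comp_whiskerRight _ _ _ := by ext; simp
  whiskerRight_id _ := by ext; simp [Strict.rightUnitor_eqToIso]
  whiskerRight_comp _ _ _ := by ext; simp [Strict.associator_eqToIso]
  whisker_assoc _ _ _ _ _ := by ext; simp [Strict.associator_eqToIso]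
  whisker_exchange _ _ := by ext; simp [whisker_exchange]
  pentagon _ _ _ _ := by ext; simp
  triangle _ _ := by ext; simp

instance : Bicategory.Strict (Slice X) where
  id_comp f := Hom.ext (Strict.id_comp f.f)
  comp_id f := Hom.ext (Strict.comp_id f.f)
  assoc f g h := Hom.ext (Strict.assoc f.f g.f h.f)
  leftUnitor_eqToIso _ := rfl
  rightUnitor_eqToIso _ := rfl
  associator_eqToIso _ _ _ := rfl

end Slice

/-- A (strict) 2-monad on a 2-category: a 2-functor `M` with 2-natural transformations
`η : id ⟶ M` and `μ : M² ⟶ M` satisfying the monad laws. -/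
structure TwoMonad (K : Type u) [Bicategory.{v₂, v} K] [Bicategory.Strict K] where
  M : StrictPseudofunctor K K
  η (A : K) : A ⟶ M.obj A
  η_nat {A B : K} (f : A ⟶ B) : f ≫ η B = η A ≫ M.map f
  η_nat₂ {A B : K} {f g : A ⟶ B} (τ : f ⟶ g) :
    τ ▷ η B ≫ eqToHom (η_nat g) = eqToHom (η_nat f) ≫ η A ◁ M.map₂ τ
  μ (A : K) : M.obj (M.obj A) ⟶ M.obj A
  μ_nat {A B : K} (f : A ⟶ B) : M.map (M.map f) ≫ μ B = μ A ≫ M.map f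
  μ_nat₂ {A B : K} {f g : A ⟶ B} (τ : f ⟶ g) :
    M.map₂ (M.map₂ τ) ▷ μ B ≫ eqToHom (μ_nat g) = eqToHom (μ_nat f) ≫ μ A ◁ M.map₂ τ
  left_unit (A : K) : η (M.obj A) ≫ μ A = 𝟙 (M.obj A)
  right_unit (A : K) : M.map (η A) ≫ μ A = 𝟙 (M.obj A)
  assoc (A : K) : M.map (μ A) ≫ μ A = μ (M.obj A) ≫ μ A

namespace TwoMonad

variable (T : TwoMonad K)

theorem eq₁ {A : K} (c : T.M.obj A ⟶ A) :
    c ≫ T.η A ≫ c = T.η (T.M.obj A) ≫ T.M.map c ≫ c := by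
  rw [← Strict.assoc, T.η_nat, Strict.assoc]

theorem eq₂ {A : K} (c : T.M.obj A ⟶ A) : T.η (T.M.obj A) ≫ T.μ A ≫ c = c := by
  rw [← Strict.assoc, T.left_unit, Strict.id_comp]

theorem eq₃ {A : K} (c : T.M.obj A ⟶ A) : c = T.M.map (𝟙 A) ≫ c := by
  rw [T.M.map_id, Strict.id_comp]

theorem eq₄ {A B : K} (f : B ⟶ T.M.obj A) (c : T.M.obj A ⟶ A) :
    T.M.map (f ≫ c) ≫ c = T.M.map f ≫ T.M.map c ≫ c := by
  rw [T.M.map_comp, Strict.assoc]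

theorem eq₅ {A : K} (c : T.M.obj A ⟶ A) : T.M.map (T.η A) ≫ T.μ A ≫ c = c := by
  rw [← Strict.assoc, T.right_unit, Strict.id_comp]

theorem eq₆ {A : K} (c : T.M.obj A ⟶ A) :
    T.M.map (T.μ A) ≫ T.μ A ≫ c = T.μ (T.M.obj A) ≫ T.μ A ≫ c := by
  rw [← Strict.assoc, T.assoc, Strict.assoc]

theorem eq₇ {A : K} (c : T.M.obj A ⟶ A) :
    T.M.map (T.M.map c) ≫ T.μ A ≫ c = T.μ (T.M.obj A) ≫ T.M.map c ≫ c := by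
  rw [← Strict.assoc, T.μ_nat, Strict.assoc]

/-- The structure of a pseudoalgebra of a 2-monad on an object. The 2-morphisms `eqToHom` are
identities between 1-morphisms which are equal by the laws of the 2-monad. -/
structure PseudoalgebraStructure (A : K) where
  c : T.M.obj A ⟶ A
  ζ : 𝟙 A ≅ T.η A ≫ c
  θ : T.M.map c ≫ c ≅ T.μ A ≫ c
  left_unit :
    eqToHom (Strict.comp_id c).symm ≫ c ◁ ζ.hom ≫ eqToHom (T.eq₁ c) ≫
      T.η (T.M.obj A) ◁ θ.hom ≫ eqToHom (T.eq₂ c) = 𝟙 c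
  right_unit :
    eqToHom (T.eq₃ c) ≫ T.M.map₂ ζ.hom ▷ c ≫ eqToHom (T.eq₄ (T.η A) c) ≫
      T.M.map (T.η A) ◁ θ.hom ≫ eqToHom (T.eq₅ c) = 𝟙 c
  assoc :
    T.M.map₂ θ.hom ▷ c ≫ eqToHom (T.eq₄ (T.μ A) c) ≫ T.M.map (T.μ A) ◁ θ.hom ≫
        eqToHom (T.eq₆ c) =
      eqToHom (T.eq₄ (T.M.map c) c) ≫ T.M.map (T.M.map c) ◁ θ.hom ≫ eqToHom (T.eq₇ c) ≫
        T.μ (T.M.obj A) ◁ θ.hom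

/-- A pseudoalgebra of a 2-monad. -/
structure Pseudoalgebra where
  obj : K
  str : T.PseudoalgebraStructure obj

end TwoMonad

end TwoMonads

section CommaCategories

variable {C : Type u₁} [Category.{v₁} C] {D : Type u₂} [Category.{v₂} D] {F : D ⥤ C}
  {C' : Type u₃} [Category.{v₃} C']

/-- The object `f : A ⟶ F E` of the comma category `C ↓ F`. -/
abbrev mkObj {A : C} {E : D} (f : A ⟶ F.obj E) : Comma (𝟭 C) F := ⟨A, E, f⟩

/-- The structure morphism of an object of the comma category. -/
def arr (X : Comma (𝟭 C) F) : X.left ⟶ F.obj X.right := X.hom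

/-- The morphism of the comma category with components `a` and `e`. -/
abbrev mkHom {X Y : Comma (𝟭 C) F} (a : X.left ⟶ Y.left) (e : X.right ⟶ Y.right)
    (w : a ≫ arr Y = arr X ≫ F.map e) : X ⟶ Y := ⟨a, e, w⟩

theorem arr_w {X Y : Comma (𝟭 C) F} (f : X ⟶ Y) : f.left ≫ arr Y = arr X ≫ F.map f.right := f.w

@[simp]
theorem mkObj_left {A : C} {E : D} (f : A ⟶ F.obj E) : (mkObj f).left = A := rfl

@[simp]
theorem mkObj_right {A : C} {E : D} (f : A ⟶ F.obj E) : (mkObj f).right = E := rfl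

@[simp]
theorem arr_mkObj {A : C} {E : D} (f : A ⟶ F.obj E) : arr (mkObj f) = f := rfl

@[simp]
theorem mkHom_left {X Y : Comma (𝟭 C) F} (a : X.left ⟶ Y.left) (e : X.right ⟶ Y.right)
    (w : a ≫ arr Y = arr X ≫ F.map e) : (mkHom a e w).left = a := rfl

@[simp]
theorem mkHom_right {X Y : Comma (𝟭 C) F} (a : X.left ⟶ Y.left) (e : X.right ⟶ Y.right)
    (w : a ≫ arr Y = arr X ≫ F.map e) : (mkHom a e w).right = e := rfl

/-- An isomorphism of the comma category. -/
def mkIso {X Y : Comma (𝟭 C) F} (a : X.left ≅ Y.left) (e : X.right ≅ Y.right)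
    (w : a.hom ≫ arr Y = arr X ≫ F.map e.hom) : X ≅ Y where
  hom := mkHom a.hom e.hom w
  inv := mkHom a.inv e.inv (by
    rw [Iso.inv_comp_eq, ← Category.assoc, w, Category.assoc, ← F.map_comp, Iso.hom_inv_id,
      F.map_id, Category.comp_id])
  hom_inv_id := Comma.hom_ext _ _ a.hom_inv_id e.hom_inv_id
  inv_hom_id := Comma.hom_ext _ _ a.inv_hom_id e.inv_hom_id

@[simp]
theorem mkIso_hom_left {X Y : Comma (𝟭 C) F} (a : X.left ≅ Y.left) (e : X.right ≅ Y.right)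
    (w : a.hom ≫ arr Y = arr X ≫ F.map e.hom) : (mkIso a e w).hom.left = a.hom := rfl

@[simp]
theorem mkIso_hom_right {X Y : Comma (𝟭 C) F} (a : X.left ≅ Y.left) (e : X.right ≅ Y.right)
    (w : a.hom ≫ arr Y = arr X ≫ F.map e.hom) : (mkIso a e w).hom.right = e.hom := rfl

theorem IsFibrePower.comma {E B P : Comma (𝟭 C) F} {n : ℕ} {q : E ⟶ B} {base : P ⟶ B}
    {proj : Fin n → (P ⟶ E)} (hl : IsFibrePower q.left base.left (fun i => (proj i).left))
    (hr : IsFibrePower q.right base.right (fun i => (proj i).right))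
    (hF : IsFibrePower (F.map q.right) (F.map base.right) (fun i => F.map (proj i).right)) :
    IsFibrePower q base proj := by
  refine .mk' (fun i => ?_) (fun X b a ha => ?_) (fun X w w' h h' => ?_)
  · exact Comma.hom_ext _ _ (hl.condition i) (hr.condition i)
  · obtain ⟨x, hx, hx'⟩ := hl.exists_lift b.left (fun i => (a i).left)
      (fun i => congrArg CommaMorphism.left (ha i))
    obtain ⟨y, hy, hy'⟩ := hr.exists_lift b.right (fun i => (a i).right)
      (fun i => congrArg CommaMorphism.right (ha i))
    refine ⟨mkHom x y (hF.hom_ext ?_ (fun i => ?_)), Comma.hom_ext _ _ hx hy,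
      fun i => Comma.hom_ext _ _ (hx' i) (hy' i)⟩
    · rw [Category.assoc, ← arr_w, reassoc_of% hx, Category.assoc, ← F.map_comp, hy, arr_w]
    · rw [Category.assoc, ← arr_w, reassoc_of% (hx' i), Category.assoc, ← F.map_comp, hy' i, arr_w]
  · refine Comma.hom_ext _ _ (hl.hom_ext (congrArg CommaMorphism.left h)
      (fun i => congrArg CommaMorphism.left (h' i))) (hr.hom_ext (congrArg CommaMorphism.right h)
      (fun i => congrArg CommaMorphism.right (h' i)))

theorem isPullback_comma {P X Y Z : Comma (𝟭 C) F} {f : P ⟶ X} {g : P ⟶ Y} {h : X ⟶ Z}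
    {k : Y ⟶ Z} (hl : IsPullback f.left g.left h.left k.left)
    (hr : IsPullback f.right g.right h.right k.right)
    (hF : IsPullback (F.map f.right) (F.map g.right) (F.map h.right) (F.map k.right)) :
    IsPullback f g h k := by
  refine ⟨⟨Comma.hom_ext _ _ hl.w hr.w⟩, ⟨PullbackCone.IsLimit.mk _ (fun s => mkHom
    (hl.lift s.fst.left s.snd.left (congrArg CommaMorphism.left s.condition))
    (hr.lift s.fst.right s.snd.right (congrArg CommaMorphism.right s.condition))
    (hF.hom_ext ?_ ?_)) ?_ ?_ ?_⟩⟩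
  · rw [Category.assoc, ← arr_w, hl.lift_fst_assoc, Category.assoc, ← F.map_comp, hr.lift_fst,
      arr_w]
  · rw [Category.assoc, ← arr_w, hl.lift_snd_assoc, Category.assoc, ← F.map_comp, hr.lift_snd,
      arr_w]
  · exact fun s => Comma.hom_ext _ _ (hl.lift_fst _ _ _) (hr.lift_fst _ _ _)
  · exact fun s => Comma.hom_ext _ _ (hl.lift_snd _ _ _) (hr.lift_snd _ _ _)
  · intro s m h1 h2
    refine Comma.hom_ext _ _ (hl.hom_ext ?_ ?_) (hr.hom_ext ?_ ?_)
    · exact (congrArg CommaMorphism.left h1).trans (hl.lift_fst _ _ _).symm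
    · exact (congrArg CommaMorphism.left h2).trans (hl.lift_snd _ _ _).symm
    · exact (congrArg CommaMorphism.right h1).trans (hr.lift_fst _ _ _).symm
    · exact (congrArg CommaMorphism.right h2).trans (hr.lift_snd _ _ _).symm

section

variable {E B : Comma (𝟭 C) F} {q : E ⟶ B}

theorem FibrePowers.exists_comma (P : FibrePowers q.left) (Q : FibrePowers q.right)
    (h : Q.PreservedBy F) (n : ℕ) : ∃ w : P.pow n ⟶ F.obj (Q.pow n),
      w ≫ F.map (Q.base n) = P.base n ≫ arr B ∧
        ∀ i, w ≫ F.map (Q.proj n i) = P.proj n i ≫ arr E :=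
  (h n).exists_lift _ _ (fun i => by
    rw [Category.assoc, ← arr_w, reassoc_of% ((P.isFibrePower n).condition i)])

/-- Componentwise `n`-fold pullbacks in the comma category. -/
noncomputable abbrev FibrePowers.comma (P : FibrePowers q.left) (Q : FibrePowers q.right)
    (h : Q.PreservedBy F) : FibrePowers q where
  pow n := mkObj (P.exists_comma Q h n).choose
  base n := mkHom (P.base n) (Q.base n) (P.exists_comma Q h n).choose_spec.1.symm
  proj n i := mkHom (P.proj n i) (Q.proj n i) ((P.exists_comma Q h n).choose_spec.2 i).symm
  isFibrePower n := .comma (P.isFibrePower n) (Q.isFibrePower n) (h n)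

theorem FibrePowers.comma_fst (P : FibrePowers q.left) (Q : FibrePowers q.right)
    (h : Q.PreservedBy F) : (P.comma Q h).PreservedBy (Comma.fst (𝟭 C) F) := P.isFibrePower

theorem FibrePowers.comma_snd (P : FibrePowers q.left) (Q : FibrePowers q.right)
    (h : Q.PreservedBy F) : (P.comma Q h).PreservedBy (Comma.snd (𝟭 C) F) := Q.isFibrePower

theorem FibrePowers.comma_pair_left (P : FibrePowers q.left) (Q : FibrePowers q.right)
    (h : Q.PreservedBy F) {X : Comma (𝟭 C) F} (a b : X ⟶ E) (w : a ≫ q = b ≫ q) :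
    ((P.comma Q h).pair a b w).left =
      P.pair a.left b.left (congrArg CommaMorphism.left w) :=
  (P.comma Q h).map_pair (Comma.fst (𝟭 C) F) (P.comma_fst Q h) a b w

theorem FibrePowers.comma_pair_right (P : FibrePowers q.left) (Q : FibrePowers q.right)
    (h : Q.PreservedBy F) {X : Comma (𝟭 C) F} (a b : X ⟶ E) (w : a ≫ q = b ≫ q) :
    ((P.comma Q h).pair a b w).right =
      Q.pair a.right b.right (congrArg CommaMorphism.right w) :=
  (P.comma Q h).map_pair (Comma.snd (𝟭 C) F) (P.comma_snd Q h) a b w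

/-- Componentwise additive bundles in the comma category. -/
noncomputable abbrev AdditiveBundle.comma (P : AdditiveBundle q.left) (Q : AdditiveBundle q.right)
    (h : Q.PreservedBy F) (hom : IsAdditiveBundleHom P (Q.map F h) (arr B) (arr E)) :
    AdditiveBundle q where
  toFibrePowers := P.toFibrePowers.comma Q.toFibrePowers h
  zero := mkHom P.zero Q.zero hom.zero
  sum := mkHom P.sum Q.sum (by
    have := hom.sum
    rw [← (Q.map F h).eq_pair _ _ _ (P.exists_comma Q.toFibrePowers h 2).choose
      ((P.exists_comma Q.toFibrePowers h 2).choose_spec.2 0)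
      ((P.exists_comma Q.toFibrePowers h 2).choose_spec.2 1)] at this
    exact this)
  zero_proj := Comma.hom_ext _ _ P.zero_proj Q.zero_proj
  sum_proj i := Comma.hom_ext _ _ (P.sum_proj i) (Q.sum_proj i)
  sum_assoc := by
    apply Comma.hom_ext
    · simp only [Comma.comp_left, FibrePowers.comma_pair_left]
      exact P.sum_assoc
    · simp only [Comma.comp_right, FibrePowers.comma_pair_right]
      exact Q.sum_assoc
  zero_sum := by
    apply Comma.hom_ext
    · simp only [Comma.comp_left, FibrePowers.comma_pair_left]
      exact P.zero_sum
    · simp only [Comma.comp_right, FibrePowers.comma_pair_right]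
      exact Q.zero_sum
  sum_comm := by
    apply Comma.hom_ext
    · simp only [Comma.comp_left, FibrePowers.comma_pair_left]
      exact P.sum_comm
    · simp only [Comma.comp_right, FibrePowers.comma_pair_right]
      exact Q.sum_comm

theorem IsAdditiveBundleHom.comma {E' B' : Comma (𝟭 C) F} {q' : E' ⟶ B'} {P : AdditiveBundle q}
    {P' : AdditiveBundle q'} {f : B ⟶ B'} {g : E ⟶ E'}
    (h₁ : P.PreservedBy (Comma.fst (𝟭 C) F)) (h₁' : P'.PreservedBy (Comma.fst (𝟭 C) F))
    (h₂ : P.PreservedBy (Comma.snd (𝟭 C) F)) (h₂' : P'.PreservedBy (Comma.snd (𝟭 C) F))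
    (hl : IsAdditiveBundleHom (P.map _ h₁) (P'.map _ h₁') f.left g.left)
    (hr : IsAdditiveBundleHom (P.map _ h₂) (P'.map _ h₂') f.right g.right) :
    IsAdditiveBundleHom P P' f g := by
  refine .of_plus (Comma.hom_ext _ _ hl.proj hr.proj) (Comma.hom_ext _ _ hl.zero hr.zero)
    (fun w => Comma.hom_ext _ _ ?_ ?_)
  · exact hl.sum.trans (P'.map_plus (Comma.fst (𝟭 C) F) h₁' _ _ w).symm
  · exact hr.sum.trans (P'.map_plus (Comma.snd (𝟭 C) F) h₂' _ _ w).symm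

end

theorem IsAdditiveBundleHom.inv {E B E' : C} {q : E ⟶ B} {q' : E' ⟶ B}
    {P : AdditiveBundle q} {P' : AdditiveBundle q'} (e : E ≅ E')
    (h : IsAdditiveBundleHom P P' (𝟙 B) e.hom) : IsAdditiveBundleHom P' P (𝟙 B) e.inv := by
  have hp : e.hom ≫ q' = q := by simpa using h.proj
  have hz : P.zero ≫ e.hom = P'.zero := by simpa using h.zero
  refine .of_plus (by rw [← hp]; simp) (by rw [← hz]; simp) (fun w => ?_)
  rw [Iso.comp_inv_eq, h.plus, P'.sum_eq_plus]
  simp only [Category.assoc, Iso.inv_hom_id, Category.comp_id]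

end CommaCategories

section CommaTangent

variable {C : Type u₁} [Category.{v₁} C] {D : Type u₂} [Category.{v₂} D]
  {S : TangentStructure C} {S' : TangentStructure D} (R : StrongTangentMorphism S' S)

theorem StrongTangentMorphism.lift_inv (E : D) :
    S.l (R.F.obj E) ≫ S.T.map (R.α E).inv ≫ (R.α (S'.T.obj E)).inv =
      (R.α E).inv ≫ R.F.map (S'.l E) := by
  rw [Iso.eq_inv_comp, ← reassoc_of% (R.lift E), ← reassoc_of% (S.T.map_comp (R.α E).hom)]
  simp

theorem StrongTangentMorphism.flip_inv (E : D) :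
    S.c (R.F.obj E) ≫ S.T.map (R.α E).inv ≫ (R.α (S'.T.obj E)).inv =
      S.T.map (R.α E).inv ≫ (R.α (S'.T.obj E)).inv ≫ R.F.map (S'.c E) := by
  have h := R.flip E
  rw [← cancel_epi (S.T.map (R.α E).hom), ← cancel_epi (R.α (S'.T.obj E)).hom, ← reassoc_of% h]
  simp only [← S.T.map_comp_assoc, Iso.hom_inv_id, S.T.map_id, Category.id_comp, Category.comp_id,
    Iso.hom_inv_id_assoc]

/-- The tangent bundle functor of the comma category: it sends `f : A ⟶ R E` to
`T A ⟶ T R E ⟶ R T' E`. -/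
abbrev commaT : Comma (𝟭 C) R.F ⥤ Comma (𝟭 C) R.F where
  obj X := mkObj (F := R.F) (S.T.map (arr X) ≫ (R.α X.right).inv)
  map {X Y} f := mkHom (S.T.map f.left) (S'.T.map f.right) (by
    have h : S.T.map f.left ≫ S.T.map (arr Y) ≫ (R.α Y.right).inv =
        (S.T.map (arr X) ≫ (R.α X.right).inv) ≫ R.F.map (S'.T.map f.right) := by
      rw [← Category.assoc, Iso.comp_inv_eq, Category.assoc, Category.assoc,
        R.α_natural, Iso.inv_hom_id_assoc, ← S.T.map_comp, ← S.T.map_comp, arr_w]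
    exact h)
  map_id X := Comma.hom_ext _ _ (S.T.map_id _) (S'.T.map_id _)
  map_comp f g := Comma.hom_ext _ _ (S.T.map_comp _ _) (S'.T.map_comp _ _)

theorem iterate_commaT (m : ℕ) : ∀ {E B P : Comma (𝟭 C) R.F} {n : ℕ} {q : E ⟶ B} {base : P ⟶ B}
    {proj : Fin n → (P ⟶ E)}
    (_ : ∀ m, IsFibrePower ((iterate S.T m).map q.left) ((iterate S.T m).map base.left)
      (fun i => (iterate S.T m).map (proj i).left))
    (_ : ∀ m, IsFibrePower ((iterate S'.T m).map q.right) ((iterate S'.T m).map base.right)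
      (fun i => (iterate S'.T m).map (proj i).right))
    (_ : ∀ m, IsFibrePower ((iterate S.T m).map (R.F.map q.right))
      ((iterate S.T m).map (R.F.map base.right))
      (fun i => (iterate S.T m).map (R.F.map (proj i).right))),
    IsFibrePower ((iterate (commaT R) m).map q) ((iterate (commaT R) m).map base)
      (fun i => (iterate (commaT R) m).map (proj i)) := by
  induction m with
  | zero => exact fun hl hr hF => IsFibrePower.comma (hl 0) (hr 0) (hF 0)
  | succ m ih =>
    intro E B P n q base proj hl hr hF
    refine ih (q := (commaT R).map q) (base := (commaT R).map base)
      (proj := fun i => (commaT R).map (proj i)) (fun m => hl (m + 1)) (fun m => hr (m + 1))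
      (fun m => ?_)
    refine (hF (m + 1)).of_iso ((iterate S.T m).mapIso (R.α _)) ((iterate S.T m).mapIso (R.α _))
      ((iterate S.T m).mapIso (R.α _)) ?_ ?_ (fun i => ?_)
    all_goals
      simp only [Functor.mapIso_hom]
      refine ((iterate S.T m).map_comp _ _).symm.trans (Eq.trans ?_ ((iterate S.T m).map_comp _ _))
      exact congrArg (iterate S.T m).map (R.α_natural _)

theorem arr_bundle (X : Comma (𝟭 C) R.F) :
    IsAdditiveBundleHom (S.bundle X.left) ((S'.bundle X.right).map R.F (R.preserved _)) (arr X)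
      (S.T.map (arr X) ≫ (R.α X.right).inv) := by
  have := (S.bundle_natural (arr X)).comp ((R.additive X.right).inv)
  rw [Category.comp_id] at this
  exact this

/-- The projection of the tangent structure of the comma category. -/
abbrev commaP (X : Comma (𝟭 C) R.F) : (commaT R).obj X ⟶ X :=
  mkHom (S.p X.left) (S'.p X.right) (arr_bundle R X).proj.symm

/-- The additive bundles of the comma category. -/
noncomputable abbrev commaBundle (X : Comma (𝟭 C) R.F) : AdditiveBundle (commaP R X) :=
  AdditiveBundle.comma (q := commaP R X) (S.bundle X.left) (S'.bundle X.right) (R.preserved _)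
    (arr_bundle R X)

theorem commaBundle_preserved (m : ℕ) (X : Comma (𝟭 C) R.F) :
    (commaBundle R X).PreservedBy (iterate (commaT R) m) := by
  intro n
  refine iterate_commaT R m (fun m => ?_) (fun m => ?_) (fun m => ?_)
  · cases m with
    | zero => exact (S.bundle X.left).isFibrePower n
    | succ m => exact S.preserved m _ n
  · cases m with
    | zero => exact (S'.bundle X.right).isFibrePower n
    | succ m => exact S'.preserved m _ n
  · have h : (S.bundle (R.F.obj X.right)).PreservedBy (iterate S.T m) := by
      cases m with
      | zero => exact (S.bundle (R.F.obj X.right)).isFibrePower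
      | succ m => exact S.preserved m _
    exact h.of_iso ((S'.bundle X.right).map R.F (R.preserved _)).toFibrePowers (Iso.refl _)
      (R.α X.right) (R.additive X.right).proj.symm n

/-- The image of the additive bundle `commaBundle` under the tangent bundle functor. -/
noncomputable abbrev commaTBundle (X : Comma (𝟭 C) R.F) :
    AdditiveBundle ((commaT R).map (commaP R X)) :=
  (commaBundle R X).map (commaT R) (commaBundle_preserved R 1 X)

theorem commaTBundle_plus_left (X : Comma (𝟭 C) R.F) {Y : Comma (𝟭 C) R.F}
    (a b : Y ⟶ (commaT R).obj ((commaT R).obj X))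
    (w : a ≫ (commaT R).map (commaP R X) = b ≫ (commaT R).map (commaP R X)) :
    ((commaTBundle R X).plus a b w).left =
      (S.mapBundle X.left).plus a.left b.left (congrArg CommaMorphism.left w) :=
  AdditiveBundle.map_plus (commaTBundle R X) (Comma.fst (𝟭 C) R.F) (S.preservedT X.left) a b w

theorem commaTBundle_plus_right (X : Comma (𝟭 C) R.F) {Y : Comma (𝟭 C) R.F}
    (a b : Y ⟶ (commaT R).obj ((commaT R).obj X))
    (w : a ≫ (commaT R).map (commaP R X) = b ≫ (commaT R).map (commaP R X)) :
    ((commaTBundle R X).plus a b w).right =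
      (S'.mapBundle X.right).plus a.right b.right (congrArg CommaMorphism.right w) :=
  AdditiveBundle.map_plus (commaTBundle R X) (Comma.snd (𝟭 C) R.F) (S'.preservedT X.right) a b w

/-- The tangent structure of the comma category. -/
noncomputable def commaTangent : TangentStructure (Comma (𝟭 C) R.F) where
  T := commaT R
  p := commaP R
  bundle := commaBundle R
  preserved m X := commaBundle_preserved R (m + 1) X
  bundle_natural {X Y} f := .comma (S.bundle X.left).isFibrePower (S.bundle Y.left).isFibrePower
    (S'.bundle X.right).isFibrePower (S'.bundle Y.right).isFibrePower
    (S.bundle_natural f.left) (S'.bundle_natural f.right)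
  l X := mkHom (S.l X.left) (S'.l X.right) (by
    have h : S.l X.left ≫ S.T.map (S.T.map (arr X) ≫ (R.α X.right).inv) ≫
          (R.α (S'.T.obj X.right)).inv =
        (S.T.map (arr X) ≫ (R.α X.right).inv) ≫ R.F.map (S'.l X.right) := by
      rw [S.T.map_comp, Category.assoc, ← reassoc_of% (S.l_natural (arr X)), Category.assoc,
        R.lift_inv]
    exact h)
  l_natural f := Comma.hom_ext _ _ (S.l_natural _) (S'.l_natural _)
  c X := mkHom (S.c X.left) (S'.c X.right) (by
    have h : S.c X.left ≫ S.T.map (S.T.map (arr X) ≫ (R.α X.right).inv) ≫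
          (R.α (S'.T.obj X.right)).inv =
        (S.T.map (S.T.map (arr X) ≫ (R.α X.right).inv) ≫ (R.α (S'.T.obj X.right)).inv) ≫
          R.F.map (S'.c X.right) := by
      rw [S.T.map_comp, Category.assoc, ← reassoc_of% (S.c_natural (arr X)), Category.assoc,
        Category.assoc, R.flip_inv]
    exact h)
  c_natural f := Comma.hom_ext _ _ (S.c_natural _) (S'.c_natural _)
  lift_additive X := .comma (S.bundle X.left).isFibrePower (S.preservedT X.left)
    (S'.bundle X.right).isFibrePower (S'.preservedT X.right)
    (S.lift_additive X.left) (S'.lift_additive X.right)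
  flip_additive X := .comma (S.preservedT X.left) (S.bundle _).isFibrePower
    (S'.preservedT X.right) (S'.bundle _).isFibrePower
    (S.flip_additive X.left) (S'.flip_additive X.right)
  lift_coassoc X := Comma.hom_ext _ _ (S.lift_coassoc _) (S'.lift_coassoc _)
  flip_flip X := Comma.hom_ext _ _ (S.flip_flip _) (S'.flip_flip _)
  flip_braid X := Comma.hom_ext _ _ (S.flip_braid _) (S'.flip_braid _)
  lift_flip X := Comma.hom_ext _ _ (S.lift_flip _) (S'.lift_flip _)
  lift_flip_flip X := Comma.hom_ext _ _ (S.lift_flip_flip _) (S'.lift_flip_flip _)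
  universal X := by
    refine isPullback_comma ?_ ?_ ?_
    · refine cast (congrArg (fun f => IsPullback f _ _ _) (Eq.symm ?_)) (S.universal X.left)
      exact commaTBundle_plus_left R X _ _ _
    · refine cast (congrArg (fun f => IsPullback f _ _ _) (Eq.symm ?_)) (S'.universal X.right)
      exact commaTBundle_plus_right R X _ _ _
    · refine cast (congrArg (fun f => IsPullback f _ _ _) (Eq.symm ?_))
        (R.preserved_lift X.right)
      exact congrArg R.F.map (commaTBundle_plus_right R X _ _ _)

end CommaTangent

section CommaObject

variable {C : Type u₁} [Category.{v₁} C] {D : Type u₂} [Category.{v₂} D]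
  {C' : Type u₃} [Category.{v₃} C'] {S : TangentStructure C} {S' : TangentStructure D}
  {S'' : TangentStructure C'} (R : StrongTangentMorphism S' S)

/-- The projection of the comma tangent category to the base, a strict tangent morphism. -/
noncomputable def commaFst : StrongTangentMorphism (commaTangent R) S :=
  .mk' (Comma.fst (𝟭 C) R.F) (fun X => Iso.refl (S.T.obj X.left))
    (fun _ => (Category.comp_id _).trans (Category.id_comp _).symm)
    (fun X => (S.bundle X.left).isFibrePower)
    (fun _ => IsAdditiveBundleHom.id)
    (fun X => by
      have : S.l X.left ≫ 𝟙 _ ≫ S.T.map (𝟙 _) = 𝟙 _ ≫ S.l X.left := by simp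
      exact this)
    (fun X => by
      have : S.c X.left ≫ 𝟙 _ ≫ S.T.map (𝟙 _) = 𝟙 _ ≫ S.T.map (𝟙 _) ≫ S.c X.left := by simp
      exact this)

/-- The projection of the comma tangent category to the total category, a strict tangent
morphism. -/
noncomputable def commaSnd : StrongTangentMorphism (commaTangent R) S' :=
  .mk' (Comma.snd (𝟭 C) R.F) (fun X => Iso.refl (S'.T.obj X.right))
    (fun _ => (Category.comp_id _).trans (Category.id_comp _).symm)
    (fun X => (S'.bundle X.right).isFibrePower)
    (fun _ => IsAdditiveBundleHom.id)
    (fun X => by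
      have : S'.l X.right ≫ 𝟙 _ ≫ S'.T.map (𝟙 _) = 𝟙 _ ≫ S'.l X.right := by simp
      exact this)
    (fun X => by
      have : S'.c X.right ≫ 𝟙 _ ≫ S'.T.map (𝟙 _) = 𝟙 _ ≫ S'.T.map (𝟙 _) ≫ S'.c X.right := by simp
      exact this)

/-- The universal 2-morphism of the comma tangent category. -/
noncomputable def commaPsi : TangentTransformation (commaFst R) ((commaSnd R).comp R) where
  τ := { app := fun X => arr X, naturality := fun _ _ f => arr_w f }
  compat X := by
    have : (S.T.map (arr X) ≫ (R.α X.right).inv) ≫ R.F.map (𝟙 _) ≫ (R.α X.right).hom =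
        𝟙 _ ≫ S.T.map (arr X) := by simp
    exact this

variable {R}

/-- The tangent morphism to the comma tangent category induced by a tangent transformation. -/
noncomputable def commaLift (G : StrongTangentMorphism S'' S) (H : StrongTangentMorphism S'' S')
    (φ : TangentTransformation G (H.comp R)) : StrongTangentMorphism S'' (commaTangent R) :=
  .mk'
    { obj := fun Y => mkObj (F := R.F) (E := H.F.obj Y) (φ.τ.app Y)
      map := fun f => mkHom (G.F.map f) (H.F.map f) (φ.τ.naturality f)
      map_id := fun _ => Comma.hom_ext _ _ (G.F.map_id _) (H.F.map_id _)
      map_comp := fun _ _ => Comma.hom_ext _ _ (G.F.map_comp _ _) (H.F.map_comp _ _) }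
    (fun Y => mkIso (X := mkObj (F := R.F) (E := H.F.obj (S''.T.obj Y)) (φ.τ.app (S''.T.obj Y)))
      (Y := (commaT R).obj (mkObj (F := R.F) (E := H.F.obj Y) (φ.τ.app Y))) (G.α Y) (H.α Y) (by
        have h : (G.α Y).hom ≫ S.T.map (φ.τ.app Y) ≫ (R.α (H.F.obj Y)).inv =
            φ.τ.app (S''.T.obj Y) ≫ R.F.map (H.α Y).hom := by
          rw [← Category.assoc, Iso.comp_inv_eq, ← φ.compat, Category.assoc]
          rfl
        exact h))
    (fun f => Comma.hom_ext _ _ (G.α_natural f) (H.α_natural f))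
    (fun Y n => IsFibrePower.comma (G.preserved Y n) (H.preserved Y n) ((H.comp R).preserved Y n))
    (fun Y => .comma (G.preserved Y) (S.bundle _).isFibrePower (H.preserved Y)
      (S'.bundle _).isFibrePower (G.additive Y) (H.additive Y))
    (fun Y => Comma.hom_ext _ _ (G.lift Y) (H.lift Y))
    (fun Y => Comma.hom_ext _ _ (G.flip Y) (H.flip Y))

theorem commaLift_fst (G : StrongTangentMorphism S'' S) (H : StrongTangentMorphism S'' S')
    (φ : TangentTransformation G (H.comp R)) : (commaLift G H φ).comp (commaFst R) = G :=
  StrongTangentMorphism.ext_of _ _ rfl (fun A => by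
    have : (G.α A).hom ≫ 𝟙 _ = 𝟙 _ ≫ (G.α A).hom ≫ 𝟙 _ := by simp
    exact this)

theorem commaLift_snd (G : StrongTangentMorphism S'' S) (H : StrongTangentMorphism S'' S')
    (φ : TangentTransformation G (H.comp R)) : (commaLift G H φ).comp (commaSnd R) = H :=
  StrongTangentMorphism.ext_of _ _ rfl (fun A => by
    have : (H.α A).hom ≫ 𝟙 _ = 𝟙 _ ≫ (H.α A).hom ≫ 𝟙 _ := by simp
    exact this)

theorem StrongTangentMorphism.obj_eq {M N : StrongTangentMorphism S'' S} (h : M = N) (A : C') :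
    M.F.obj A = N.F.obj A := by rw [h]

theorem StrongTangentMorphism.map_eq {M N : StrongTangentMorphism S'' S} (h : M = N) {A B : C'}
    (f : A ⟶ B) : M.F.map f = eqToHom (obj_eq h A) ≫ N.F.map f ≫ eqToHom (obj_eq h B).symm := by
  subst h
  simp

theorem StrongTangentMorphism.α_eq {M N : StrongTangentMorphism S'' S} (h : M = N) (A : C') :
    (M.α A).hom = eqToHom (obj_eq h _) ≫ (N.α A).hom ≫ eqToHom (by rw [h]) := by
  subst h
  simp

/-- Uniqueness in the universal property of the comma tangent category. -/
theorem commaLift_ext {M N : StrongTangentMorphism S'' (commaTangent R)}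
    (h₁ : M.comp (commaFst R) = N.comp (commaFst R))
    (h₂ : M.comp (commaSnd R) = N.comp (commaSnd R))
    (h : ∀ Y, arr (M.F.obj Y) ≫ R.F.map (eqToHom (StrongTangentMorphism.obj_eq h₂ Y)) =
      eqToHom (StrongTangentMorphism.obj_eq h₁ Y) ≫ arr (N.F.obj Y)) : M = N := by
  have hobj : ∀ Y, M.F.obj Y = N.F.obj Y := fun Y => by
    have e₁ : (M.F.obj Y).left = (N.F.obj Y).left := StrongTangentMorphism.obj_eq h₁ Y
    have e₂ : (M.F.obj Y).right = (N.F.obj Y).right := StrongTangentMorphism.obj_eq h₂ Y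
    have e := h Y
    revert e₁ e₂ e
    generalize StrongTangentMorphism.obj_eq h₁ Y = p₁
    generalize StrongTangentMorphism.obj_eq h₂ Y = p₂
    intro e₁ e₂
    change arr (M.F.obj Y) ≫ R.F.map (eqToHom e₂) = eqToHom e₁ ≫ arr (N.F.obj Y) → _
    clear p₁ p₂
    generalize M.F.obj Y = P at *
    generalize N.F.obj Y = Q at *
    obtain ⟨l, r, f⟩ := P
    obtain ⟨l', r', f'⟩ := Q
    dsimp only at e₁ e₂
    subst e₁ e₂
    intro e
    have : f = f' := by simpa [arr] using e
    rw [this]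
  have hF : M.F = N.F := by
    refine CategoryTheory.Functor.ext hobj (fun Y Z f => Comma.hom_ext _ _ ?_ ?_)
    · rw [Comma.comp_left, Comma.comp_left, Comma.eqToHom_left, Comma.eqToHom_left]
      exact StrongTangentMorphism.map_eq h₁ f
    · rw [Comma.comp_right, Comma.comp_right, Comma.eqToHom_right, Comma.eqToHom_right]
      exact StrongTangentMorphism.map_eq h₂ f
  refine StrongTangentMorphism.ext_of _ _ hF (fun Y => Comma.hom_ext _ _ ?_ ?_)
  · rw [Comma.comp_left, Comma.comp_left, Comma.eqToHom_left, Comma.eqToHom_left]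
    have := StrongTangentMorphism.α_eq h₁ Y
    have a : ((M.α Y).hom.left ≫ 𝟙 _ : _) = _ ≫ ((N.α Y).hom.left ≫ 𝟙 _) ≫ _ := this
    rw [Category.comp_id, Category.comp_id] at a
    exact a
  · rw [Comma.comp_right, Comma.comp_right, Comma.eqToHom_right, Comma.eqToHom_right]
    have := StrongTangentMorphism.α_eq h₂ Y
    have a : ((M.α Y).hom.right ≫ 𝟙 _ : _) = _ ≫ ((N.α Y).hom.right ≫ 𝟙 _) ≫ _ := this
    rw [Category.comp_id, Category.comp_id] at a
    exact a

end CommaObject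

section CommaMonad

open Bicategory

/-- The tangent transformation between tangent morphisms to a comma tangent category induced by
its two components. -/
noncomputable def commaLift₂ {C : Type u₁} [Category.{v₁} C] {D : Type u₂} [Category.{v₂} D]
    {C' : Type u₃} [Category.{v₃} C'] {S : TangentStructure C} {S' : TangentStructure D}
    {S'' : TangentStructure C'} {R : StrongTangentMorphism S' S}
    {M N : StrongTangentMorphism S'' (commaTangent R)}
    (σ : TangentTransformation (M.comp (commaFst R)) (N.comp (commaFst R)))
    (τ : TangentTransformation (M.comp (commaSnd R)) (N.comp (commaSnd R)))
    (h : ∀ Y, σ.τ.app Y ≫ arr (N.F.obj Y) = arr (M.F.obj Y) ≫ R.F.map (τ.τ.app Y)) :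
    TangentTransformation M N where
  τ :=
    { app := fun Y => mkHom (σ.τ.app Y) (τ.τ.app Y) (h Y)
      naturality := fun _ _ f => Comma.hom_ext _ _ (σ.τ.naturality f) (τ.τ.naturality f) }
  compat Y := by
    refine Comma.hom_ext _ _ ?_ ?_
    · have a : σ.τ.app (S''.T.obj Y) ≫ ((N.α Y).hom.left ≫ 𝟙 _) =
        ((M.α Y).hom.left ≫ 𝟙 _) ≫ S.T.map (σ.τ.app Y) := σ.compat Y
      exact (congrArg (σ.τ.app (S''.T.obj Y) ≫ ·) (Category.comp_id _)).symm.trans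
        (a.trans (congrArg (· ≫ S.T.map (σ.τ.app Y)) (Category.comp_id _)))
    · have a : τ.τ.app (S''.T.obj Y) ≫ ((N.α Y).hom.right ≫ 𝟙 _) =
        ((M.α Y).hom.right ≫ 𝟙 _) ≫ S'.T.map (τ.τ.app Y) := τ.compat Y
      exact (congrArg (τ.τ.app (S''.T.obj Y) ≫ ·) (Category.comp_id _)).symm.trans
        (a.trans (congrArg (· ≫ S'.T.map (τ.τ.app Y)) (Category.comp_id _)))

variable {X : TngCat.{v, max u v}}

/-- The comma object of an object of the slice, with its projection to `X`. -/
noncomputable def commaObj (A : Slice X) : Slice X where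
  dom :=
    { carrier := Comma (𝟭 X.carrier) (StrongTangentMorphism.F A.hom)
      str := commaTangent A.hom }
  hom := commaFst A.hom

/-- The second projection of the comma object. -/
noncomputable def commaTotal (A : Slice X) : (commaObj A).dom ⟶ A.dom := commaSnd A.hom

/-- The universal 2-morphism of the comma object. -/
noncomputable def commaCell (A : Slice X) : (commaObj A).hom ⟶ commaTotal A ≫ A.hom :=
  commaPsi A.hom

/-- The 1-morphism of the slice to a comma object induced by the universal property. -/
noncomputable def sliceLift {A B : Slice X} (H : A.dom ⟶ B.dom) (φ : A.hom ⟶ H ≫ B.hom) :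
    A ⟶ commaObj B where
  f := commaLift A.hom H φ
  w := commaLift_fst A.hom H φ

theorem sliceLift_total {A B : Slice X} (H : A.dom ⟶ B.dom) (φ : A.hom ⟶ H ≫ B.hom) :
    (sliceLift H φ).f ≫ commaTotal B = H := commaLift_snd A.hom H φ

/-- The value of `M` on 1-morphisms: `f : A ⟶ Π E` is sent to `f : A ⟶ Π E = Π' F E`. -/
noncomputable def commaMap {A B : Slice X} (F : A ⟶ B) : commaObj A ⟶ commaObj B :=
  sliceLift (A := commaObj A) (commaTotal A ≫ F.f)
    (commaCell A ≫ eqToHom (by rw [Strict.assoc, F.w]))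

/-- The unit: it sends `E` to the identity of `Π E`. -/
noncomputable def commaUnit (A : Slice X) : A ⟶ commaObj A :=
  sliceLift (𝟙 A.dom) (eqToHom (Strict.id_comp A.hom).symm)

/-- The multiplication: it sends `(g : B ⟶ A, f : A ⟶ Π E)` to the composite `B ⟶ Π E`. -/
noncomputable def commaMult (A : Slice X) : commaObj (commaObj A) ⟶ commaObj A :=
  sliceLift (A := commaObj (commaObj A)) (commaTotal (commaObj A) ≫ commaTotal A)
    (commaCell (commaObj A) ≫ commaTotal (commaObj A) ◁ commaCell A ≫
      eqToHom (Strict.assoc _ _ _).symm)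

theorem slice_ext {A B : Slice X} {f g : A ⟶ commaObj B}
    (h₂ : f.f ≫ commaTotal B = g.f ≫ commaTotal B)
    (h : ∀ Y : A.dom.carrier, arr ((StrongTangentMorphism.F f.f).obj Y) ≫
      (StrongTangentMorphism.F B.hom).map (eqToHom (StrongTangentMorphism.obj_eq h₂ Y)) =
      eqToHom (StrongTangentMorphism.obj_eq (f.w.trans g.w.symm) Y) ≫
        arr ((StrongTangentMorphism.F g.f).obj Y)) : f = g :=
  Slice.Hom.ext (commaLift_ext (f.w.trans g.w.symm) h₂ h)

theorem commaMap_total {A B : Slice X} (F : A ⟶ B) :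
    (commaMap F).f ≫ commaTotal B = commaTotal A ≫ F.f := sliceLift_total _ _

theorem arr_commaMap {A B : Slice X} (F : A ⟶ B) (Y : (commaObj A).dom.carrier) :
    arr ((StrongTangentMorphism.F (commaMap F).f).obj Y) =
      arr Y ≫ eqToHom (StrongTangentMorphism.obj_eq F.w Y.right).symm :=
  congrArg (arr Y ≫ ·) (eqToHom_τ_app _ _)

theorem map_conj_app {D E E' : TngCat.{v, u}} {M' M N N' : D ⟶ E} (e : M' = M) (e' : N = N')
    (t : M ⟶ N) (P : E ⟶ E') (Y : D.carrier) :
    (StrongTangentMorphism.F P).map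
        ((TangentTransformation.τ (eqToHom e ≫ t ≫ eqToHom e')).app Y) =
      eqToHom (by rw [e]) ≫ (StrongTangentMorphism.F P).map ((TangentTransformation.τ t).app Y) ≫
        eqToHom (by rw [e']) := by
  subst e e'
  simp

theorem eqToHom_aux {C : Type u₁} [Category.{v₁} C] {V W W₁ W₂ W₃ W₄ : C} {a : V ⟶ V}
    {y : V ⟶ W} {b : V ⟶ W₄} {c : V ⟶ W₁} {d : W₁ ⟶ W₄} {t : W₂ ⟶ W₃}
    {e₁ : W = W₄} {e₂ : W = W₁} {e₃ : W₁ = W₂} {e₄ : W₂ = W₃} {e₅ : W₃ = W₄}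
    (ha : a = 𝟙 V) (hb : b = y ≫ eqToHom e₁) (hc : c = y ≫ eqToHom e₂)
    (hd : d = eqToHom e₃ ≫ t ≫ eqToHom e₅) (ht : t = eqToHom e₄) : a ≫ b = c ≫ d := by
  subst hd ht ha hb hc
  simp

theorem slice_w {A B : Slice X} {F G : A ⟶ B} (σ : F ⟶ G) (E : A.dom.carrier) :
    (StrongTangentMorphism.F B.hom).map
      ((TangentTransformation.τ (Slice.Hom₂.τ σ)).app E) =
      eqToHom (StrongTangentMorphism.obj_eq (F.w.trans G.w.symm) E) :=
  (congrArg (fun t => (TangentTransformation.τ t).app E) (Slice.Hom₂.w σ)).trans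
    (eqToHom_τ_app _ _)

/-- The value of `M` on 2-morphisms. -/
noncomputable def commaMap₂ {A B : Slice X} {F G : A ⟶ B} (σ : F ⟶ G) :
    commaMap F ⟶ commaMap G where
  τ := commaLift₂ (R := B.hom)
    (eqToHom ((commaMap F).w.trans (commaMap G).w.symm) : (commaMap F).f ≫ (commaObj B).hom ⟶ _)
    (eqToHom (commaMap_total F) ≫ commaTotal A ◁ Slice.Hom₂.τ σ ≫
      eqToHom (commaMap_total G).symm : (commaMap F).f ≫ commaTotal B ⟶ _)
    (fun Y => by
      exact eqToHom_aux (eqToHom_τ_app _ Y) (arr_commaMap G Y) (arr_commaMap F Y)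
        (map_conj_app (commaMap_total F) (commaMap_total G).symm (commaTotal A ◁ Slice.Hom₂.τ σ)
          B.hom Y) (slice_w σ Y.right))
  w := by
    refine hom_ext_τ fun Y => ?_
    rfl

theorem slice_ext₂ {A B : Slice X} {F G : A ⟶ commaObj B} {σ τ : F ⟶ G}
    (h : ∀ Y, ((TangentTransformation.τ (Slice.Hom₂.τ σ)).app Y).right =
      ((TangentTransformation.τ (Slice.Hom₂.τ τ)).app Y).right) : σ = τ :=
  Slice.Hom₂.ext (hom_ext_τ fun Y => Comma.hom_ext _ _ ((slice_w σ Y).trans (slice_w τ Y).symm)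
    (h Y))

theorem commaMap₂_right {A B : Slice X} {F G : A ⟶ B} (σ : F ⟶ G)
    (Y : (commaObj A).dom.carrier) :
    ((TangentTransformation.τ (Slice.Hom₂.τ (commaMap₂ σ))).app Y).right =
      (TangentTransformation.τ (Slice.Hom₂.τ σ)).app Y.right :=
  (map_conj_app (commaMap_total F) (commaMap_total G).symm (commaTotal A ◁ Slice.Hom₂.τ σ)
    (𝟙 B.dom) Y).trans ((Category.id_comp _).trans (Category.comp_id _))

theorem arr_commaUnit (A : Slice X) (E : A.dom.carrier) :
    arr ((StrongTangentMorphism.F (commaUnit A).f).obj E) = 𝟙 _ :=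
  eqToHom_τ_app _ _

theorem comp_eqToHom_τ_app {D E : TngCat.{v, u}} {M N P P' : D ⟶ E} (σ : M ⟶ N) (τ : N ⟶ P)
    (e : P = P') (Y : D.carrier) :
    (TangentTransformation.τ (σ ≫ τ ≫ eqToHom e)).app Y =
      (TangentTransformation.τ σ).app Y ≫ (TangentTransformation.τ τ).app Y ≫
        eqToHom (StrongTangentMorphism.obj_eq e Y) := by
  subst e
  simp only [eqToHom_refl, Category.comp_id]
  rfl

theorem arr_commaMult (A : Slice X) (Y : (commaObj (commaObj A)).dom.carrier) :
    arr ((StrongTangentMorphism.F (commaMult A).f).obj Y) = arr Y ≫ arr Y.right :=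
  (comp_eqToHom_τ_app (commaCell (commaObj A)) (commaTotal (commaObj A) ◁ commaCell A)
    (Strict.assoc _ _ _).symm Y).trans (congrArg (arr Y ≫ ·) (Category.comp_id (arr Y.right)))

theorem eqToHom_aux' {C : Type u₁} [Category.{v₁} C] {D : Type u₂} [Category.{v₂} D] {F : D ⥤ C}
    {V₁ V₂ V W : C} {W₁ W₂ : D} {a : V₁ ⟶ F.obj W₁} {b : V₂ ⟶ F.obj W₂} (y : V ⟶ W)
    {e₁ : V₁ = V} {e₂ : V₂ = V} {d₁ : W = F.obj W₁} {d₂ : W = F.obj W₂}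
    (ha : a = eqToHom e₁ ≫ y ≫ eqToHom d₁) (hb : b = eqToHom e₂ ≫ y ≫ eqToHom d₂)
    (h₂ : W₁ = W₂) (h₁ : V₁ = V₂) : a ≫ F.map (eqToHom h₂) = eqToHom h₁ ≫ b := by
  subst ha hb e₁ h₁ h₂
  simp

theorem eqToHom_shape {C : Type u₁} [Category.{v₁} C] {V W W' : C} {a : V ⟶ W'} {y : V ⟶ W}
    {d : W = W'} (h : a = y ≫ eqToHom d) : a = eqToHom rfl ≫ y ≫ eqToHom d :=
  h.trans (Category.id_comp _).symm

theorem eqToHom_shape₀ {C : Type u₁} [Category.{v₁} C] {V W : C} {a y : V ⟶ W}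
    (h : a = y) : a = eqToHom rfl ≫ y ≫ eqToHom rfl :=
  eqToHom_shape (h.trans (Category.comp_id _).symm)

theorem eqToHom_comp {C : Type u₁} [Category.{v₁} C] {V W W' W'' : C} {a : V ⟶ W'} {y : V ⟶ W}
    {d : W = W'} (h : a = y ≫ eqToHom d) (e : W' = W'') :
    a ≫ eqToHom e = y ≫ eqToHom (d.trans e) := by
  rw [h, Category.assoc, eqToHom_trans]

theorem eqToHom_middle {C : Type u₁} [Category.{v₁} C] {V W W' Z Z' : C} {a : V ⟶ W'} {y : V ⟶ W}
    {d : W = W'} (h : a = y ≫ eqToHom d) {b : W' ⟶ Z'} {z : W ⟶ Z} {d' : Z = Z'}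
    (h' : b = eqToHom d.symm ≫ z ≫ eqToHom d') : a ≫ b = (y ≫ z) ≫ eqToHom d' := by
  subst h h' d d'
  simp

theorem slice_ext' {A B : Slice X} {f g : A ⟶ commaObj B}
    (h₂ : f.f ≫ commaTotal B = g.f ≫ commaTotal B)
    (h : ∀ Y : A.dom.carrier, ∃ (V W : X.carrier) (y : V ⟶ W) (e₁ : _ = V) (e₂ : _ = V)
      (d₁ : W = _) (d₂ : W = _),
      arr ((StrongTangentMorphism.F f.f).obj Y) = eqToHom e₁ ≫ y ≫ eqToHom d₁ ∧
      arr ((StrongTangentMorphism.F g.f).obj Y) = eqToHom e₂ ≫ y ≫ eqToHom d₂) : f = g :=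
  slice_ext h₂ fun Y => by
    obtain ⟨V, W, y, e₁, e₂, d₁, d₂, ha, hb⟩ := h Y
    exact eqToHom_aux' y ha hb _ _

theorem conj_right {A B : Slice X} {F' F G G' : A ⟶ commaObj B} (e : F' = F) (e' : G = G')
    (t : F ⟶ G) (Y : A.dom.carrier) :
    ((TangentTransformation.τ (Slice.Hom₂.τ (eqToHom e ≫ t ≫ eqToHom e'))).app Y).right =
      eqToHom (by rw [e]) ≫ ((TangentTransformation.τ (Slice.Hom₂.τ t)).app Y).right ≫
        eqToHom (by rw [e']) := by
  subst e e'
  simp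

theorem eqToHom_conj {C : Type u₁} [Category.{v₁} C] {V W : C} {a b c : V ⟶ W} (h : a = b)
    (h' : c = b) : a = eqToHom rfl ≫ c ≫ eqToHom rfl := by
  subst h h'
  simp

/-- The 2-functor underlying the comma 2-monad. -/
noncomputable def commaFunctor : StrictPseudofunctor (Slice X) (Slice X) := .mk''
  { obj := commaObj
    map := commaMap
    map₂ := commaMap₂
    map₂_id f := slice_ext₂ fun Y => commaMap₂_right (𝟙 f) Y
    map₂_comp σ τ := slice_ext₂ fun Y => (commaMap₂_right (σ ≫ τ) Y).trans
      (congrArg₂ (· ≫ ·) (commaMap₂_right σ Y) (commaMap₂_right τ Y)).symm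
    map_id A := slice_ext' ((commaMap_total _).trans
      ((Strict.comp_id (commaTotal A)).trans (Strict.id_comp (commaTotal A)).symm))
      (fun Y => ⟨_, _, arr Y, rfl, rfl, rfl, rfl,
        eqToHom_shape (arr_commaMap (𝟙 A) Y), eqToHom_shape₀ (y := arr Y) rfl⟩)
    map_comp {A B D} f g := slice_ext' ((commaMap_total _).trans (by
        have h₁ := commaMap_total f
        have h₂ := commaMap_total g
        have e₁ : (f ≫ g).f = f.f ≫ g.f := rfl
        have e₂ : (commaMap f ≫ commaMap g).f = (commaMap f).f ≫ (commaMap g).f := rfl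
        rw [e₁, e₂, Strict.assoc, h₂, ← Strict.assoc, ← Strict.assoc, h₁]))
      (fun Y => ⟨_, _, arr Y, rfl, rfl, _, _, eqToHom_shape (arr_commaMap (f ≫ g) Y),
        eqToHom_shape ((arr_commaMap g _).trans (eqToHom_comp (arr_commaMap f Y) _))⟩)
    map₂_whisker_left f g g' η := slice_ext₂ fun Y =>
      (eqToHom_conj (commaMap₂_right (f ◁ η) Y)
        (commaMap₂_right η ((StrongTangentMorphism.F (commaMap f).f).obj Y))).trans
        (conj_right _ _ (commaMap f ◁ commaMap₂ η) Y).symm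
    map₂_whisker_right {A B D f f'} η g := slice_ext₂ fun Y =>
      (eqToHom_conj (commaMap₂_right (η ▷ g) Y)
        (congrArg (StrongTangentMorphism.F g.f).map (commaMap₂_right η Y))).trans
        (conj_right _ _ (commaMap₂ η ▷ commaMap g) Y).symm }

end CommaMonad

section CommaMonad

open Bicategory

variable {X : TngCat.{v, max u v}}

theorem post_right {A B : Slice X} {F G G' : A ⟶ commaObj B} (e : G = G') (t : F ⟶ G)
    (Y : A.dom.carrier) :
    ((TangentTransformation.τ (Slice.Hom₂.τ (t ≫ eqToHom e))).app Y).right =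
      ((TangentTransformation.τ (Slice.Hom₂.τ t)).app Y).right ≫ eqToHom (by rw [e]) := by
  subst e
  simp

theorem pre_right {A B : Slice X} {F F' G : A ⟶ commaObj B} (e : F' = F) (t : F ⟶ G)
    (Y : A.dom.carrier) :
    ((TangentTransformation.τ (Slice.Hom₂.τ (eqToHom e ≫ t))).app Y).right =
      eqToHom (by rw [e]) ≫ ((TangentTransformation.τ (Slice.Hom₂.τ t)).app Y).right := by
  subst e
  simp

theorem square_right {A B : Slice X} {F F' G G' : A ⟶ commaObj B} (e : F' = F) (e' : G = G')
    (s : F' ⟶ G) (t : F ⟶ G')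
    (h : ∀ Y, ((TangentTransformation.τ (Slice.Hom₂.τ s)).app Y).right ≫ eqToHom (by rw [e']) =
      eqToHom (by rw [e]) ≫ ((TangentTransformation.τ (Slice.Hom₂.τ t)).app Y).right) :
    s ≫ eqToHom e' = eqToHom e ≫ t :=
  slice_ext₂ fun Y => (post_right e' s Y).trans ((h Y).trans (pre_right e t Y).symm)

theorem eqToHom_square {C : Type u₁} [Category.{v₁} C] {V W : C} {a b c : V ⟶ W} (h : a = b)
    (h' : c = b) : a ≫ eqToHom rfl = eqToHom rfl ≫ c := by
  subst h h'
  simp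

theorem commaUnit_total (A : Slice X) : (commaUnit A).f ≫ commaTotal A = 𝟙 A.dom :=
  sliceLift_total _ _

theorem commaMult_total (A : Slice X) :
    (commaMult A).f ≫ commaTotal A = commaTotal (commaObj A) ≫ commaTotal A :=
  sliceLift_total (A := commaObj (commaObj A)) _ _

theorem eqToHom_id {C : Type u₁} [Category.{v₁} C] {V W : C} {a : V ⟶ V} (h : a = 𝟙 V)
    (e : V = W) : a = eqToHom e ≫ 𝟙 W ≫ eqToHom e.symm := by
  subst h e
  simp

theorem eqToHom_id' {C : Type u₁} [Category.{v₁} C] {V W : C} {a : V ⟶ V} (h : a = 𝟙 V)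
    (e : V = W) : a ≫ eqToHom e = eqToHom rfl ≫ 𝟙 V ≫ eqToHom e := by
  subst h e
  simp

theorem comp_f {A B D : Slice X} (f : A ⟶ B) (g : B ⟶ D) : (f ≫ g).f = f.f ≫ g.f := rfl

theorem id_f (A : Slice X) : Slice.Hom.f (𝟙 A) = 𝟙 A.dom := rfl

theorem commaUnit_nat {A B : Slice X} (f : A ⟶ B) :
    f ≫ commaUnit B = commaUnit A ≫ commaMap f :=
  slice_ext' (by
    rw [comp_f, comp_f, Strict.assoc, Strict.assoc, commaUnit_total, commaMap_total,
      ← Strict.assoc, commaUnit_total, Strict.comp_id, Strict.id_comp])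
    (fun E => ⟨_, _, 𝟙 _, StrongTangentMorphism.obj_eq f.w E, rfl, _, _,
      eqToHom_id (arr_commaUnit B _) _,
      (arr_commaMap f _).trans (eqToHom_id' (arr_commaUnit A E) _)⟩)

theorem map_arr {A B : Slice X} (F : A ⟶ B) {Y Z : (commaObj A).dom.carrier} (f : Y ⟶ Z) :
    ((StrongTangentMorphism.F (commaMap F).f).map f).left = f.left := rfl

theorem commaMult_nat {A B : Slice X} (f : A ⟶ B) :
    commaMap (commaMap f) ≫ commaMult B = commaMult A ≫ commaMap f :=
  slice_ext' (by
    rw [comp_f, comp_f, Strict.assoc, Strict.assoc, commaMap_total, commaMult_total,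
      ← Strict.assoc, ← Strict.assoc, commaMult_total, commaMap_total, Strict.assoc,
      commaMap_total, Strict.assoc])
    (fun Y => ⟨_, _, arr Y ≫ arr Y.right, rfl, rfl, _, _,
      eqToHom_shape ((arr_commaMult B _).trans ((eqToHom_middle (arr_commaMap (commaMap f) Y)
        ((arr_commaMap f Y.right).trans (Category.id_comp _).symm)))),
      eqToHom_shape ((arr_commaMap f _).trans
        (congrArg (· ≫ eqToHom _) (arr_commaMult A Y)))⟩)

theorem comma_left_unit (A : Slice X) : commaUnit (commaObj A) ≫ commaMult A = 𝟙 (commaObj A) :=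
  slice_ext' (by
    rw [comp_f, id_f, Strict.assoc, commaMult_total, ← Strict.assoc, commaUnit_total])
    (fun Y => ⟨_, _, arr Y, rfl, rfl, rfl, rfl,
      eqToHom_shape₀ ((arr_commaMult A _).trans
        ((congrArg (· ≫ arr Y) (arr_commaUnit (commaObj A) Y)).trans (Category.id_comp _))),
      eqToHom_shape₀ (y := arr Y) rfl⟩)

theorem comma_right_unit (A : Slice X) :
    commaMap (commaUnit A) ≫ commaMult A = 𝟙 (commaObj A) :=
  slice_ext' (by
    rw [comp_f, id_f, Strict.assoc, commaMult_total, ← Strict.assoc, commaMap_total, Strict.assoc,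
      commaUnit_total, Strict.comp_id, Strict.id_comp])
    (fun Y => ⟨_, _, arr Y, rfl, rfl, rfl, rfl,
      eqToHom_shape₀ ((arr_commaMult A _).trans
        ((congrArg₂ (· ≫ ·) ((arr_commaMap (commaUnit A) Y).trans (Category.comp_id _))
          (arr_commaUnit A Y.right)).trans (Category.comp_id _))),
      eqToHom_shape₀ (y := arr Y) rfl⟩)

theorem comma_assoc (A : Slice X) :
    commaMap (commaMult A) ≫ commaMult A = commaMult (commaObj A) ≫ commaMult A :=
  slice_ext' (by
    rw [comp_f, comp_f, Strict.assoc, Strict.assoc, commaMult_total, ← Strict.assoc,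
      ← Strict.assoc, commaMap_total, commaMult_total, Strict.assoc, commaMult_total,
      Strict.assoc])
    (fun Y => ⟨_, _, arr Y ≫ arr Y.right ≫ arr Y.right.right, rfl, rfl, rfl, rfl,
      eqToHom_shape₀ ((arr_commaMult A _).trans
        (congrArg₂ (· ≫ ·) ((arr_commaMap (commaMult A) Y).trans (Category.comp_id _))
          (arr_commaMult A Y.right))),
      eqToHom_shape₀ ((arr_commaMult A _).trans
        ((congrArg (· ≫ arr Y.right.right) (arr_commaMult (commaObj A) Y)).trans
          (Category.assoc _ _ _)))⟩)

theorem commaUnit_nat₂ {A B : Slice X} {f g : A ⟶ B} (τ : f ⟶ g) :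
    τ ▷ commaUnit B ≫ eqToHom (commaUnit_nat g) =
      eqToHom (commaUnit_nat f) ≫ commaUnit A ◁ commaMap₂ τ :=
  square_right _ _ _ _ fun Y => eqToHom_square rfl
    (commaMap₂_right τ ((StrongTangentMorphism.F (commaUnit A).f).obj Y))

theorem commaMult_nat₂ {A B : Slice X} {f g : A ⟶ B} (τ : f ⟶ g) :
    commaMap₂ (commaMap₂ τ) ▷ commaMult B ≫ eqToHom (commaMult_nat g) =
      eqToHom (commaMult_nat f) ≫ commaMult A ◁ commaMap₂ τ :=
  square_right _ _ _ _ fun Y => eqToHom_square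
    ((congrArg CommaMorphism.right (commaMap₂_right (commaMap₂ τ) Y)).trans
      (commaMap₂_right τ Y.right))
    (commaMap₂_right τ ((StrongTangentMorphism.F (commaMult A).f).obj Y))

attribute [local irreducible] commaObj commaMap commaMap₂ commaUnit commaMult

/-- The comma 2-monad on the slice over `X`. -/
noncomputable def commaMonad (X : TngCat.{v, max u v}) : TwoMonad (Slice X) where
  M := commaFunctor
  η := commaUnit
  η_nat := commaUnit_nat
  η_nat₂ := commaUnit_nat₂
  μ := commaMult
  μ_nat := commaMult_nat
  μ_nat₂ := commaMult_nat₂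
  left_unit := comma_left_unit
  right_unit := comma_right_unit
  assoc := comma_assoc

end CommaMonad

section TangentFibrations

/-- A choice, for all `f : A ⟶ p E`, of a morphism with codomain `E`. -/
structure LiftChoice {C : Type u₁} [Category.{v₁} C] {D : Type u₂} [Category.{v₂} D]
    (p : D ⥤ C) where
  pull {A : C} {E : D} (f : A ⟶ p.obj E) : D
  lift {A : C} {E : D} (f : A ⟶ p.obj E) : pull f ⟶ E

/-- A cleavage of a functor: a choice of cartesian lifts, which makes it a cloven fibration. -/
structure Cleavage {C : Type u₁} [Category.{v₁} C] {D : Type u₂} [Category.{v₂} D]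
    (p : D ⥤ C) extends LiftChoice p where
  cartesian {A : C} {E : D} (f : A ⟶ p.obj E) : p.IsStronglyCartesian f (lift f)

section

variable {C : Type u₁} [Category.{v₁} C] {D : Type u₂} [Category.{v₂} D]
  {S : TangentStructure C} {S' : TangentStructure D} {R : StrongTangentMorphism S' S}

theorem StrongTangentMorphism.IsStrict.isHomLift (hR : R.IsStrict) {A : C} {E E' : D}
    (f : A ⟶ R.F.obj E) (φ : E' ⟶ E) (h : R.F.IsHomLift f φ) :
    R.F.IsHomLift (S.T.map f ≫ (R.α E).inv) (S'.T.map φ) := by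
  obtain ⟨h₁, e₁⟩ := hR E'
  have h₂ := IsHomLift.domain_eq R.F f φ
  refine IsHomLift.of_fac _ _ _ (h₁.trans (congrArg S.T.obj h₂)) rfl ?_
  have h₃ : R.F.map (S'.T.map φ) = (R.α E').hom ≫ S.T.map (R.F.map φ) ≫ (R.α E).inv := by
    rw [← Category.assoc, Iso.eq_comp_inv, R.α_natural]
  rw [h₃, IsHomLift.fac' R.F f φ, e₁]
  simp [eqToHom_map]

/-- The distributor `T' (f^* E) ⟶ (T f)^* (T' E)` of a cleavage of a strict tangent morphism: the
unique vertical morphism whose composite with the lift of `T f` is `T'` of the lift of `f`. The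
identity `T Π E = Π T' E` is the inverse of the distributive law of the strict tangent morphism. -/
noncomputable def distributor (hR : R.IsStrict) (K : Cleavage R.F) {A : C} {E : D}
    (f : A ⟶ R.F.obj E) :
    S'.T.obj (K.pull f) ⟶ K.pull (S.T.map f ≫ (R.α E).inv) :=
  haveI := K.cartesian (S.T.map f ≫ (R.α E).inv)
  haveI := hR.isHomLift f (K.lift f) (K.cartesian f).toIsHomLift
  Functor.IsStronglyCartesian.map R.F (S.T.map f ≫ (R.α E).inv) (K.lift (S.T.map f ≫ (R.α E).inv))
    (g := 𝟙 (S.T.obj A)) (Category.id_comp _).symm (S'.T.map (K.lift f))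

end

/-- A (cloven) tangent fibration over `X`. -/
structure TangentFibration (X : TngCat.{v, max u v}) where
  obj : Slice X
  strict : StrongTangentMorphism.IsStrict obj.hom
  cleavage : Cleavage (StrongTangentMorphism.F obj.hom)
  distributor_iso {A : X.carrier} {E : obj.dom.carrier}
    (f : A ⟶ (StrongTangentMorphism.F obj.hom).obj E) : IsIso (distributor strict cleavage f)

variable {X : TngCat.{v, max u v}}

/-- The choice of lifts of a pseudoalgebra of the comma 2-monad: the lift of `f : A ⟶ Π E` is the
value of `c` on the morphism `(f, 𝟙 E)` from `f` to the identity of `Π E`, followed by the inverse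
of the unitor `ζ`. -/
noncomputable def liftChoice {A : Slice X} (P : (commaMonad X).PseudoalgebraStructure A) :
    LiftChoice (StrongTangentMorphism.F A.hom) where
  pull f := (StrongTangentMorphism.F P.c.f).obj (mkObj f)
  lift {_ E} f := (StrongTangentMorphism.F P.c.f).map
      (mkHom (X := mkObj f) (Y := (StrongTangentMorphism.F (commaUnit A).f).obj E) f (𝟙 E)
        ((congrArg (f ≫ ·) (arr_commaUnit A E)).trans
          (congrArg (f ≫ ·) (CategoryTheory.Functor.map_id _ E).symm))) ≫
    (TangentTransformation.τ (Slice.Hom₂.τ P.ζ.inv)).app E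

end TangentFibrations

end TangentCat

/-! Let `η` be the unit of the comma 2-monad, so that `η E` is the identity of `Π E`. A morphism
from `η E'` to `f : A ⟶ Π E` in the comma category is a pair of `g : Π E' ⟶ A` and `h : E' ⟶ E` with
`g ≫ f = Π h`. This is exactly what a cartesian lift of `f` turns into a morphism `E' ⟶ f^* E`. A
choice of cartesian lifts is therefore a functor `c`, right adjoint to `η` and strictly over the
base, whose counit at `f` is the identity of `A` paired with the lift `φ`.

From fibrations to algebras the tool is doctrinal adjunction. Since `η` is a strong tangent
morphism, its right adjoint carries a mate `T' c ⟶ c T̄` satisfying the inverted axioms of a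
distributive law. This mate is the distributor (`dist_eq_distributor`), so invertible distributors
make `c` a strong tangent morphism (`rightAdjoint`). The unitor is the inverse of the lift of an
identity, and the multiplicator compares the lift of a composite with the composite of lifts. The
remaining equations follow from one principle: a morphism into `f^* E` is determined by its
projection to the base and its composite with `φ`. Projections agree because 2-morphisms of the
slice become identities over the base.

From algebras to fibrations, put `φ = c(f, 𝟙) ≫ ζ⁻¹`. Naturality of `ζ` already gives factorizations
through `φ`. Their uniqueness rests on a triangle identity, namely that `ζ⁻¹` at `c Y` is `c`
applied to the would-be counit at `Y`. The two unit laws and the naturality of `θ` yield it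
(`MultiplicatorData.z_eq`). Compatibility of `ζ` with the tangent structures then identifies the
inverse of the law of `c` with the distributor.

The constructions are mutually inverse because the lifts determine `c`, its law, `ζ` and `θ`
(`pseudoalgebra_ext`). -/

namespace TangentCat

/-! ### Doctrinal adjunction for strong tangent morphisms. -/

section DoctrinalAdjunction

variable {C : Type u₁} [Category.{v₁} C] {D : Type u₂} [Category.{v₂} D]
  {S : TangentStructure C} {S' : TangentStructure D}

/-- The functor `R` is right adjoint to `L`, expressed by a natural family of universal arrows
from `L` to the objects of `C`. -/
structure UniversalCounit (L : D ⥤ C) (R : C ⥤ D) where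
  counit (Y : C) : L.obj (R.obj Y) ⟶ Y
  counit_natural {Y Z : C} (f : Y ⟶ Z) : L.map (R.map f) ≫ counit Z = counit Y ≫ f
  hom_ext {E : D} {Y : C} {f g : E ⟶ R.obj Y} (h : L.map f ≫ counit Y = L.map g ≫ counit Y) : f = g
  exists_lift {E : D} {Y : C} (h : L.obj E ⟶ Y) : ∃ k : E ⟶ R.obj Y, L.map k ≫ counit Y = h

namespace UniversalCounit

variable {L : D ⥤ C} {R : C ⥤ D} (adj : UniversalCounit L R)

/-- The morphism to the right adjoint with a given transpose. -/
noncomputable def lift {E : D} {Y : C} (h : L.obj E ⟶ Y) : E ⟶ R.obj Y :=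
  (adj.exists_lift h).choose

theorem lift_counit {E : D} {Y : C} (h : L.obj E ⟶ Y) : L.map (adj.lift h) ≫ adj.counit Y = h :=
  (adj.exists_lift h).choose_spec

/-- Right adjoints preserve limits: a cone is transposed along the counit, lifted there, and
transposed back. -/
theorem preservedBy (adj : UniversalCounit L R) {E B : C} {q : E ⟶ B}
    (P : FibrePowers q) : P.PreservedBy R := by
  refine fun n => .mk' (fun i => by rw [← R.map_comp, (P.isFibrePower n).condition])
    (fun X b a ha => ?_) (fun X w w' hb hp => ?_)
  · obtain ⟨w, hw, hw'⟩ := (P.isFibrePower n).exists_lift (L.map b ≫ adj.counit B)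
      (fun i => L.map (a i) ≫ adj.counit E) (fun i => by
        rw [← ha i, L.map_comp, Category.assoc, Category.assoc, ← adj.counit_natural])
    refine ⟨adj.lift w, adj.hom_ext ?_, fun i => adj.hom_ext ?_⟩
    · rw [L.map_comp, Category.assoc, adj.counit_natural, reassoc_of% (adj.lift_counit w), hw]
    · rw [L.map_comp, Category.assoc, adj.counit_natural, reassoc_of% (adj.lift_counit w), hw' i]
  · refine adj.hom_ext ((P.isFibrePower n).hom_ext ?_ (fun i => ?_))
    · rw [Category.assoc, ← adj.counit_natural, Category.assoc, ← adj.counit_natural,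
        ← L.map_comp_assoc, hb, L.map_comp_assoc]
    · rw [Category.assoc, ← adj.counit_natural, Category.assoc, ← adj.counit_natural,
        ← L.map_comp_assoc, hp, L.map_comp_assoc]

end UniversalCounit

namespace StrongTangentMorphism

variable (L : StrongTangentMorphism S' S) {R : C ⥤ D} (adj : UniversalCounit L.F R)

/-- The mate of the distributive law of a strong tangent morphism with a right adjoint. -/
noncomputable def mate (Y : C) : S'.T.obj (R.obj Y) ⟶ R.obj (S.T.obj Y) :=
  adj.lift ((L.α (R.obj Y)).hom ≫ S.T.map (adj.counit Y))

theorem mate_counit (Y : C) : L.F.map (L.mate adj Y) ≫ adj.counit (S.T.obj Y) =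
    (L.α (R.obj Y)).hom ≫ S.T.map (adj.counit Y) :=
  adj.lift_counit _

theorem mate_natural {Y Z : C} (f : Y ⟶ Z) :
    L.mate adj Y ≫ R.map (S.T.map f) = S'.T.map (R.map f) ≫ L.mate adj Z := by
  refine adj.hom_ext ?_
  rw [L.F.map_comp, Category.assoc, adj.counit_natural, reassoc_of% (L.mate_counit adj Y),
    L.F.map_comp, Category.assoc, mate_counit, reassoc_of% (L.α_natural (R.map f)),
    ← S.T.map_comp, ← S.T.map_comp, adj.counit_natural]

/-- Each equation is tested after transposition, where it becomes additivity of the law of `L`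
followed by naturality of the bundle of `S` at the counit. -/
theorem mate_additive (Y : C) :
    IsAdditiveBundleHom (S'.bundle (R.obj Y)) ((S.bundle Y).map R (adj.preservedBy _))
      (𝟙 (R.obj Y)) (L.mate adj Y) := by
  refine .of_plus ?_ ?_ (fun w => ?_)
  · refine adj.hom_ext ?_
    rw [L.F.map_comp, Category.assoc, adj.counit_natural, reassoc_of% (L.mate_counit adj Y),
      (S.bundle_natural _).proj, reassoc_of% (L.α_proj), Category.comp_id]
  · refine adj.hom_ext ?_
    rw [L.F.map_comp, Category.assoc, mate_counit, reassoc_of% (L.α_zero), Category.id_comp,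
      (S.bundle_natural _).zero]
    exact (adj.counit_natural _).symm
  · refine adj.hom_ext ?_
    have h₁ : L.F.map (S'.bundle (R.obj Y)).sum =
        ((S'.bundle (R.obj Y)).map L.F (L.preserved _)).sum := rfl
    -- Naturality of the counit at the sum: a sum in the image bundle is transposed by transposing
    -- the pair and then adding in `S`.
    have h₂ {Z : D} (a b : Z ⟶ R.obj (S.T.obj Y)) (w : a ≫ R.map (S.p Y) = b ≫ R.map (S.p Y)) :
        L.F.map (((S.bundle Y).map R (adj.preservedBy _)).plus a b w) ≫ adj.counit (S.T.obj Y) =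
          (L.F.map (((S.bundle Y).map R (adj.preservedBy _)).pair a b w) ≫
            adj.counit ((S.bundle Y).pow 2)) ≫ (S.bundle Y).sum := by
      rw [Category.assoc, ← adj.counit_natural, ← L.F.map_comp_assoc]
      rfl
    rw [L.F.map_comp, Category.assoc, mate_counit, h₁,
      AdditiveBundle.sum_eq_plus, ← Category.assoc, (L.additive (R.obj Y)).plus,
      (S.bundle_natural (adj.counit Y)).plus]
    symm
    refine (h₂ _ _ w).trans ?_
    rw [AdditiveBundle.plus]
    congr 1
    refine FibrePowers.eq_pair _ _ _ _ _ ?_ ?_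
    · rw [Category.assoc, ← adj.counit_natural, ← L.F.map_comp_assoc]
      refine (congrArg (L.F.map · ≫ _) (FibrePowers.pair_fst _ _ _ w)).trans ?_
      rw [L.F.map_comp, Category.assoc, mate_counit, Category.assoc]
    · rw [Category.assoc, ← adj.counit_natural, ← L.F.map_comp_assoc]
      refine (congrArg (L.F.map · ≫ _) (FibrePowers.pair_snd _ _ _ w)).trans ?_
      rw [L.F.map_comp, Category.assoc, mate_counit, Category.assoc]

/-- The twofold mate transposes to the twofold law followed by `T²` of the counit. The axioms for
the vertical lift and for the flip both reduce to this. -/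
theorem mate_mate_counit (Y : C) :
    L.F.map (S'.T.map (L.mate adj Y)) ≫ L.F.map (L.mate adj (S.T.obj Y)) ≫ adj.counit _ =
      (L.α _).hom ≫ S.T.map (L.α (R.obj Y)).hom ≫ S.T.map (S.T.map (adj.counit Y)) := by
  rw [mate_counit, reassoc_of% (L.α_natural (L.mate adj Y)), ← S.T.map_comp, mate_counit,
    S.T.map_comp]

theorem mate_lift (Y : C) :
    L.mate adj Y ≫ R.map (S.l Y) =
      S'.l (R.obj Y) ≫ S'.T.map (L.mate adj Y) ≫ L.mate adj (S.T.obj Y) := by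
  refine adj.hom_ext ?_
  simp only [L.F.map_comp, Category.assoc]
  rw [mate_mate_counit, adj.counit_natural, reassoc_of% (L.mate_counit adj Y), S.l_natural,
    reassoc_of% (L.lift (R.obj Y))]

theorem mate_flip (Y : C) :
    S'.T.map (L.mate adj Y) ≫ L.mate adj (S.T.obj Y) ≫ R.map (S.c Y) =
      S'.c (R.obj Y) ≫ S'.T.map (L.mate adj Y) ≫ L.mate adj (S.T.obj Y) := by
  refine adj.hom_ext ?_
  simp only [L.F.map_comp, Category.assoc]
  rw [mate_mate_counit, adj.counit_natural, reassoc_of% (L.mate_mate_counit adj Y), S.c_natural,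
    reassoc_of% (L.flip (R.obj Y))]

/-- The right adjoint of a strong tangent morphism is a strong tangent morphism as soon as the
mate of the distributive law is invertible. -/
noncomputable def rightAdjoint (h : ∀ Y, IsIso (L.mate adj Y)) : StrongTangentMorphism S S' :=
  -- The mate points from `T' R` to `R T`, so the distributive law of the right adjoint is its
  -- inverse.
  .mk' R (fun Y => (asIso (L.mate adj Y)).symm)
    (fun f => by
      rw [Iso.symm_hom, Iso.symm_hom, Iso.comp_inv_eq, Category.assoc, Iso.eq_inv_comp]
      exact L.mate_natural adj f)
    (fun Y => adj.preservedBy _)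
    (fun Y => (L.mate_additive adj Y).inv (asIso (L.mate adj Y)))
    (fun Y => by
      simp only [Iso.symm_hom, asIso_inv]
      rw [IsIso.eq_inv_comp, ← Category.assoc, L.mate_lift adj]
      simp)
    (fun Y => by
      have h := L.mate_flip adj Y
      simp only [Iso.symm_hom, asIso_inv]
      rw [← cancel_epi (L.mate adj (S.T.obj Y)), ← cancel_epi (S'.T.map (L.mate adj Y)),
        reassoc_of% h]
      simp)

end StrongTangentMorphism

end DoctrinalAdjunction

/-! ### Cartesian lifts as a functor on the comma category. -/

section CartesianLifts

variable {C : Type u₁} [Category.{v₁} C] {D : Type u₂} [Category.{v₂} D] {p : D ⥤ C}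

/-- The functor `c` sends the objects `f : A ⟶ p E` of the comma category to the domains of
cartesian lifts `φ f` of `f`, and the morphisms to the induced morphisms. -/
structure CartesianLifts (c : Comma (𝟭 C) p ⥤ D) where
  φ (Y : Comma (𝟭 C) p) : c.obj Y ⟶ Y.right
  φ_natural {Y Z : Comma (𝟭 C) p} (f : Y ⟶ Z) : c.map f ≫ φ Z = φ Y ≫ f.right
  base (Y : Comma (𝟭 C) p) : p.obj (c.obj Y) = Y.left
  base_map {Y Z : Comma (𝟭 C) p} (f : Y ⟶ Z) :
    p.map (c.map f) = eqToHom (base Y) ≫ f.left ≫ eqToHom (base Z).symm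
  map_φ (Y : Comma (𝟭 C) p) : p.map (φ Y) = eqToHom (base Y) ≫ arr Y
  hom_ext {E : D} {Y : Comma (𝟭 C) p} {χ χ' : E ⟶ c.obj Y} (hp : p.map χ = p.map χ')
    (hφ : χ ≫ φ Y = χ' ≫ φ Y) : χ = χ'
  exists_lift {E : D} {Y : Comma (𝟭 C) p} (g : p.obj E ⟶ Y.left) (h : E ⟶ Y.right)
    (w : g ≫ arr Y = p.map h) :
    ∃ χ : E ⟶ c.obj Y, p.map χ = g ≫ eqToHom (base Y).symm ∧ χ ≫ φ Y = h

namespace Cleavage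

variable (K : Cleavage p)

theorem base {A : C} {E : D} (f : A ⟶ p.obj E) : p.obj (K.pull f) = A :=
  have := K.cartesian f
  IsHomLift.domain_eq p f (K.lift f)

theorem map_lift {A : C} {E : D} (f : A ⟶ p.obj E) :
    p.map (K.lift f) = eqToHom (K.base f) ≫ f := by
  have := K.cartesian f
  simpa using IsHomLift.fac' p f (K.lift f)

theorem hom_ext {A : C} {E E' : D} (f : A ⟶ p.obj E) {χ χ' : E' ⟶ K.pull f}
    (hp : p.map χ = p.map χ') (hφ : χ ≫ K.lift f = χ' ≫ K.lift f) : χ = χ' := by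
  have := K.cartesian f
  have h : p.IsHomLift (p.map χ ≫ eqToHom (K.base f)) χ := inferInstance
  -- Equal projections make both morphisms lifts of the same morphism of the base, so cartesian
  -- uniqueness applies.
  have h' : p.IsHomLift (p.map χ ≫ eqToHom (K.base f)) χ' := by rw [hp]; infer_instance
  exact Functor.IsStronglyCartesian.ext p f (K.lift f) (p.map χ ≫ eqToHom (K.base f)) hφ

theorem exists_lift {A : C} {E E' : D} (f : A ⟶ p.obj E) (g : p.obj E' ⟶ A) (h : E' ⟶ E)
    (w : g ≫ f = p.map h) :
    ∃ χ : E' ⟶ K.pull f, p.map χ = g ≫ eqToHom (K.base f).symm ∧ χ ≫ K.lift f = h := by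
  have := K.cartesian f
  have : p.IsHomLift (g ≫ f) h := by rw [w]; infer_instance
  refine ⟨Functor.IsStronglyCartesian.map p f (K.lift f) (g := g) rfl h, ?_,
    Functor.IsStronglyCartesian.fac _ _ _ _ _⟩
  simpa using IsHomLift.fac' p g (Functor.IsStronglyCartesian.map p f (K.lift f) (g := g) rfl h)

theorem exists_map {Y Z : Comma (𝟭 C) p} (f : Y ⟶ Z) :
    ∃ χ : K.pull (arr Y) ⟶ K.pull (arr Z),
      p.map χ = (eqToHom (K.base (arr Y)) ≫ f.left) ≫ eqToHom (K.base (arr Z)).symm ∧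
      χ ≫ K.lift (arr Z) = K.lift (arr Y) ≫ f.right :=
  K.exists_lift _ _ _ (by rw [p.map_comp, map_lift, Category.assoc, arr_w, Category.assoc])

/-- The morphism between cartesian lifts induced by a morphism of the comma category. -/
noncomputable def map {Y Z : Comma (𝟭 C) p} (f : Y ⟶ Z) : K.pull (arr Y) ⟶ K.pull (arr Z) :=
  (K.exists_map f).choose

theorem proj_map {Y Z : Comma (𝟭 C) p} (f : Y ⟶ Z) :
    p.map (K.map f) = eqToHom (K.base (arr Y)) ≫ f.left ≫ eqToHom (K.base (arr Z)).symm :=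
  (K.exists_map f).choose_spec.1.trans (Category.assoc _ _ _)

theorem map_comp_lift {Y Z : Comma (𝟭 C) p} (f : Y ⟶ Z) :
    K.map f ≫ K.lift (arr Z) = K.lift (arr Y) ≫ f.right :=
  (K.exists_map f).choose_spec.2

/-- The functor on the comma category given by the cartesian lifts of a cleavage. -/
noncomputable def functor : Comma (𝟭 C) p ⥤ D where
  obj Y := K.pull (arr Y)
  map f := K.map f
  -- Functoriality is uniqueness of morphisms into a cartesian lift.
  map_id Y := K.hom_ext _ (by simp [proj_map]) (by simp [map_comp_lift])
  map_comp f g := K.hom_ext _ (by simp [proj_map])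
    (by simp [map_comp_lift, reassoc_of% (K.map_comp_lift f)])

/-- The functor given by a cleavage, with its cartesian lifts. -/
noncomputable def cartesianLifts : CartesianLifts K.functor where
  φ Y := K.lift (arr Y)
  φ_natural f := K.map_comp_lift f
  base Y := K.base (arr Y)
  base_map f := K.proj_map f
  map_φ Y := K.map_lift (arr Y)
  hom_ext hp hφ := K.hom_ext _ hp hφ
  exists_lift g h w := K.exists_lift _ g h w

end Cleavage

namespace CartesianLifts

variable {c : Comma (𝟭 C) p ⥤ D} (K : CartesianLifts c)

/-- This and the next two lemmas move the identification `base` to the left-hand side, the form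
taken by the left component of a composite with the counit. -/
theorem map_eqToHom_base {Y Z : Comma (𝟭 C) p} (f : Y ⟶ Z) :
    p.map (c.map f) ≫ eqToHom (K.base Z) = eqToHom (K.base Y) ≫ f.left := by
  simp [K.base_map]

theorem hom_ext_base {E : D} {Y : Comma (𝟭 C) p} {χ χ' : E ⟶ c.obj Y}
    (hp : p.map χ ≫ eqToHom (K.base Y) = p.map χ' ≫ eqToHom (K.base Y))
    (hφ : χ ≫ K.φ Y = χ' ≫ K.φ Y) : χ = χ' :=
  K.hom_ext ((cancel_mono _).1 hp) hφ

theorem exists_lift_base {E : D} {Y : Comma (𝟭 C) p} (g : p.obj E ⟶ Y.left) (h : E ⟶ Y.right)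
    (w : g ≫ arr Y = p.map h) :
    ∃ χ : E ⟶ c.obj Y, p.map χ ≫ eqToHom (K.base Y) = g ∧ χ ≫ K.φ Y = h := by
  obtain ⟨χ, hχ, hχ'⟩ := K.exists_lift g h w
  exact ⟨χ, by simp [hχ], hχ'⟩

theorem isStronglyCartesian (Y : Comma (𝟭 C) p) : p.IsStronglyCartesian (arr Y) (K.φ Y) :=
  letI h : p.IsHomLift (arr Y) (K.φ Y) :=
    IsHomLift.of_fac' _ _ _ (K.base Y) rfl (by simp [K.map_φ])
  { toIsHomLift := h
    universal_property' := fun {E} g χ hχ => by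
      obtain ⟨k, hk, hk'⟩ := K.exists_lift g χ
        (by simpa using (IsHomLift.fac' p (g ≫ arr Y) χ).symm)
      refine ⟨k, ⟨IsHomLift.of_fac' _ _ _ rfl (K.base Y) (by simp [hk]), hk'⟩, ?_⟩
      rintro k' ⟨h₁, h₂⟩
      -- Being a lift of `g` fixes the projection of `k'`, which leaves only the composite with `φ`
      -- to compare.
      refine K.hom_ext ?_ (h₂.trans hk'.symm)
      rw [hk]
      simpa using IsHomLift.fac' p g k' }

/-- A cartesian lift of an isomorphism is invertible: the inverse is the factorization of the
identity over the inverse in the base. -/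
theorem isIso_φ (Y : Comma (𝟭 C) p) [IsIso (arr Y)] : IsIso (K.φ Y) := by
  obtain ⟨χ, hχ, hχ'⟩ := K.exists_lift (Y := Y) (inv (arr Y)) (𝟙 _) (by simp)
  refine ⟨χ, K.hom_ext ?_ ?_, hχ'⟩
  · simp [K.map_φ, hχ]
  · simp [hχ']

/-- The composite of the lifts of `w` and of `arr Y` lies over `g`, hence factors vertically through
the chosen lift of `g`. -/
theorem exists_comp {Y : Comma (𝟭 C) p} {B : C} {w : B ⟶ p.obj (c.obj Y)}
    {g : B ⟶ p.obj Y.right} (h : w ≫ eqToHom (K.base Y) ≫ arr Y = g) :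
    ∃ θ : c.obj (mkObj w) ⟶ c.obj (mkObj g),
      p.map θ = eqToHom ((K.base (mkObj w)).trans (K.base (mkObj g)).symm) ∧
      θ ≫ K.φ (mkObj g) = K.φ (mkObj w) ≫ K.φ Y := by
  obtain ⟨θ, hθ, hθ'⟩ := K.exists_lift (E := c.obj (mkObj w)) (Y := mkObj g)
    (eqToHom (K.base (mkObj w))) (K.φ (mkObj w) ≫ K.φ Y) (by simp [← h, K.map_φ])
  exact ⟨θ, by simp [hθ], hθ'⟩

/-- The comparison of the cartesian lift of a composite with the composite of cartesian lifts. -/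
noncomputable def compMap {Y : Comma (𝟭 C) p} {B : C} {w : B ⟶ p.obj (c.obj Y)}
    {g : B ⟶ p.obj Y.right} (h : w ≫ eqToHom (K.base Y) ≫ arr Y = g) :
    c.obj (mkObj w) ⟶ c.obj (mkObj g) :=
  (K.exists_comp h).choose

section

variable {Y : Comma (𝟭 C) p} {B : C} {w : B ⟶ p.obj (c.obj Y)} {g : B ⟶ p.obj Y.right}
  (h : w ≫ eqToHom (K.base Y) ≫ arr Y = g)

theorem proj_compMap : p.map (K.compMap h) =
    eqToHom ((K.base (mkObj w)).trans (K.base (mkObj g)).symm) :=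
  (K.exists_comp h).choose_spec.1

theorem compMap_φ : K.compMap h ≫ K.φ (mkObj g) = K.φ (mkObj w) ≫ K.φ Y :=
  (K.exists_comp h).choose_spec.2

/-- Composites of cartesian lifts are cartesian. The inverse is found in two stages: the lift of `g`
is factored through `φ Y` over `w`, and the result is factored vertically through the lift of `w`.
-/
theorem isIso_compMap : IsIso (K.compMap h) := by
  obtain ⟨k, hk, hk'⟩ := K.exists_lift (E := c.obj (mkObj g)) (Y := Y)
    (eqToHom (K.base (mkObj g)) ≫ w ≫ eqToHom (K.base Y)) (K.φ (mkObj g))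
    (by simp [← h, K.map_φ])
  obtain ⟨θ, hθ, hθ'⟩ := K.exists_lift (E := c.obj (mkObj g)) (Y := mkObj w)
    (eqToHom (K.base (mkObj g))) k (by simp [hk])
  have hθp : p.map (K.compMap h) ≫ p.map θ = 𝟙 _ := by simp [K.proj_compMap, hθ]
  -- On the domain of the lift of `w`, uniqueness is needed twice, once for `w` and once for `arr
  -- Y`.
  refine ⟨θ, K.hom_ext (by rw [p.map_comp, hθp, p.map_id]) (K.hom_ext ?_ ?_), K.hom_ext ?_ ?_⟩
  · rw [p.map_comp, p.map_comp, hθp, p.map_comp, p.map_id]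
  · simp only [Category.assoc, Category.id_comp]
    rw [reassoc_of% hθ', hk', K.compMap_φ]
  · simp [K.proj_compMap, hθ]
  · rw [Category.assoc, K.compMap_φ, reassoc_of% hθ', hk', Category.id_comp]

/-- Only the components of `a` and `b` are prescribed, so that the values of `M c` and of the
multiplication on a morphism can be substituted for them. -/
theorem compMap_natural {Y' : Comma (𝟭 C) p} {B' : C} {w' : B' ⟶ p.obj (c.obj Y')}
    {g' : B' ⟶ p.obj Y'.right} (h' : w' ≫ eqToHom (K.base Y') ≫ arr Y' = g') (m : Y ⟶ Y')
    {a : mkObj w ⟶ mkObj w'} {b : mkObj g ⟶ mkObj g'} (ha : a.right = c.map m)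
    (hb : b.right = m.right) (hab : a.left = b.left) :
    c.map a ≫ K.compMap h' = K.compMap h ≫ c.map b := by
  refine K.hom_ext ?_ ?_
  · simp [K.proj_compMap, K.base_map, hab]
  · rw [Category.assoc, K.compMap_φ, Category.assoc, K.φ_natural, reassoc_of% (K.φ_natural a), ha,
      reassoc_of% (K.compMap_φ h), hb, K.φ_natural m]

end

/-- Equal comma objects over the same `E` have the same lift up to transport. This absorbs the
identity 2-morphisms in the pseudoalgebra laws. -/
theorem eqToHom_comp_φ {B B' : C} {E : D} (y : B ⟶ p.obj E) (z : B' ⟶ p.obj E)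
    (h : mkObj y = mkObj z) (e : c.obj (mkObj y) = c.obj (mkObj z)) :
    eqToHom e ≫ K.φ (mkObj z) = K.φ (mkObj y) := by
  cases h
  simp

end CartesianLifts

end CartesianLifts

/-! ### The structure map as the right adjoint of the unit. -/

section AlgebraMaps

open Bicategory

variable {X : TngCat.{v, max u v}}

/-- The functor underlying an object of the slice. -/
abbrev Slice.proj (A : Slice X) : A.dom.carrier ⥤ X.carrier := StrongTangentMorphism.F A.hom

variable {A : Slice X}

/-- The universal counit which exhibits a choice of cartesian lifts as a right adjoint of the
unit of the comma 2-monad. -/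
noncomputable def CartesianLifts.universalCounit {c : Comma (𝟭 X.carrier) A.proj ⥤ A.dom.carrier}
    (K : CartesianLifts c) : UniversalCounit (C := (commaObj A).dom.carrier)
      (StrongTangentMorphism.F (commaUnit A).f) c where
  counit Y := mkHom (X := (StrongTangentMorphism.F (commaUnit A).f).obj (c.obj Y)) (Y := Y)
    (eqToHom (K.base Y)) (K.φ Y)
    (((K.map_φ Y).symm.trans (Category.id_comp _).symm).trans
      (congrArg (· ≫ A.proj.map (K.φ Y)) (arr_commaUnit A (c.obj Y)).symm))
  counit_natural f := Comma.hom_ext _ _ (K.map_eqToHom_base f) (K.φ_natural f)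
  hom_ext h := K.hom_ext_base (congrArg CommaMorphism.left h) (congrArg CommaMorphism.right h)
  -- The source is an identity of the base, so the square of `h` reduces to `h.left ≫ arr Y = Π
  -- h.right`, the hypothesis for a cartesian factorization.
  exists_lift {E Y} h := by
    obtain ⟨χ, hχ, hχ'⟩ := K.exists_lift_base (E := E) (Y := Y) h.left h.right
      ((arr_w (F := A.proj) (X := (StrongTangentMorphism.F (commaUnit A).f).obj E) (Y := Y) h).trans
        ((congrArg (· ≫ A.proj.map h.right) (arr_commaUnit A E)).trans (Category.id_comp _)))
    exact ⟨χ, Comma.hom_ext _ _ hχ hχ'⟩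

namespace CartesianLifts

variable {c : Comma (𝟭 X.carrier) A.proj ⥤ A.dom.carrier} (K : CartesianLifts c)

/-- The distributor of a choice of cartesian lifts. -/
noncomputable def dist (Y : Comma (𝟭 X.carrier) A.proj) :
    A.dom.str.T.obj (c.obj Y) ⟶ c.obj ((commaT A.hom).obj Y) :=
  StrongTangentMorphism.mate (commaUnit A).f K.universalCounit Y

/-- The right component of the defining equation of the mate. The law of the unit is an identity
there, which leaves the defining equation of a distributor. -/
theorem dist_φ (Y : Comma (𝟭 X.carrier) A.proj) :
    K.dist Y ≫ K.φ ((commaT A.hom).obj Y) = A.dom.str.T.map (K.φ Y) :=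
  (congrArg CommaMorphism.right
    (StrongTangentMorphism.mate_counit (commaUnit A).f K.universalCounit Y)).trans
      (Category.id_comp _)

/-- The left component of the same equation, where the law of the unit is that of `Π`. For strict
`Π` it says that the distributor is vertical. -/
theorem proj_dist (Y : Comma (𝟭 X.carrier) A.proj) :
    A.proj.map (K.dist Y) ≫ eqToHom (K.base ((commaT A.hom).obj Y)) =
      (StrongTangentMorphism.α A.hom (c.obj Y)).hom ≫
        eqToHom (congrArg X.str.T.obj (K.base Y)) := by
  have h : A.proj.map (K.dist Y) ≫ eqToHom (K.base ((commaT A.hom).obj Y)) =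
      (StrongTangentMorphism.α A.hom (c.obj Y)).hom ≫ X.str.T.map (eqToHom (K.base Y)) :=
    congrArg CommaMorphism.left
      (StrongTangentMorphism.mate_counit (commaUnit A).f K.universalCounit Y)
  rw [h, eqToHom_map]

/-- The comparison of distributive laws needed for the triangle over `X` to commute strictly: the
comma projection has identity law. -/
theorem proj_inv_dist (Y : Comma (𝟭 X.carrier) A.proj) [IsIso (K.dist Y)] :
    A.proj.map (inv (K.dist Y)) ≫ (StrongTangentMorphism.α A.hom (c.obj Y)).hom =
      eqToHom (K.base ((commaT A.hom).obj Y)) ≫ 𝟙 (X.str.T.obj Y.left) ≫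
        eqToHom (congrArg X.str.T.obj (K.base Y).symm) := by
  rw [Functor.map_inv, IsIso.inv_comp_eq, Category.id_comp, ← Category.assoc, proj_dist]
  simp

/-- The 1-morphism of the slice given by a choice of cartesian lifts with invertible
distributors. -/
noncomputable def algebraMap (h : ∀ Y, IsIso (K.dist Y)) : commaObj A ⟶ A where
  f := StrongTangentMorphism.rightAdjoint (commaUnit A).f K.universalCounit h
  w := StrongTangentMorphism.ext_of _ _
    (CategoryTheory.Functor.ext K.base (fun _ _ f => K.base_map f)) (fun Y =>
      have := h Y
      K.proj_inv_dist Y)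

end CartesianLifts

end AlgebraMaps

/-! ### 2-morphisms of the slice by components. -/

section SliceCells

open Bicategory

variable {X : TngCat.{v, max u v}}

namespace Slice

/-- The functor underlying a 1-morphism of the slice. -/
abbrev functor {A B : Slice X} (F : A ⟶ B) : A.dom.carrier ⥤ B.dom.carrier :=
  StrongTangentMorphism.F F.f

/-- The distributive law of a 1-morphism of the slice. -/
abbrev law {A B : Slice X} (F : A ⟶ B) (Y : A.dom.carrier) :
    (functor F).obj (A.dom.str.T.obj Y) ≅ B.dom.str.T.obj ((functor F).obj Y) :=
  StrongTangentMorphism.α F.f Y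

/-- The components of a 2-morphism of the slice. -/
abbrev app {A B : Slice X} {F G : A ⟶ B} (σ : F ⟶ G) (Y : A.dom.carrier) :
    (functor F).obj Y ⟶ (functor G).obj Y :=
  (TangentTransformation.τ (Hom₂.τ σ)).app Y

theorem app_eqToHom {A B : Slice X} {F G : A ⟶ B} (h : F = G) (Y : A.dom.carrier) :
    app (eqToHom h) Y = eqToHom (by rw [h]) := by
  subst h
  rfl

theorem hom_ext_app {A B : Slice X} {F G : A ⟶ B} {σ τ : F ⟶ G} (h : ∀ Y, app σ Y = app τ Y) :
    σ = τ :=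
  Hom₂.ext (hom_ext_τ h)

section

variable {A B : Slice X} {F G : B ⟶ A} {e : ∀ Y, (functor F).obj Y ⟶ (functor G).obj Y}

/-- `F` and `G` lie over the same tangent morphism to `X`. A family with identity projections is
therefore compatible with their laws after projection. -/
theorem proj_compat
    (he : ∀ Y, A.proj.map (e Y) = eqToHom (StrongTangentMorphism.obj_eq (F.w.trans G.w.symm) Y))
    (Y : B.dom.carrier) :
    A.proj.map (e (B.dom.str.T.obj Y) ≫ (law G Y).hom) =
      A.proj.map ((law F Y).hom ≫ A.dom.str.T.map (e Y)) := by
  rw [← cancel_mono (StrongTangentMorphism.α A.hom ((functor G).obj Y)).hom]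
  have h := StrongTangentMorphism.α_eq (F.w.trans G.w.symm) Y
  change A.proj.map (law F Y).hom ≫ (StrongTangentMorphism.α A.hom ((functor F).obj Y)).hom =
    _ ≫ (A.proj.map (law G Y).hom ≫ (StrongTangentMorphism.α A.hom ((functor G).obj Y)).hom) ≫
      _ at h
  rw [A.proj.map_comp, A.proj.map_comp, Category.assoc, Category.assoc,
    StrongTangentMorphism.α_natural, reassoc_of% h, he, he, eqToHom_map]
  simp

end

/-- An invertible 2-morphism of the slice from its components. -/
def isoMk {A B : Slice X} {F G : B ⟶ A} (e : ∀ Y, (functor F).obj Y ≅ (functor G).obj Y)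
    (natural : ∀ {Y Z : B.dom.carrier} (f : Y ⟶ Z),
      (functor F).map f ≫ (e Z).hom = (e Y).hom ≫ (functor G).map f)
    (compat : ∀ Y, (e (B.dom.str.T.obj Y)).hom ≫ (law G Y).hom =
      (law F Y).hom ≫ A.dom.str.T.map (e Y).hom)
    (proj : ∀ Y, A.proj.map (e Y).hom =
      eqToHom (StrongTangentMorphism.obj_eq (F.w.trans G.w.symm) Y)) : F ≅ G where
  hom :=
    { τ := { τ := { app := fun Y => (e Y).hom, naturality := fun _ _ f => natural f },
             compat := compat }
      w := hom_ext_τ fun Y => (proj Y).trans (eqToHom_τ_app _ Y).symm }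
  inv :=
    { τ := { τ := { app := fun Y => (e Y).inv
                    naturality := fun _ _ f => by
                      rw [Iso.comp_inv_eq, Category.assoc, natural, Iso.inv_hom_id_assoc] }
             compat := fun Y => by
              rw [Iso.inv_comp_eq, ← Category.assoc, compat, Category.assoc,
                ← A.dom.str.T.map_comp, Iso.hom_inv_id, A.dom.str.T.map_id, Category.comp_id] }
      w := hom_ext_τ fun Y => by
        refine Eq.trans ?_ (eqToHom_τ_app _ Y).symm
        change A.proj.map (e Y).inv = _
        rw [← cancel_epi (A.proj.map (e Y).hom), ← A.proj.map_comp, Iso.hom_inv_id, proj]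
        simp }
  hom_inv_id := hom_ext_app fun Y => (e Y).hom_inv_id
  inv_hom_id := hom_ext_app fun Y => (e Y).inv_hom_id

end Slice

end SliceCells

/-! ### Unitor and multiplicator of a choice of cartesian lifts. -/

section PseudoalgebraOfLifts

open Bicategory

variable {X : TngCat.{v, max u v}} {A : Slice X}

/-- A structure map of an algebra of the comma 2-monad. -/
abbrev StructureMap (A : Slice X) := commaObj A ⟶ A

/-- The functor underlying the structure map of an algebra of the comma 2-monad. -/
noncomputable abbrev algFunctor (c : StructureMap A) :
    Comma (𝟭 X.carrier) A.proj ⥤ A.dom.carrier := StrongTangentMorphism.F c.f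

/-- The component at `Y` of the distributive law of the structure map of an algebra. -/
noncomputable abbrev algLaw (c : StructureMap A) (Y : Comma (𝟭 X.carrier) A.proj) :
    (algFunctor c).obj ((commaT A.hom).obj Y) ≅ A.dom.str.T.obj ((algFunctor c).obj Y) :=
  StrongTangentMorphism.α c.f Y

/-- Cartesian lifts compatible with the tangent structures. -/
structure TangentLifts (c : StructureMap A) extends CartesianLifts (algFunctor c) where
  law_φ (Y : Comma (𝟭 X.carrier) A.proj) :
    (algLaw c Y).hom ≫ A.dom.str.T.map (φ Y) = φ ((commaT A.hom).obj Y)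

namespace TangentLifts

variable {c : StructureMap A} (K : TangentLifts c)

/-- Up to the invertible law of `c`, the morphism `T' φ` is itself a chosen cartesian lift, so
uniqueness carries over to it. -/
theorem tangent_hom_ext {E : A.dom.carrier} {Y : Comma (𝟭 X.carrier) A.proj}
    {f g : E ⟶ A.dom.str.T.obj ((algFunctor c).obj Y)} (hp : A.proj.map f = A.proj.map g)
    (hφ : f ≫ A.dom.str.T.map (K.φ Y) = g ≫ A.dom.str.T.map (K.φ Y)) : f = g := by
  rw [← cancel_mono (algLaw c Y).inv]
  refine K.hom_ext (by rw [A.proj.map_comp, hp, A.proj.map_comp]) ?_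
  rw [← K.law_φ, Category.assoc, Category.assoc, Iso.inv_hom_id_assoc, hφ]

end TangentLifts

section

variable (A)

/-- The structure morphism of the value of the unit of the comma 2-monad, an identity. -/
noncomputable def unitArr (E : A.dom.carrier) : A.proj.obj E ⟶ A.proj.obj E :=
  arr (F := A.proj) ((Slice.functor (commaUnit A)).obj E)

theorem unitArr_eq (E : A.dom.carrier) : unitArr A E = 𝟙 (A.proj.obj E) := arr_commaUnit A E

end

variable (c : StructureMap A)

/-- The structure morphism of the value of `M c` at the object `(f, Y)`. -/
noncomputable def mapArr {B : X.carrier} {Y : Comma (𝟭 X.carrier) A.proj} (f : B ⟶ Y.left) :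
    B ⟶ A.proj.obj ((algFunctor c).obj Y) :=
  arr (F := A.proj) ((Slice.functor (commaMap c)).obj
    (mkObj (F := (commaObj A).proj) (E := Y) f))

/-- The structure morphism of the value of the multiplication at the object `(f, Y)`. -/
noncomputable def multArr {B : X.carrier} {Y : Comma (𝟭 X.carrier) A.proj} (f : B ⟶ Y.left) :
    B ⟶ A.proj.obj Y.right :=
  arr (F := A.proj) ((Slice.functor (commaMult A)).obj
    (mkObj (F := (commaObj A).proj) (E := Y) f))

/-- Strict commutativity of the triangle of `c` over `X`, read on objects. -/
theorem alg_base (Y : Comma (𝟭 X.carrier) A.proj) : A.proj.obj ((algFunctor c).obj Y) = Y.left :=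
  StrongTangentMorphism.obj_eq c.w Y

theorem mapArr_eq {B : X.carrier} {Y : Comma (𝟭 X.carrier) A.proj} (f : B ⟶ Y.left) :
    mapArr c f = f ≫ eqToHom (alg_base c Y).symm :=
  arr_commaMap c (mkObj (F := (commaObj A).proj) (E := Y) f)

theorem multArr_eq {B : X.carrier} {Y : Comma (𝟭 X.carrier) A.proj} (f : B ⟶ Y.left) :
    multArr f = f ≫ arr Y :=
  arr_commaMult A (mkObj (F := (commaObj A).proj) (E := Y) f)

/-- The hypothesis under which `compMap` compares the two sides of the multiplicator: lifting along
`f` after lifting along `arr Y` lies over the composite. -/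
theorem mapArr_multArr {B : X.carrier} {Y : Comma (𝟭 X.carrier) A.proj} (f : B ⟶ Y.left)
    (h : A.proj.obj ((algFunctor c).obj Y) = Y.left) :
    mapArr c f ≫ eqToHom h ≫ arr Y = multArr f := by
  rw [mapArr_eq, multArr_eq]
  simp

namespace TangentLifts

variable {c} (K : TangentLifts c)

theorem isIso_φ_unitArr (E : A.dom.carrier) : IsIso (K.φ (mkObj (unitArr A E))) :=
  have : IsIso (arr (mkObj (unitArr A E))) := by
    rw [arr_mkObj, unitArr_eq]
    infer_instance
  K.isIso_φ (mkObj (unitArr A E))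

/-- The components of the inverse of the unitor. -/
noncomputable def unitIso (E : A.dom.carrier) : (algFunctor c).obj (mkObj (unitArr A E)) ≅ E :=
  have := K.isIso_φ_unitArr E
  asIso (K.φ (mkObj (unitArr A E)))

theorem unitIso_hom (E : A.dom.carrier) : (K.unitIso E).hom = K.φ (mkObj (unitArr A E)) := rfl

theorem proj_unitIso (E : A.dom.carrier) :
    A.proj.map (K.unitIso E).hom = eqToHom (K.base (mkObj (unitArr A E))) := by
  rw [unitIso_hom, K.map_φ, arr_mkObj, unitArr_eq, Category.comp_id]

/-- Only the right component of `a` matters after composition with `φ`; the intended `a` is the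
distributive law of the unit. -/
theorem unitIso_compat {E : A.dom.carrier}
    (a : mkObj (unitArr A (A.dom.str.T.obj E)) ⟶ (commaT A.hom).obj (mkObj (unitArr A E)))
    (ha : a.right = 𝟙 (A.dom.str.T.obj E)) :
    (K.unitIso (A.dom.str.T.obj E)).hom ≫ 𝟙 (A.dom.str.T.obj E) =
      ((algFunctor c).map a ≫ (algLaw c (mkObj (unitArr A E))).hom) ≫
        A.dom.str.T.map (K.unitIso E).hom := by
  rw [Category.assoc, unitIso_hom, unitIso_hom, K.law_φ, K.φ_natural, ha]

/-- The unitor of the pseudoalgebra associated to cartesian lifts. -/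
noncomputable def unitor : 𝟙 A ≅ commaUnit A ≫ c :=
  -- The lift of an identity goes from `c (η E)` to `E`, so it is the inverse of `ζ`; hence the
  -- final `.symm`.
  (Slice.isoMk (F := commaUnit A ≫ c) (G := 𝟙 A) K.unitIso
    (fun f => K.φ_natural ((Slice.functor (commaUnit A)).map f))
    (fun E => K.unitIso_compat (Slice.law (commaUnit A) E).hom rfl)
    K.proj_unitIso).symm

/-- The components of the multiplicator of the pseudoalgebra associated to cartesian lifts. -/
noncomputable def multMap {B : X.carrier} {Y : Comma (𝟭 X.carrier) A.proj} (f : B ⟶ Y.left) :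
    (algFunctor c).obj (mkObj (mapArr c f)) ⟶ (algFunctor c).obj (mkObj (multArr f)) :=
  K.compMap (mapArr_multArr c f (K.base Y))

section

variable {B : X.carrier} {Y : Comma (𝟭 X.carrier) A.proj} (f : B ⟶ Y.left)

/-- The components of the multiplicator are invertible. -/
noncomputable def multIso :
    (algFunctor c).obj (mkObj (mapArr c f)) ≅ (algFunctor c).obj (mkObj (multArr f)) :=
  have : IsIso (K.multMap f) := K.isIso_compMap (mapArr_multArr c f (K.base Y))
  asIso (K.multMap f)

theorem multMap_φ : K.multMap f ≫ K.φ (mkObj (multArr f)) = K.φ (mkObj (mapArr c f)) ≫ K.φ Y :=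
  K.compMap_φ _

theorem proj_multMap : A.proj.map (K.multMap f) =
    eqToHom ((K.base (mkObj (mapArr c f))).trans (K.base (mkObj (multArr f))).symm) :=
  K.proj_compMap _

/-- Both sides end in `T'` of a cartesian lift, so `tangent_hom_ext` leaves two equations: the
projected one, supplied as `hp`, and one in which both sides collapse to a composite of two lifts.
-/
theorem multMap_compat {f' : X.str.T.obj B ⟶ ((commaT A.hom).obj Y).left}
    (a : mkObj (mapArr c f') ⟶ (commaT A.hom).obj (mkObj (mapArr c f)))
    (b : mkObj (multArr f') ⟶ (commaT A.hom).obj (mkObj (multArr f)))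
    (ha : a.right = (algLaw c Y).hom) (hb : b.right = 𝟙 (A.dom.str.T.obj Y.right))
    (hp : A.proj.map
        (K.multMap f' ≫ (algFunctor c).map b ≫ (algLaw c (mkObj (multArr f))).hom) =
      A.proj.map (((algFunctor c).map a ≫ (algLaw c (mkObj (mapArr c f))).hom) ≫
        A.dom.str.T.map (K.multMap f))) :
    K.multMap f' ≫ (algFunctor c).map b ≫ (algLaw c (mkObj (multArr f))).hom =
      ((algFunctor c).map a ≫ (algLaw c (mkObj (mapArr c f))).hom) ≫
        A.dom.str.T.map (K.multMap f) := by
  refine K.tangent_hom_ext hp ?_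
  simp only [Category.assoc]
  rw [← A.dom.str.T.map_comp, K.multMap_φ, K.law_φ, A.dom.str.T.map_comp,
    reassoc_of% (K.law_φ (mkObj (mapArr c f))), reassoc_of% (K.φ_natural a), K.φ_natural b,
    reassoc_of% (K.multMap_φ f'), ha, hb, K.law_φ]
  simp

end

/-- The multiplicator of the pseudoalgebra associated to cartesian lifts. -/
noncomputable def multiplicator : commaMap c ≫ c ≅ commaMult A ≫ c :=
  Slice.isoMk (F := commaMap c ≫ c) (G := commaMult A ≫ c)
    (fun Z => K.multIso (arr Z))
    (fun {Z Z'} f => K.compMap_natural (mapArr_multArr c (arr Z) (K.base Z.right))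
      (mapArr_multArr c (arr Z') (K.base Z'.right)) f.right
      (a := (Slice.functor (commaMap c)).map f) (b := (Slice.functor (commaMult A)).map f)
      rfl rfl rfl)
    (fun Z => K.multMap_compat (arr Z) (Slice.law (commaMap c) Z).hom
      (Slice.law (commaMult A) Z).hom
      -- The second component of the law of `M c` is `c` of an identity followed by the law of `c`.
      ((congrArg (· ≫ (algLaw c Z.right).hom) ((algFunctor c).map_id _)).trans (Category.id_comp _))
      (Category.id_comp _)
      -- The projected equation is automatic, since the multiplicator is vertical.
      (Slice.proj_compat (F := commaMap c ≫ c) (G := commaMult A ≫ c)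
        (fun Z => K.proj_multMap (arr Z)) Z))
    (fun Z => K.proj_multMap (arr Z))

end TangentLifts

end PseudoalgebraOfLifts

/-! ### The pseudoalgebra laws. -/

section PseudoalgebraLaws

open Bicategory

variable {X : TngCat.{v, max u v}} {A : Slice X}

theorem commaMap_id (A : Slice X) : commaMap (𝟙 A) = 𝟙 (commaObj A) :=
  commaFunctor.map_id A

theorem commaMap_comp {A B D : Slice X} (f : A ⟶ B) (g : B ⟶ D) :
    commaMap (f ≫ g) = commaMap f ≫ commaMap g :=
  commaFunctor.map_comp f g

namespace TangentLifts

variable {c : StructureMap A} (K : TangentLifts c)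

/-- Followed by `φ`, the multiplicator becomes two successive lifts. The first is the lift of an
identity and cancels the unitor. -/
theorem left_unit_φ {B : X.carrier} {E : A.dom.carrier} {y : B ⟶ A.proj.obj E}
    {w : B ⟶ (mkObj y).left}
    {i₀ : (algFunctor c).obj (mkObj y) ⟶ (algFunctor c).obj (mkObj y)}
    {i₁ : (algFunctor c).obj (mkObj (unitArr A ((algFunctor c).obj (mkObj y)))) ⟶
      (algFunctor c).obj (mkObj (mapArr c w))}
    {i₂ : (algFunctor c).obj (mkObj (multArr w)) ⟶ (algFunctor c).obj (mkObj y)}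
    {e₀ e₁ e₂} (h₀ : i₀ = eqToHom e₀) (h₁ : i₁ = eqToHom e₁) (h₂ : i₂ = eqToHom e₂)
    (k₁ : mkObj (unitArr A ((algFunctor c).obj (mkObj y))) = mkObj (mapArr c w))
    (k₂ : mkObj (multArr w) = mkObj y) :
    (i₀ ≫ (K.unitIso ((algFunctor c).obj (mkObj y))).inv ≫ i₁ ≫ K.multMap w ≫ i₂) ≫
      K.φ (mkObj y) = 𝟙 _ ≫ K.φ (mkObj y) := by
  subst h₀ h₁ h₂
  simp only [eqToHom_refl, Category.id_comp, Category.assoc]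
  rw [K.eqToHom_comp_φ _ _ k₂, K.multMap_φ, ← Category.assoc (eqToHom e₁),
    K.eqToHom_comp_φ _ _ k₁, ← K.unitIso_hom, Iso.inv_hom_id_assoc]

/-- Here the second of the two lifts is that of an identity. Naturality of `φ` at `m` brings the
unitor next to it. -/
theorem right_unit_φ {B : X.carrier} {E : A.dom.carrier} {y y' : B ⟶ A.proj.obj E}
    {z : B ⟶ A.proj.obj ((algFunctor c).obj (mkObj (unitArr A E)))}
    {g : B ⟶ (mkObj (unitArr A E)).left} {m : mkObj y' ⟶ mkObj z}
    {i₀ : (algFunctor c).obj (mkObj y) ⟶ (algFunctor c).obj (mkObj y')}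
    {i₁ : (algFunctor c).obj (mkObj z) ⟶ (algFunctor c).obj (mkObj (mapArr c g))}
    {i₂ : (algFunctor c).obj (mkObj (multArr g)) ⟶ (algFunctor c).obj (mkObj y)}
    {e₀ e₁ e₂} (h₀ : i₀ = eqToHom e₀) (h₁ : i₁ = eqToHom e₁) (h₂ : i₂ = eqToHom e₂)
    (hm : m.right = (K.unitIso E).inv) (k₀ : mkObj y = mkObj y')
    (k₁ : mkObj z = mkObj (mapArr c g)) (k₂ : mkObj (multArr g) = mkObj y) :
    (i₀ ≫ (algFunctor c).map m ≫ i₁ ≫ K.multMap g ≫ i₂) ≫ K.φ (mkObj y) =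
      𝟙 _ ≫ K.φ (mkObj y) := by
  subst h₀ h₁ h₂
  simp only [Category.assoc]
  rw [K.eqToHom_comp_φ _ _ k₂, K.multMap_φ, ← Category.assoc (eqToHom e₁),
    K.eqToHom_comp_φ _ _ k₁, reassoc_of% (K.φ_natural m), hm, ← K.unitIso_hom, Iso.inv_hom_id,
    Category.comp_id, K.eqToHom_comp_φ _ _ k₀, Category.id_comp]

/-- Followed by `φ`, both sides become the same composite of three successive lifts. -/
theorem assoc_φ {B B' : X.carrier} {Y : Comma (𝟭 X.carrier) A.proj} {w : B' ⟶ Y.left}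
    {z₁ : B ⟶ A.proj.obj ((algFunctor c).obj (mkObj (mapArr c w)))}
    {z₂ : B ⟶ A.proj.obj ((algFunctor c).obj (mkObj (multArr w)))}
    {m : mkObj z₁ ⟶ mkObj z₂} {g : B ⟶ (mkObj (multArr w)).left}
    {g' : B ⟶ (mkObj (mapArr c w)).left} {f : B ⟶ Y.left}
    {i₁ : (algFunctor c).obj (mkObj z₂) ⟶ (algFunctor c).obj (mkObj (mapArr c g))}
    {i₂ : (algFunctor c).obj (mkObj (multArr g)) ⟶ (algFunctor c).obj (mkObj (multArr f))}
    {i₃ : (algFunctor c).obj (mkObj z₁) ⟶ (algFunctor c).obj (mkObj (mapArr c g'))}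
    {i₄ : (algFunctor c).obj (mkObj (multArr g')) ⟶ (algFunctor c).obj (mkObj (mapArr c f))}
    {e₁ e₂ e₃ e₄} (h₁ : i₁ = eqToHom e₁) (h₂ : i₂ = eqToHom e₂) (h₃ : i₃ = eqToHom e₃)
    (h₄ : i₄ = eqToHom e₄) (hm : m.right = K.multMap w) (k₁ : mkObj z₂ = mkObj (mapArr c g))
    (k₂ : mkObj (multArr g) = mkObj (multArr f)) (k₃ : mkObj z₁ = mkObj (mapArr c g'))
    (k₄ : mkObj (multArr g') = mkObj (mapArr c f)) :
    ((algFunctor c).map m ≫ i₁ ≫ K.multMap g ≫ i₂) ≫ K.φ (mkObj (multArr f)) =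
      (i₃ ≫ K.multMap g' ≫ i₄ ≫ K.multMap f) ≫ K.φ (mkObj (multArr f)) := by
  subst h₁ h₂ h₃ h₄
  simp only [Category.assoc]
  rw [K.eqToHom_comp_φ _ _ k₂, K.multMap_φ, ← Category.assoc (eqToHom e₁),
    K.eqToHom_comp_φ _ _ k₁, reassoc_of% (K.φ_natural m), hm, K.multMap_φ, K.multMap_φ,
    ← Category.assoc (eqToHom e₄), K.eqToHom_comp_φ _ _ k₄, reassoc_of% (K.multMap_φ g'),
    ← Category.assoc (eqToHom e₃), K.eqToHom_comp_φ _ _ k₃]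

theorem left_unit (h₀ : c = c ≫ 𝟙 A)
    (h₁ : c ≫ commaUnit A ≫ c = commaUnit (commaObj A) ≫ commaMap c ≫ c)
    (h₂ : commaUnit (commaObj A) ≫ commaMult A ≫ c = c) :
    eqToHom h₀ ≫ c ◁ K.unitor.hom ≫ eqToHom h₁ ≫ commaUnit (commaObj A) ◁ K.multiplicator.hom ≫
      eqToHom h₂ = 𝟙 c :=
  Slice.hom_ext_app fun Y =>
    -- Both sides are 2-morphisms of the slice, so their projections to `X` agree; only composites
    -- with `φ` need comparison.
    K.hom_ext (Y := Y) ((slice_w _ Y).trans (slice_w (𝟙 c) Y).symm)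
      (K.left_unit_φ (y := arr Y) (w := arr (F := (commaObj A).proj)
          ((Slice.functor (commaUnit (commaObj A))).obj Y))
        (Slice.app_eqToHom h₀ Y) (Slice.app_eqToHom h₁ Y) (Slice.app_eqToHom h₂ Y)
        (StrongTangentMorphism.obj_eq (congrArg Slice.Hom.f (commaUnit_nat c)) Y)
        (StrongTangentMorphism.obj_eq (congrArg Slice.Hom.f (comma_left_unit A)) Y))

set_option maxHeartbeats 1000000 in
theorem right_unit (h₀ : c = commaMap (𝟙 A) ≫ c)
    (h₁ : commaMap (commaUnit A ≫ c) ≫ c = commaMap (commaUnit A) ≫ commaMap c ≫ c)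
    (h₂ : commaMap (commaUnit A) ≫ commaMult A ≫ c = c) :
    eqToHom h₀ ≫ commaMap₂ K.unitor.hom ▷ c ≫ eqToHom h₁ ≫
      commaMap (commaUnit A) ◁ K.multiplicator.hom ≫ eqToHom h₂ = 𝟙 c :=
  Slice.hom_ext_app fun Y =>
    K.hom_ext (Y := Y) ((slice_w _ Y).trans (slice_w (𝟙 c) Y).symm)
      (K.right_unit_φ (B := Comma.left Y) (E := Comma.right Y) (y := arr Y)
        (y' := arr (F := A.proj) ((Slice.functor (commaMap (𝟙 A))).obj Y))
        (z := arr (F := A.proj) ((Slice.functor (commaMap (commaUnit A ≫ c))).obj Y))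
        (g := arr (F := (commaObj A).proj) ((Slice.functor (commaMap (commaUnit A))).obj Y))
        (m := Slice.app (commaMap₂ K.unitor.hom) Y)
        (Slice.app_eqToHom h₀ Y) (Slice.app_eqToHom h₁ Y) (Slice.app_eqToHom h₂ Y)
        (commaMap₂_right K.unitor.hom Y)
        (StrongTangentMorphism.obj_eq (congrArg Slice.Hom.f (commaMap_id A).symm) Y)
        (StrongTangentMorphism.obj_eq (congrArg Slice.Hom.f (commaMap_comp (commaUnit A) c)) Y)
        (StrongTangentMorphism.obj_eq (congrArg Slice.Hom.f (comma_right_unit A)) Y))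

theorem assoc (h₁ : commaMap (commaMult A ≫ c) ≫ c = commaMap (commaMult A) ≫ commaMap c ≫ c)
    (h₂ : commaMap (commaMult A) ≫ commaMult A ≫ c = commaMult (commaObj A) ≫ commaMult A ≫ c)
    (h₃ : commaMap (commaMap c ≫ c) ≫ c = commaMap (commaMap c) ≫ commaMap c ≫ c)
    (h₄ : commaMap (commaMap c) ≫ commaMult A ≫ c = commaMult (commaObj A) ≫ commaMap c ≫ c) :
    commaMap₂ K.multiplicator.hom ▷ c ≫ eqToHom h₁ ≫
        commaMap (commaMult A) ◁ K.multiplicator.hom ≫ eqToHom h₂ =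
      eqToHom h₃ ≫ commaMap (commaMap c) ◁ K.multiplicator.hom ≫ eqToHom h₄ ≫
        commaMult (commaObj A) ◁ K.multiplicator.hom :=
  Slice.hom_ext_app fun Z =>
    K.hom_ext (Y := (Slice.functor (commaMult (commaObj A) ≫ commaMult A)).obj Z)
      ((slice_w _ Z).trans (slice_w _ Z).symm)
      (K.assoc_φ (Y := Z.right.right) (w := arr Z.right)
        (z₁ := arr (F := A.proj) ((Slice.functor (commaMap (commaMap c ≫ c))).obj Z))
        (z₂ := arr (F := A.proj) ((Slice.functor (commaMap (commaMult A ≫ c))).obj Z))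
        (m := Slice.app (commaMap₂ K.multiplicator.hom) Z)
        (g := arr (F := (commaObj A).proj) ((Slice.functor (commaMap (commaMult A))).obj Z))
        (g' := arr (F := (commaObj A).proj) ((Slice.functor (commaMap (commaMap c))).obj Z))
        (f := arr (F := (commaObj A).proj) ((Slice.functor (commaMult (commaObj A))).obj Z))
        (Slice.app_eqToHom h₁ Z) (Slice.app_eqToHom h₂ Z) (Slice.app_eqToHom h₃ Z)
        (Slice.app_eqToHom h₄ Z) (commaMap₂_right K.multiplicator.hom Z)
        (StrongTangentMorphism.obj_eq (congrArg Slice.Hom.f (commaMap_comp (commaMult A) c)) Z)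
        (StrongTangentMorphism.obj_eq (congrArg Slice.Hom.f (comma_assoc A)) Z)
        (StrongTangentMorphism.obj_eq (congrArg Slice.Hom.f (commaMap_comp (commaMap c) c)) Z)
        (StrongTangentMorphism.obj_eq (congrArg Slice.Hom.f (commaMult_nat c)) Z))

section

attribute [local irreducible] commaObj commaMap commaMap₂ commaUnit commaMult

/-- The pseudoalgebra associated to cartesian lifts compatible with the tangent structures. -/
noncomputable def pseudoalgebra : (commaMonad X).PseudoalgebraStructure A where
  c := c
  ζ := K.unitor
  θ := K.multiplicator
  left_unit := K.left_unit _ _ _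
  right_unit := K.right_unit _ _ _
  assoc := K.assoc _ _ _ _

end

end TangentLifts

end PseudoalgebraLaws

/-! ### Lifts from a unitor. -/

section UnitorData

variable {C : Type u₁} [Category.{v₁} C] {D : Type u₂} [Category.{v₂} D] {p : D ⥤ C}

/-- The part of a pseudoalgebra structure on `p : D ⥤ C` given by the structure map `c` and the
unitor `z`, where `u E` is the identity of `p E`. -/
structure UnitorData (c : Comma (𝟭 C) p ⥤ D) (u : ∀ E, p.obj E ⟶ p.obj E) where
  u_eq (E : D) : u E = 𝟙 (p.obj E)
  base (Y : Comma (𝟭 C) p) : p.obj (c.obj Y) = Y.left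
  base_map {Y Z : Comma (𝟭 C) p} (f : Y ⟶ Z) :
    p.map (c.map f) = eqToHom (base Y) ≫ f.left ≫ eqToHom (base Z).symm
  z (E : D) : c.obj (mkObj (u E)) ≅ E
  z_natural {E E' : D} (m : mkObj (u E) ⟶ mkObj (u E')) :
    c.map m ≫ (z E').hom = (z E).hom ≫ m.right
  proj_z (E : D) : p.map (z E).hom = eqToHom (base (mkObj (u E)))

namespace UnitorData

variable {c : Comma (𝟭 C) p ⥤ D} {u : ∀ E, p.obj E ⟶ p.obj E} (U : UnitorData c u)

theorem arr_unit (U : UnitorData c u) (E : D) : arr (mkObj (u E)) = 𝟙 (p.obj E) := U.u_eq E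

/-- The morphism from `Y` to the unit at `E` given by a morphism `Y.right ⟶ E`. -/
abbrev toUnit {E : D} {Y : Comma (𝟭 C) p} (h : Y.right ⟶ E) : Y ⟶ mkObj (u E) :=
  mkHom (arr Y ≫ p.map h) h (by rw [U.arr_unit, Category.comp_id])

/-- The lift of the structure morphism of `Y`. -/
def φ (Y : Comma (𝟭 C) p) : c.obj Y ⟶ Y.right :=
  c.map (U.toUnit (𝟙 Y.right)) ≫ (U.z Y.right).hom

/-- The target is an identity of the base, so the commuting square forces the left component. -/
theorem left_eq (U : UnitorData c u) {Y : Comma (𝟭 C) p} {E : D} (m : Y ⟶ mkObj (u E)) :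
    m.left = arr Y ≫ p.map m.right := by
  rw [← arr_w m, U.arr_unit, Category.comp_id]

theorem hom_ext_unit (U : UnitorData c u) {Y : Comma (𝟭 C) p} {E : D} {m m' : Y ⟶ mkObj (u E)}
    (h : m.right = m'.right) : m = m' :=
  Comma.hom_ext _ _ (by rw [U.left_eq, U.left_eq, h]) h

/-- Every morphism to a unit factors through the canonical one from `Y` to the unit at `Y.right`;
the rest is naturality of `z`. -/
theorem map_z {Y : Comma (𝟭 C) p} {E : D} (m : Y ⟶ mkObj (u E)) :
    c.map m ≫ (U.z E).hom = U.φ Y ≫ m.right := by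
  have h : m = U.toUnit (𝟙 Y.right) ≫ U.toUnit (Y := mkObj (u Y.right)) m.right :=
    U.hom_ext_unit (Category.id_comp _).symm
  rw [h, c.map_comp, Category.assoc, U.z_natural, φ, Category.assoc]
  simp

theorem φ_natural {Y Z : Comma (𝟭 C) p} (f : Y ⟶ Z) : c.map f ≫ U.φ Z = U.φ Y ≫ f.right := by
  rw [φ, ← Category.assoc, ← c.map_comp, U.map_z]
  simp

theorem map_φ (Y : Comma (𝟭 C) p) : p.map (U.φ Y) = eqToHom (U.base Y) ≫ arr Y := by
  rw [φ, p.map_comp, U.base_map, U.proj_z]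
  simp

theorem φ_unit (E : D) : U.φ (mkObj (u E)) = (U.z E).hom := by
  have h := U.map_z (𝟙 (mkObj (u E)))
  rw [c.map_id, Category.id_comp] at h
  exact (Category.comp_id _).symm.trans h.symm

theorem exists_lift {E : D} {Y : Comma (𝟭 C) p} (g : p.obj E ⟶ Y.left) (h : E ⟶ Y.right)
    (w : g ≫ arr Y = p.map h) :
    ∃ χ : E ⟶ c.obj Y, p.map χ = g ≫ eqToHom (U.base Y).symm ∧ χ ≫ U.φ Y = h := by
  -- The pair `(g, h)` is a comma morphism out of the unit at `E`. Applying `c` and precomposing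
  -- with the unitor gives the factorization.
  refine ⟨(U.z E).inv ≫ c.map (mkHom (X := mkObj (u E)) g h
    (by rw [w, U.arr_unit, Category.id_comp])), ?_, ?_⟩
  · rw [← cancel_epi (p.map (U.z E).hom), ← p.map_comp, Iso.hom_inv_id_assoc, U.base_map, U.proj_z]
  · rw [Category.assoc, U.φ_natural, Iso.inv_comp_eq]
    rw [U.φ_unit]

/-- A unitor gives cartesian lifts as soon as its components at the values of the structure map
are induced by the lifts. -/
def cartesianLifts (hU : ∀ (Y : Comma (𝟭 C) p) (m : mkObj (u (c.obj Y)) ⟶ Y),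
    m.left = eqToHom (U.base Y) → m.right = U.φ Y → (U.z (c.obj Y)).hom = c.map m) :
    CartesianLifts c where
  φ := U.φ
  φ_natural := U.φ_natural
  base := U.base
  base_map := U.base_map
  map_φ := U.map_φ
  exists_lift := U.exists_lift
  hom_ext {E Y χ χ'} hp hφ := by
    -- The would-be counit of the adjunction at `Y`.
    let m : mkObj (u (c.obj Y)) ⟶ Y := mkHom (eqToHom (U.base Y)) (U.φ Y) (by
      rw [U.map_φ, U.arr_unit, Category.id_comp])
    -- The triangle identity `hU` recovers `χ` from its transpose, whose components are the
    -- projection of `χ` and its composite with `φ`.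
    have h (χ : E ⟶ c.obj Y) :
        c.map (U.toUnit (Y := mkObj (u E)) χ ≫ m) = (U.z E).hom ≫ χ := by
      rw [c.map_comp, ← hU Y m rfl rfl, U.z_natural]
    rw [← cancel_epi (U.z E).hom, ← h, ← h]
    congr 1
    refine Comma.hom_ext _ _ ?_ hφ
    simp [hp]

end UnitorData

/-- A morphism between the values of a functor at equal objects of the comma category. -/
theorem exists_map_eq_eqToHom (c : Comma (𝟭 C) p ⥤ D) {B B' : C} {E : D} {v : B ⟶ p.obj E}
    {w : B' ⟶ p.obj E} (h : mkObj v = mkObj w) (e : c.obj (mkObj v) = c.obj (mkObj w)) :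
    ∃ n : mkObj v ⟶ mkObj w, n.left = eqToHom (congrArg Comma.left h) ∧ n.right = 𝟙 E ∧
      eqToHom e = c.map n := by
  cases h
  exact ⟨𝟙 _, rfl, rfl, by simp⟩

end UnitorData

/-! ### The triangle identity from the unit laws. -/

section MultiplicatorData

variable {C : Type u₁} [Category.{v₁} C] {D : Type u₂} [Category.{v₂} D] {p : D ⥤ C}

/-- The part of a pseudoalgebra structure on `p : D ⥤ C` given by the structure map `c`, the
unitor and the multiplicator `t`, with the unit laws. -/
structure MultiplicatorData {c : Comma (𝟭 C) p ⥤ D} {u : ∀ E, p.obj E ⟶ p.obj E}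
    (U : UnitorData c u)
    (mapArr : ∀ {B : C} {Y : Comma (𝟭 C) p}, (B ⟶ Y.left) → (B ⟶ p.obj (c.obj Y)))
    (multArr : ∀ {B : C} {Y : Comma (𝟭 C) p}, (B ⟶ Y.left) → (B ⟶ p.obj Y.right)) where
  mapArr_eq {B : C} {Y : Comma (𝟭 C) p} (f : B ⟶ Y.left) : mapArr f = f ≫ eqToHom (U.base Y).symm
  multArr_eq {B : C} {Y : Comma (𝟭 C) p} (f : B ⟶ Y.left) : multArr f = f ≫ arr Y
  t {B : C} {Y : Comma (𝟭 C) p} (f : B ⟶ Y.left) :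
    c.obj (mkObj (mapArr f)) ⟶ c.obj (mkObj (multArr f))
  t_natural {B B' : C} {Y Y' : Comma (𝟭 C) p} {f : B ⟶ Y.left} {f' : B' ⟶ Y'.left} (b : B ⟶ B')
    (m : Y ⟶ Y') (w : b ≫ f' = f ≫ m.left) (a : mkObj (mapArr f) ⟶ mkObj (mapArr f'))
    (a' : mkObj (multArr f) ⟶ mkObj (multArr f')) (ha : a.left = b) (ha' : a.right = c.map m)
    (hb : a'.left = b) (hb' : a'.right = m.right) : c.map a ≫ t f' = t f ≫ c.map a'
  left_unit (Y : Comma (𝟭 C) p) : ∃ (w : Y.left ⟶ Y.left)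
    (n : mkObj (u (c.obj Y)) ⟶ mkObj (mapArr w)) (n' : mkObj (multArr w) ⟶ Y), w = 𝟙 _ ∧
    n.left = eqToHom (U.base Y) ∧ n.right = 𝟙 _ ∧ n'.left = 𝟙 Y.left ∧ n'.right = 𝟙 Y.right ∧
    (U.z (c.obj Y)).inv ≫ c.map n ≫ t w ≫ c.map n' = 𝟙 (c.obj Y)
  right_unit (Y : Comma (𝟭 C) p) : ∃ (g : Y.left ⟶ (mkObj (u Y.right)).left)
    (k : Y ⟶ mkObj (mapArr g)) (n : mkObj (multArr g) ⟶ Y), g = arr Y ∧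
    k.left = 𝟙 Y.left ∧ k.right = (U.z Y.right).inv ∧ n.left = 𝟙 Y.left ∧ n.right = 𝟙 Y.right ∧
    c.map k ≫ t g ≫ c.map n = 𝟙 (c.obj Y)

namespace MultiplicatorData

variable {c : Comma (𝟭 C) p ⥤ D} {u : ∀ E, p.obj E ⟶ p.obj E} {U : UnitorData c u}
  {mapArr : ∀ {B : C} {Y : Comma (𝟭 C) p}, (B ⟶ Y.left) → (B ⟶ p.obj (c.obj Y))}
  {multArr : ∀ {B : C} {Y : Comma (𝟭 C) p}, (B ⟶ Y.left) → (B ⟶ p.obj Y.right)}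
  (V : MultiplicatorData U mapArr multArr)

/-- The triangle identity. The left unit law expresses `z` at `c Y` through `t` at `(𝟙, Y)`.
Naturality along the canonical morphism from `Y` to the unit at `Y.right` moves this to `t` at `arr
Y` over that unit, which the right unit law computes as a value of `c`. So `z` at `c Y` is itself a
value of `c`. -/
theorem z_eq (V : MultiplicatorData U mapArr multArr) (Y : Comma (𝟭 C) p)
    (m : mkObj (u (c.obj Y)) ⟶ Y) (hm : m.left = eqToHom (U.base Y))
    (hm' : m.right = U.φ Y) : (U.z (c.obj Y)).hom = c.map m := by
  obtain ⟨w, n₁, n₂, hw, h₁, h₁', h₂, h₂', hl⟩ := V.left_unit Y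
  obtain ⟨g, k, n₃, hg, hk, hk', h₃, h₃', hr⟩ := V.right_unit Y
  -- A one-sided inverse `q ≫ k = 𝟙` is enough to solve the right unit law for `t g`.
  let q : mkObj (mapArr g) ⟶ Y := mkHom (𝟙 Y.left) (U.z Y.right).hom (by
    rw [arr_mkObj, V.mapArr_eq, hg, U.proj_z, Category.id_comp]
    simp [arr])
  have hqk : q ≫ k = 𝟙 _ := Comma.hom_ext _ _ (by simp [q, hk]) (by simp [q, hk'])
  have ht : V.t g ≫ c.map n₃ = c.map q := by
    rw [← Category.comp_id (c.map q), ← hr, ← c.map_comp_assoc, hqk, c.map_id, Category.id_comp]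
  let mY : Y ⟶ mkObj (u Y.right) := U.toUnit (𝟙 Y.right)
  have hmY : mY.left = arr Y := by simp [mY]
  let a : mkObj (mapArr w) ⟶ mkObj (mapArr g) := mkHom (𝟙 Y.left) (c.map mY) (by
    rw [arr_mkObj, arr_mkObj, V.mapArr_eq, V.mapArr_eq, hg, hw, U.base_map, hmY]
    simp)
  let a' : mkObj (multArr w) ⟶ mkObj (multArr g) := mkHom (𝟙 Y.left) (𝟙 Y.right) (by
    rw [arr_mkObj, arr_mkObj, V.multArr_eq, V.multArr_eq, hg, hw, U.arr_unit]
    simp)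
  have hn := V.t_natural (𝟙 Y.left) mY (by rw [hg, hw, hmY]) a a' rfl rfl rfl rfl
  have hn₂ : n₂ = a' ≫ n₃ := Comma.hom_ext _ _ (by simp [a', h₂, h₃]) (by simp [a', h₂', h₃'])
  rw [hn₂, c.map_comp, ← reassoc_of% hn, ht, ← c.map_comp, ← c.map_comp, Iso.inv_comp_eq,
    Category.comp_id] at hl
  rw [← hl]
  congr 1
  refine Comma.hom_ext _ _ ?_ ?_
  · simp [hm, a, q, h₁]
  · rw [hm']
    simp [a, q, h₁', UnitorData.φ, mY]

/-- The cartesian lifts given by a unitor and a multiplicator. -/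
def cartesianLifts : CartesianLifts c := U.cartesianLifts V.z_eq

/-- The left unit law computes `t` at `(𝟙, Y)`, and naturality along `(f, 𝟙)` extends this to all
`f`. Hence `t` can only be the comparison of cartesian lifts. -/
theorem t_φ {B : C} {Y : Comma (𝟭 C) p} (f : B ⟶ Y.left) :
    V.t f ≫ U.φ (mkObj (multArr f)) = U.φ (mkObj (mapArr f)) ≫ U.φ Y := by
  obtain ⟨w, n₁, n₂, hw, h₁, h₁', h₂, h₂', hl⟩ := V.left_unit Y
  let n : mkObj (mapArr w) ⟶ mkObj (u (c.obj Y)) := mkHom (eqToHom (U.base Y).symm) (𝟙 _) (by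
    rw [U.arr_unit, arr_mkObj, V.mapArr_eq, hw]
    simp)
  have hnn : n ≫ n₁ = 𝟙 _ := Comma.hom_ext _ _ (by simp [n, h₁]) (by simp [n, h₁'])
  have ht : V.t w ≫ c.map n₂ = c.map n ≫ (U.z (c.obj Y)).hom := by
    rw [← Category.id_comp (V.t w), ← c.map_id, ← hnn, c.map_comp, Category.assoc, Category.assoc]
    rw [Iso.inv_comp_eq, Category.comp_id] at hl
    rw [hl]
  let a : mkObj (mapArr f) ⟶ mkObj (mapArr w) := mkHom f (𝟙 _) (by
    rw [arr_mkObj, arr_mkObj, V.mapArr_eq, V.mapArr_eq, hw]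
    simp)
  let a' : mkObj (multArr f) ⟶ mkObj (multArr w) := mkHom f (𝟙 _) (by
    rw [arr_mkObj, arr_mkObj, V.multArr_eq, V.multArr_eq, hw]
    simp)
  have hn := V.t_natural f (𝟙 Y) (by simp [hw]) a a' rfl (c.map_id Y).symm rfl rfl
  have h := congrArg (· ≫ c.map n₂ ≫ U.φ Y) hn
  simp only [Category.assoc] at h
  rw [reassoc_of% ht, U.φ_natural, reassoc_of% (U.φ_natural a'), h₂',
    ← reassoc_of% (c.map_comp a n), reassoc_of% (U.map_z (a ≫ n))] at h
  simpa [a, a', n] using h.symm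

end MultiplicatorData

end MultiplicatorData

/-! ### Transport morphisms in the unit laws. -/

section EqToHom

variable {C : Type u₁} [Category.{v₁} C] {D : Type u₂} [Category.{v₂} D] {p : D ⥤ C}
  {c : Comma (𝟭 C) p ⥤ D}

/-- Transports between values of `c` are replaced by values of `c` at comma morphisms, so that
functoriality of `c` and naturality of `t` apply to them. -/
theorem exists_left_unit {B : C} {F : D} {y : B ⟶ p.obj F}
    {a : p.obj (c.obj (mkObj y)) ⟶ p.obj (c.obj (mkObj y))}
    {v : B ⟶ p.obj (c.obj (mkObj y))} {x : B ⟶ p.obj F} {ζ : c.obj (mkObj y) ⟶ c.obj (mkObj a)}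
    {t : c.obj (mkObj v) ⟶ c.obj (mkObj x)} {i₀ : c.obj (mkObj y) ⟶ c.obj (mkObj y)}
    {i₁ : c.obj (mkObj a) ⟶ c.obj (mkObj v)} {i₂ : c.obj (mkObj x) ⟶ c.obj (mkObj y)} {e₀ e₁ e₂}
    (h₀ : i₀ = eqToHom e₀) (h₁ : i₁ = eqToHom e₁) (h₂ : i₂ = eqToHom e₂)
    (k₁ : mkObj a = mkObj v) (k₂ : mkObj x = mkObj y) (h : i₀ ≫ ζ ≫ i₁ ≫ t ≫ i₂ = 𝟙 _)
    (b : p.obj (c.obj (mkObj y)) = B) : ∃ (n : mkObj a ⟶ mkObj v) (n' : mkObj x ⟶ mkObj y),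
      n.left = eqToHom b ∧ n.right = 𝟙 _ ∧ n'.left = 𝟙 _ ∧ n'.right = 𝟙 _ ∧
      ζ ≫ c.map n ≫ t ≫ c.map n' = 𝟙 _ := by
  subst h₀ h₁ h₂
  obtain ⟨n, hn, hn', h₁⟩ := exists_map_eq_eqToHom c k₁ e₁
  obtain ⟨n', hk, hk', h₂⟩ := exists_map_eq_eqToHom c k₂ e₂
  refine ⟨n, n', hn, hn', hk, hk', ?_⟩
  refine Eq.trans ?_ h
  rw [h₁, h₂, eqToHom_refl, Category.id_comp]

theorem exists_right_unit {B : C} {E F : D} {y y' : B ⟶ p.obj F}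
    {z v : B ⟶ p.obj E} {x : B ⟶ p.obj F} {m : mkObj y' ⟶ mkObj z}
    {t : c.obj (mkObj v) ⟶ c.obj (mkObj x)} {i₀ : c.obj (mkObj y) ⟶ c.obj (mkObj y')}
    {i₁ : c.obj (mkObj z) ⟶ c.obj (mkObj v)} {i₂ : c.obj (mkObj x) ⟶ c.obj (mkObj y)} {e₀ e₁ e₂}
    (h₀ : i₀ = eqToHom e₀) (h₁ : i₁ = eqToHom e₁) (h₂ : i₂ = eqToHom e₂)
    (k₀ : mkObj y = mkObj y') (k₁ : mkObj z = mkObj v) (k₂ : mkObj x = mkObj y)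
    (hm : m.left = 𝟙 _) (h : i₀ ≫ c.map m ≫ i₁ ≫ t ≫ i₂ = 𝟙 _) :
    ∃ (k : mkObj y ⟶ mkObj v) (n : mkObj x ⟶ mkObj y), k.left = 𝟙 _ ∧ k.right = m.right ∧
      n.left = 𝟙 _ ∧ n.right = 𝟙 _ ∧ c.map k ≫ t ≫ c.map n = 𝟙 _ := by
  subst h₀ h₁ h₂
  obtain ⟨n₀, hn₀, hn₀', h₀⟩ := exists_map_eq_eqToHom c k₀ e₀
  obtain ⟨n₁, hn₁, hn₁', h₁⟩ := exists_map_eq_eqToHom c k₁ e₁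
  obtain ⟨n₂, hn₂, hn₂', h₂⟩ := exists_map_eq_eqToHom c k₂ e₂
  refine ⟨n₀ ≫ m ≫ n₁, n₂, ?_, ?_, hn₂, hn₂', ?_⟩
  · simp [hn₀, hm, hn₁]
  · simp [hn₀', hn₁']
  · refine Eq.trans ?_ h
    rw [h₁, h₂, c.map_comp, c.map_comp, Category.assoc, Category.assoc]
    exact congrArg (· ≫ _) h₀.symm

end EqToHom

/-! ### Lifts of a pseudoalgebra and their tangent compatibility. -/

section LiftsOfPseudoalgebra

open Bicategory

variable {X : TngCat.{v, max u v}} {A : Slice X}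

/-- The data given by the unitor of a pseudoalgebra. -/
noncomputable def unitorData (c : StructureMap A) (ζ : 𝟙 A ≅ commaUnit A ≫ c) :
    UnitorData (algFunctor c) (unitArr A) where
  u_eq := unitArr_eq A
  base := alg_base c
  base_map f := StrongTangentMorphism.map_eq c.w f
  z E := { hom := Slice.app ζ.inv E
           inv := Slice.app ζ.hom E
           hom_inv_id := congrArg (fun σ : commaUnit A ≫ c ⟶ commaUnit A ≫ c => Slice.app σ E)
             ζ.inv_hom_id
           inv_hom_id := congrArg (fun σ : 𝟙 A ⟶ 𝟙 A => Slice.app σ E) ζ.hom_inv_id }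
  z_natural {E E'} m := by
    -- The unit is full onto morphisms between its values: both ends are identities of the base,
    -- which forces the left component.
    have h : m = (Slice.functor (commaUnit A)).map m.right :=
      Comma.hom_ext _ _
        (((Category.comp_id _).symm.trans (congrArg (m.left ≫ ·) (unitArr_eq A E').symm)).trans
          ((arr_w m).trans ((congrArg (· ≫ A.proj.map m.right) (unitArr_eq A E)).trans
            (Category.id_comp _)))) rfl
    exact (congrArg (fun n => (algFunctor c).map n ≫ Slice.app ζ.inv E') h).trans
      ((TangentTransformation.τ (Slice.Hom₂.τ ζ.inv)).naturality m.right)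
  proj_z E := slice_w ζ.inv E

/-- The component of the multiplicator of a pseudoalgebra at the object `(f, Y)`. -/
noncomputable def multComponent {c : StructureMap A} (θ : commaMap c ≫ c ⟶ commaMult A ≫ c)
    {B : X.carrier} {Y : Comma (𝟭 X.carrier) A.proj} (f : B ⟶ Y.left) :
    (algFunctor c).obj (mkObj (mapArr c f)) ⟶ (algFunctor c).obj (mkObj (multArr f)) :=
  Slice.app θ (mkObj (F := (commaObj A).proj) (E := Y) f)

theorem multComponent_natural {c : StructureMap A} (θ : commaMap c ≫ c ⟶ commaMult A ≫ c)
    {B B' : X.carrier} {Y Y' : Comma (𝟭 X.carrier) A.proj} {f : B ⟶ Y.left} {f' : B' ⟶ Y'.left}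
    (b : B ⟶ B') (m : Y ⟶ Y') (w : b ≫ f' = f ≫ m.left)
    (a : mkObj (mapArr c f) ⟶ mkObj (mapArr c f'))
    (a' : mkObj (multArr f) ⟶ mkObj (multArr f')) (ha : a.left = b)
    (ha' : a.right = (algFunctor c).map m) (hb : a'.left = b) (hb' : a'.right = m.right) :
    (algFunctor c).map a ≫ multComponent θ f' = multComponent θ f ≫ (algFunctor c).map a' := by
  -- The prescribed components force `a` and `a'` to be the images of this one morphism, at which
  -- `θ` is natural.
  let n : mkObj (F := (commaObj A).proj) (E := Y) f ⟶ mkObj (F := (commaObj A).proj) (E := Y') f' :=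
    mkHom b m w
  have h₁ : a = (Slice.functor (commaMap c)).map n := Comma.hom_ext _ _ ha ha'
  have h₂ : a' = (Slice.functor (commaMult A)).map n := Comma.hom_ext _ _ hb hb'
  rw [h₁, h₂]
  exact (TangentTransformation.τ (Slice.Hom₂.τ θ)).naturality n

theorem left_unit_component {c : StructureMap A} {ζ : 𝟙 A ⟶ commaUnit A ≫ c}
    {θ : commaMap c ≫ c ⟶ commaMult A ≫ c} {h₀ : c = c ≫ 𝟙 A}
    {h₁ : c ≫ commaUnit A ≫ c = commaUnit (commaObj A) ≫ commaMap c ≫ c}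
    {h₂ : commaUnit (commaObj A) ≫ commaMult A ≫ c = c}
    (h : eqToHom h₀ ≫ c ◁ ζ ≫ eqToHom h₁ ≫ commaUnit (commaObj A) ◁ θ ≫ eqToHom h₂ = 𝟙 c)
    (Y : Comma (𝟭 X.carrier) A.proj) : ∃ (w : Y.left ⟶ Y.left)
    (n : mkObj (unitArr A ((algFunctor c).obj Y)) ⟶ mkObj (mapArr c w))
    (n' : mkObj (multArr w) ⟶ Y), w = 𝟙 _ ∧ n.left = eqToHom (alg_base c Y) ∧ n.right = 𝟙 _ ∧
    n'.left = 𝟙 Y.left ∧ n'.right = 𝟙 Y.right ∧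
    Slice.app ζ ((algFunctor c).obj Y) ≫ (algFunctor c).map n ≫ multComponent θ w ≫
      (algFunctor c).map n' = 𝟙 ((algFunctor c).obj Y) := by
  let w : Y.left ⟶ Y.left := arr (F := (commaObj A).proj)
    ((Slice.functor (commaUnit (commaObj A))).obj Y)
  obtain ⟨n, n', H⟩ := exists_left_unit (c := algFunctor c) (y := arr Y)
    (a := unitArr A ((algFunctor c).obj Y)) (v := mapArr c w) (x := multArr w)
    (ζ := Slice.app ζ ((algFunctor c).obj Y)) (t := multComponent θ w)
    (Slice.app_eqToHom h₀ Y) (Slice.app_eqToHom h₁ Y) (Slice.app_eqToHom h₂ Y)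
    (StrongTangentMorphism.obj_eq (congrArg Slice.Hom.f (commaUnit_nat c)) Y)
    (StrongTangentMorphism.obj_eq (congrArg Slice.Hom.f (comma_left_unit A)) Y)
    (congrArg (fun σ : c ⟶ c => Slice.app σ Y) h) (alg_base c Y)
  exact ⟨w, n, n', arr_commaUnit (commaObj A) Y, H⟩

theorem right_unit_component {c : StructureMap A} {ζ : 𝟙 A ⟶ commaUnit A ≫ c}
    {θ : commaMap c ≫ c ⟶ commaMult A ≫ c} {h₀ : c = commaMap (𝟙 A) ≫ c}
    {h₁ : commaMap (commaUnit A ≫ c) ≫ c = commaMap (commaUnit A) ≫ commaMap c ≫ c}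
    {h₂ : commaMap (commaUnit A) ≫ commaMult A ≫ c = c}
    (h : eqToHom h₀ ≫ commaMap₂ ζ ▷ c ≫ eqToHom h₁ ≫ commaMap (commaUnit A) ◁ θ ≫
      eqToHom h₂ = 𝟙 c)
    (Y : Comma (𝟭 X.carrier) A.proj) : ∃ (g : Y.left ⟶ (mkObj (unitArr A Y.right)).left)
    (k : Y ⟶ mkObj (mapArr c g)) (n : mkObj (multArr g) ⟶ Y), g = arr Y ∧
    k.left = 𝟙 Y.left ∧ k.right = Slice.app ζ Y.right ∧ n.left = 𝟙 Y.left ∧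
    n.right = 𝟙 Y.right ∧
    (algFunctor c).map k ≫ multComponent θ g ≫ (algFunctor c).map n =
      𝟙 ((algFunctor c).obj Y) := by
  let g : Y.left ⟶ (mkObj (unitArr A Y.right)).left :=
    arr (F := (commaObj A).proj) ((Slice.functor (commaMap (commaUnit A))).obj Y)
  have hg : g = arr Y := (arr_commaMap (commaUnit A) Y).trans (Category.comp_id _)
  obtain ⟨k, n, h₁, h₂, H⟩ := exists_right_unit (c := algFunctor c) (y := arr Y)
    (y' := arr (F := A.proj) ((Slice.functor (commaMap (𝟙 A))).obj Y))
    (z := arr (F := A.proj) ((Slice.functor (commaMap (commaUnit A ≫ c))).obj Y))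
    (v := mapArr c g) (x := multArr (Y := mkObj (unitArr A Y.right)) g)
    (m := Slice.app (commaMap₂ ζ) Y) (t := multComponent θ g)
    (Slice.app_eqToHom h₀ Y) (Slice.app_eqToHom h₁ Y) (Slice.app_eqToHom h₂ Y)
    (StrongTangentMorphism.obj_eq (congrArg Slice.Hom.f (commaMap_id A).symm) Y)
    (StrongTangentMorphism.obj_eq (congrArg Slice.Hom.f (commaMap_comp (commaUnit A) c)) Y)
    (StrongTangentMorphism.obj_eq (congrArg Slice.Hom.f (comma_right_unit A)) Y)
    (slice_w (commaMap₂ ζ) Y) (congrArg (fun σ : c ⟶ c => Slice.app σ Y) h)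
  exact ⟨g, k, n, hg, h₁, h₂.trans (commaMap₂_right ζ Y), H⟩

/-- The data given by the unitor and the multiplicator of a pseudoalgebra. -/
noncomputable def multiplicatorData {c : StructureMap A} (ζ : 𝟙 A ≅ commaUnit A ≫ c)
    (θ : commaMap c ≫ c ≅ commaMult A ≫ c) {h₀ : c = c ≫ 𝟙 A}
    {h₁ : c ≫ commaUnit A ≫ c = commaUnit (commaObj A) ≫ commaMap c ≫ c}
    {h₂ : commaUnit (commaObj A) ≫ commaMult A ≫ c = c}
    (hl : eqToHom h₀ ≫ c ◁ ζ.hom ≫ eqToHom h₁ ≫ commaUnit (commaObj A) ◁ θ.hom ≫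
      eqToHom h₂ = 𝟙 c)
    {h₃ : c = commaMap (𝟙 A) ≫ c}
    {h₄ : commaMap (commaUnit A ≫ c) ≫ c = commaMap (commaUnit A) ≫ commaMap c ≫ c}
    {h₅ : commaMap (commaUnit A) ≫ commaMult A ≫ c = c}
    (hr : eqToHom h₃ ≫ commaMap₂ ζ.hom ▷ c ≫ eqToHom h₄ ≫ commaMap (commaUnit A) ◁ θ.hom ≫
      eqToHom h₅ = 𝟙 c) :
    MultiplicatorData (unitorData c ζ) (mapArr c) multArr where
  mapArr_eq := mapArr_eq c
  multArr_eq := multArr_eq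
  t := multComponent θ.hom
  t_natural := multComponent_natural θ.hom
  left_unit := left_unit_component hl
  right_unit := right_unit_component hr

/-- As `φ` is `c` of the canonical morphism to a unit followed by the inverse unitor, its
compatibility combines naturality of the law of `c` with the tangent compatibility of `ζ`. -/
theorem unitorData_law {c : StructureMap A} (ζ : 𝟙 A ≅ commaUnit A ≫ c)
    (Y : Comma (𝟭 X.carrier) A.proj) :
    (algLaw c Y).hom ≫ A.dom.str.T.map ((unitorData c ζ).φ Y) =
      (unitorData c ζ).φ ((commaT A.hom).obj Y) := by
  let U := unitorData c ζ
  -- The unit at `T' E` and `T̄` of the unit at `E` differ by the law of `Π`; `i` and `j` compare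
  -- them and have identity right components.
  let i : mkObj (unitArr A (A.dom.str.T.obj Y.right)) ⟶
      (commaT A.hom).obj (mkObj (unitArr A Y.right)) := (Slice.law (commaUnit A) Y.right).hom
  let j : (commaT A.hom).obj (mkObj (unitArr A Y.right)) ⟶
      mkObj (unitArr A (A.dom.str.T.obj Y.right)) := (Slice.law (commaUnit A) Y.right).inv
  have hji : j ≫ i = 𝟙 _ := (Slice.law (commaUnit A) Y.right).inv_hom_id
  have hj : j.right = 𝟙 (A.dom.str.T.obj Y.right) := rfl
  have h₁ : (U.z (A.dom.str.T.obj Y.right)).hom ≫ 𝟙 (A.dom.str.T.obj Y.right) =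
      ((algFunctor c).map i ≫ (algLaw c (mkObj (unitArr A Y.right))).hom) ≫
        A.dom.str.T.map (U.z Y.right).hom :=
    (TangentTransformation.compat (Slice.Hom₂.τ ζ.inv) Y.right)
  let n : Y ⟶ mkObj (unitArr A Y.right) := U.toUnit (𝟙 Y.right)
  have h₂ : (algFunctor c).map ((commaT A.hom).map n) ≫
      (algLaw c (mkObj (unitArr A Y.right))).hom =
        (algLaw c Y).hom ≫ A.dom.str.T.map ((algFunctor c).map n) :=
    StrongTangentMorphism.α_natural c.f n
  have h₃ : A.dom.str.T.map (U.φ Y) =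
    A.dom.str.T.map ((algFunctor c).map n) ≫ A.dom.str.T.map (U.z Y.right).hom :=
    A.dom.str.T.map_comp _ _
  have h₄ := U.map_z ((commaT A.hom).map n ≫ j)
  have h₅ : (algFunctor c).map j ≫ (U.z (A.dom.str.T.obj Y.right)).hom =
      (algLaw c (mkObj (unitArr A Y.right))).hom ≫ A.dom.str.T.map (U.z Y.right).hom := by
    rw [Category.comp_id, Category.assoc] at h₁
    rw [h₁, ← (algFunctor c).map_comp_assoc, hji, (algFunctor c).map_id, Category.id_comp]
  refine (congrArg ((algLaw c Y).hom ≫ ·) h₃).trans ?_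
  rw [← reassoc_of% h₂, ← h₅, ← (algFunctor c).map_comp_assoc, h₄]
  refine (congrArg (U.φ _ ≫ ·) ?_).trans (Category.comp_id _)
  refine (congrArg (A.dom.str.T.map (𝟙 Y.right) ≫ ·) hj).trans ?_
  rw [A.dom.str.T.map_id]
  exact Category.comp_id _

end LiftsOfPseudoalgebra

/-! ### A pseudoalgebra is determined by its lifts. -/

section Uniqueness

open Bicategory

variable {X : TngCat.{v, max u v}} {A : Slice X}

/-- The cartesian lifts given by a unitor and a multiplicator which satisfy the unit laws. -/
noncomputable def tangentLifts {c : StructureMap A} (ζ : 𝟙 A ≅ commaUnit A ≫ c)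
    (θ : commaMap c ≫ c ≅ commaMult A ≫ c) {h₀ : c = c ≫ 𝟙 A}
    {h₁ : c ≫ commaUnit A ≫ c = commaUnit (commaObj A) ≫ commaMap c ≫ c}
    {h₂ : commaUnit (commaObj A) ≫ commaMult A ≫ c = c}
    (hl : eqToHom h₀ ≫ c ◁ ζ.hom ≫ eqToHom h₁ ≫ commaUnit (commaObj A) ◁ θ.hom ≫
      eqToHom h₂ = 𝟙 c)
    {h₃ : c = commaMap (𝟙 A) ≫ c}
    {h₄ : commaMap (commaUnit A ≫ c) ≫ c = commaMap (commaUnit A) ≫ commaMap c ≫ c}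
    {h₅ : commaMap (commaUnit A) ≫ commaMult A ≫ c = c}
    (hr : eqToHom h₃ ≫ commaMap₂ ζ.hom ▷ c ≫ eqToHom h₄ ≫ commaMap (commaUnit A) ◁ θ.hom ≫
      eqToHom h₅ = 𝟙 c) : TangentLifts c where
  toCartesianLifts := (multiplicatorData ζ θ hl hr).cartesianLifts
  law_φ := unitorData_law ζ

/-- At units, `φ` is the inverse of the unitor. -/
theorem unitor_eq_of_φ_eq {c : StructureMap A} {ζ ζ' : 𝟙 A ≅ commaUnit A ≫ c}
    (h : ∀ Y, (unitorData c ζ).φ Y = (unitorData c ζ').φ Y) : ζ = ζ' := by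
  refine Iso.ext_inv (Slice.hom_ext_app fun E => ?_)
  exact ((unitorData c ζ).φ_unit E).symm.trans
    ((h (mkObj (unitArr A E))).trans ((unitorData c ζ').φ_unit E))

/-- Both are vertical, and `t_φ` gives both the same composite with the cartesian lift. -/
theorem multiplicator_eq {c : StructureMap A} {ζ : 𝟙 A ≅ commaUnit A ≫ c}
    {θ θ' : commaMap c ≫ c ≅ commaMult A ≫ c} {h₀ : c = c ≫ 𝟙 A}
    {h₁ : c ≫ commaUnit A ≫ c = commaUnit (commaObj A) ≫ commaMap c ≫ c}
    {h₂ : commaUnit (commaObj A) ≫ commaMult A ≫ c = c}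
    (hl : eqToHom h₀ ≫ c ◁ ζ.hom ≫ eqToHom h₁ ≫ commaUnit (commaObj A) ◁ θ.hom ≫
      eqToHom h₂ = 𝟙 c)
    (hl' : eqToHom h₀ ≫ c ◁ ζ.hom ≫ eqToHom h₁ ≫ commaUnit (commaObj A) ◁ θ'.hom ≫
      eqToHom h₂ = 𝟙 c)
    {h₃ : c = commaMap (𝟙 A) ≫ c}
    {h₄ : commaMap (commaUnit A ≫ c) ≫ c = commaMap (commaUnit A) ≫ commaMap c ≫ c}
    {h₅ : commaMap (commaUnit A) ≫ commaMult A ≫ c = c}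
    (hr : eqToHom h₃ ≫ commaMap₂ ζ.hom ▷ c ≫ eqToHom h₄ ≫ commaMap (commaUnit A) ◁ θ.hom ≫
      eqToHom h₅ = 𝟙 c)
    (hr' : eqToHom h₃ ≫ commaMap₂ ζ.hom ▷ c ≫ eqToHom h₄ ≫ commaMap (commaUnit A) ◁ θ'.hom ≫
      eqToHom h₅ = 𝟙 c) : θ = θ' :=
  Iso.ext (Slice.hom_ext_app fun Z =>
    (multiplicatorData ζ θ hl hr).cartesianLifts.hom_ext (Y := mkObj (multArr (arr Z)))
      ((slice_w θ.hom Z).trans (slice_w θ'.hom Z).symm)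
      (((multiplicatorData ζ θ hl hr).t_φ (Y := Z.right) (arr Z)).trans
        ((multiplicatorData ζ θ' hl' hr').t_φ (Y := Z.right) (arr Z)).symm))

theorem CartesianLifts.map_eq {C : Type u₁} [Category.{v₁} C] {D : Type u₂} [Category.{v₂} D]
    {p : D ⥤ C} {c c' : Comma (𝟭 C) p ⥤ D} (K : CartesianLifts c) (K' : CartesianLifts c')
    (hobj : ∀ Y, c.obj Y = c'.obj Y) (hφ : ∀ Y, K.φ Y = eqToHom (hobj Y) ≫ K'.φ Y)
    {Y Z : Comma (𝟭 C) p} (f : Y ⟶ Z) :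
    c.map f = eqToHom (hobj Y) ≫ c'.map f ≫ eqToHom (hobj Z).symm := by
  refine K.hom_ext ?_ ?_
  · rw [p.map_comp, p.map_comp, K.base_map, K'.base_map, eqToHom_map, eqToHom_map]
    simp
  · rw [K.φ_natural, hφ Y, hφ Z]
    simp [K'.φ_natural]

/-- The law of `c` is fixed by its projection, dictated by the triangle over `X`, and by its
composite with `T' φ`. -/
theorem TangentLifts.algLaw_eq {c c' : StructureMap A} (K : TangentLifts c)
    (K' : TangentLifts c') (hobj : ∀ Y, (algFunctor c).obj Y = (algFunctor c').obj Y)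
    (hφ : ∀ Y, K.φ Y = eqToHom (hobj Y) ≫ K'.φ Y) (Y : Comma (𝟭 X.carrier) A.proj) :
    (algLaw c Y).hom = eqToHom (hobj ((commaT A.hom).obj Y)) ≫ (algLaw c' Y).hom ≫
      eqToHom (congrArg A.dom.str.T.obj (hobj Y).symm) := by
  refine K.tangent_hom_ext ?_ ?_
  · rw [← cancel_mono (StrongTangentMorphism.α A.hom ((algFunctor c).obj Y)).hom]
    have h := StrongTangentMorphism.α_eq (c.w.trans c'.w.symm) Y
    change A.proj.map (algLaw c Y).hom ≫
      (StrongTangentMorphism.α A.hom ((algFunctor c).obj Y)).hom = _ ≫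
        (A.proj.map (algLaw c' Y).hom ≫
          (StrongTangentMorphism.α A.hom ((algFunctor c').obj Y)).hom) ≫ _ at h
    have hn := StrongTangentMorphism.α_natural A.hom (eqToHom (hobj Y).symm)
    rw [eqToHom_map A.dom.str.T] at hn
    rw [h, A.proj.map_comp, A.proj.map_comp, Category.assoc, Category.assoc, Category.assoc, hn,
      eqToHom_map, eqToHom_map, eqToHom_map]
    rfl
  · have h : eqToHom (congrArg A.dom.str.T.obj (hobj Y).symm) ≫ A.dom.str.T.map (K.φ Y) =
        A.dom.str.T.map (K'.φ Y) := by
      rw [hφ, A.dom.str.T.map_comp, eqToHom_map]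
      simp
    rw [Category.assoc, Category.assoc, h, K.law_φ, K'.law_φ, hφ]

theorem TangentLifts.structureMap_eq {c c' : StructureMap A} (K : TangentLifts c)
    (K' : TangentLifts c') (hobj : ∀ Y, (algFunctor c).obj Y = (algFunctor c').obj Y)
    (hφ : ∀ Y, K.φ Y = eqToHom (hobj Y) ≫ K'.φ Y) : c = c' :=
  Slice.Hom.ext (StrongTangentMorphism.ext_of _ _
    (CategoryTheory.Functor.ext hobj fun _ _ f =>
      K.toCartesianLifts.map_eq K'.toCartesianLifts hobj hφ f) (K.algLaw_eq K' hobj hφ))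

end Uniqueness

/-! ### Extensionality of pseudoalgebra structures. -/

section Pseudoalgebras

open Bicategory

variable {X : TngCat.{v, max u v}} {A : Slice X}

section

attribute [local irreducible] commaObj commaMap commaMap₂ commaUnit commaMult

/-- The cartesian lifts of a pseudoalgebra of the comma 2-monad. -/
noncomputable def pseudoalgebraLifts (P : (commaMonad X).PseudoalgebraStructure A) :
    TangentLifts (A := A) P.c :=
  tangentLifts (c := P.c) P.ζ P.θ P.left_unit P.right_unit

theorem pseudoalgebra_cells_eq {c : (commaMonad X).M.obj A ⟶ A}
    {ζ ζ' : 𝟙 A ≅ (commaMonad X).η A ≫ c} {θ θ' : (commaMonad X).M.map c ≫ c ≅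
      (commaMonad X).μ A ≫ c} {l r a l' r' a'}
    (h : ∀ Y : Comma (𝟭 X.carrier) A.proj,
      (unitorData (A := A) c ζ).φ Y = (unitorData (A := A) c ζ').φ Y) :
    (⟨c, ζ, θ, l, r, a⟩ : (commaMonad X).PseudoalgebraStructure A) = ⟨c, ζ', θ', l', r', a'⟩ := by
  obtain rfl : ζ = ζ' := unitor_eq_of_φ_eq (A := A) (c := c) h
  obtain rfl : θ = θ' := multiplicator_eq (A := A) (c := c) (ζ := ζ) l l' r r'
  rfl

end

/-- The two comma morphisms to the unit at `E` have the same right component and are therefore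
equal. -/
theorem liftChoice_lift (P : (commaMonad X).PseudoalgebraStructure A) {B : X.carrier}
    {E : A.dom.carrier} (f : B ⟶ A.proj.obj E) :
    (liftChoice P).lift f = (pseudoalgebraLifts P).φ (mkObj f) :=
  congrArg (fun n : mkObj f ⟶ mkObj (unitArr A E) =>
      (algFunctor (A := A) P.c).map n ≫ (TangentTransformation.τ (Slice.Hom₂.τ P.ζ.inv)).app E)
    ((unitorData (A := A) P.c P.ζ).hom_ext_unit rfl)

theorem LiftChoice.lift_eq {C : Type u₁} [Category.{v₁} C] {D : Type u₂} [Category.{v₂} D]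
    {p : D ⥤ C} {L L' : LiftChoice p} (h : L = L') {B : C} {E : D} (f : B ⟶ p.obj E) :
    L.lift f = eqToHom (by rw [h]) ≫ L'.lift f := by
  subst h
  simp

theorem pseudoalgebra_ext {P Q : (commaMonad X).PseudoalgebraStructure A}
    (h : liftChoice P = liftChoice Q) : P = Q := by
  have hφ (Y : Comma (𝟭 X.carrier) A.proj) :
      ∃ e, (pseudoalgebraLifts P).φ Y = eqToHom e ≫ (pseudoalgebraLifts Q).φ Y := by
    have := LiftChoice.lift_eq h (arr Y)
    rw [liftChoice_lift, liftChoice_lift] at this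
    exact ⟨_, this⟩
  have hc : P.c = Q.c :=
    TangentLifts.structureMap_eq (pseudoalgebraLifts P) (pseudoalgebraLifts Q)
      (fun Y => (hφ Y).choose) (fun Y => (hφ Y).choose_spec)
  obtain ⟨c, ζ, θ, l, r, a⟩ := P
  obtain ⟨c', ζ', θ', l', r', a'⟩ := Q
  -- Once the structure maps are identified, the remaining transport in `hφ` is an identity.
  obtain rfl : c = c' := hc
  refine pseudoalgebra_cells_eq fun Y => ?_
  obtain ⟨_, h⟩ := hφ Y
  exact h.trans (Category.id_comp _)

end Pseudoalgebras

/-! ### Characterization of the distributor. -/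

section Distributors

variable {C : Type u₁} [Category.{v₁} C] {D : Type u₂} [Category.{v₂} D]
  {S : TangentStructure C} {S' : TangentStructure D} {R : StrongTangentMorphism S' S}

theorem distributor_lift (hR : R.IsStrict) (K : Cleavage R.F) {A : C} {E : D}
    (f : A ⟶ R.F.obj E) :
    distributor hR K f ≫ K.lift (S.T.map f ≫ (R.α E).inv) = S'.T.map (K.lift f) :=
  have := K.cartesian (S.T.map f ≫ (R.α E).inv)
  have := hR.isHomLift f (K.lift f) (K.cartesian f).toIsHomLift
  Functor.IsStronglyCartesian.fac R.F (S.T.map f ≫ (R.α E).inv)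
    (K.lift (S.T.map f ≫ (R.α E).inv)) (Category.id_comp _).symm (S'.T.map (K.lift f))

theorem proj_distributor (hR : R.IsStrict) (K : Cleavage R.F) {A : C} {E : D}
    (f : A ⟶ R.F.obj E) (h : R.F.obj (S'.T.obj (K.pull f)) =
      R.F.obj (K.pull (S.T.map f ≫ (R.α E).inv))) :
    R.F.map (distributor hR K f) = eqToHom h := by
  have := K.cartesian (S.T.map f ≫ (R.α E).inv)
  have := hR.isHomLift f (K.lift f) (K.cartesian f).toIsHomLift
  have : R.F.IsHomLift (𝟙 (S.T.obj A)) (distributor hR K f) :=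
    Functor.IsStronglyCartesian.map_isHomLift R.F (S.T.map f ≫ (R.α E).inv)
      (K.lift (S.T.map f ≫ (R.α E).inv)) (Category.id_comp _).symm (S'.T.map (K.lift f))
  simpa using IsHomLift.fac' R.F (𝟙 (S.T.obj A)) (distributor hR K f)

/-- The projection hypothesis is stated with the law of `R`, as it arises for the mate and for the
inverse law of a structure map. Strictness turns it into verticality. -/
theorem eq_distributor (hR : R.IsStrict) (K : Cleavage R.F) {A : C} {E : D}
    (f : A ⟶ R.F.obj E) {g : S'.T.obj (K.pull f) ⟶ K.pull (S.T.map f ≫ (R.α E).inv)}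
    (hp : R.F.map g ≫ eqToHom (K.base (S.T.map f ≫ (R.α E).inv)) =
      (R.α (K.pull f)).hom ≫ eqToHom (congrArg S.T.obj (K.base f)))
    (hφ : g ≫ K.lift (S.T.map f ≫ (R.α E).inv) = S'.T.map (K.lift f)) :
    g = distributor hR K f := by
  refine K.hom_ext _ ?_ (hφ.trans (distributor_lift hR K f).symm)
  obtain ⟨h, hα⟩ := hR (K.pull f)
  rw [hα, eqToHom_trans] at hp
  rw [proj_distributor hR K f ((h.trans (congrArg S.T.obj (K.base f))).trans (K.base _).symm),
    ← cancel_mono (eqToHom (K.base (S.T.map f ≫ (R.α E).inv))), hp, eqToHom_trans]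

end Distributors

/-! ### The bijection. -/

section Equivalence

open Bicategory

variable {X : TngCat.{v, max u v}}

namespace TangentFibration

variable (Φ : TangentFibration X)

/-- The two components of the mate equation are the two defining properties of the distributor. -/
theorem dist_eq_distributor (Y : Comma (𝟭 X.carrier) Φ.obj.proj) :
    Φ.cleavage.cartesianLifts.dist Y = distributor Φ.strict Φ.cleavage (arr Y) :=
  eq_distributor Φ.strict Φ.cleavage (arr Y) (Φ.cleavage.cartesianLifts.proj_dist Y)
    (Φ.cleavage.cartesianLifts.dist_φ Y)

theorem isIso_dist (Y : Comma (𝟭 X.carrier) Φ.obj.proj) :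
    IsIso (Φ.cleavage.cartesianLifts.dist Y) := by
  rw [dist_eq_distributor]
  exact Φ.distributor_iso (arr Y)

/-- The structure map of the pseudoalgebra associated to a tangent fibration. -/
noncomputable def structureMap : StructureMap Φ.obj :=
  Φ.cleavage.cartesianLifts.algebraMap Φ.isIso_dist

theorem structureMap_law_inv (Y : Comma (𝟭 X.carrier) Φ.obj.proj) :
    (algLaw Φ.structureMap Y).inv = distributor Φ.strict Φ.cleavage (arr Y) :=
  Φ.dist_eq_distributor Y

/-- The lifts of a tangent fibration. -/
noncomputable def tangentLifts : TangentLifts Φ.structureMap where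
  toCartesianLifts := Φ.cleavage.cartesianLifts
  law_φ Y := by
    rw [← Iso.eq_inv_comp, structureMap_law_inv]
    exact (distributor_lift Φ.strict Φ.cleavage (arr Y)).symm

/-- The pseudoalgebra associated to a tangent fibration. -/
noncomputable def pseudoalgebra : (commaMonad X).PseudoalgebraStructure Φ.obj :=
  Φ.tangentLifts.pseudoalgebra

/-- The domains agree by definition. For the lifts, naturality of `φ` at the morphism `(f, 𝟙)` to
the unit gives `c(f, 𝟙) ≫ ζ⁻¹ = φ`. -/
theorem liftChoice_pseudoalgebra :
    liftChoice Φ.pseudoalgebra = Φ.cleavage.toLiftChoice := by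
  refine congrArg (LiftChoice.mk fun {B E} f => Φ.cleavage.pull f) ?_
  funext B E f
  exact (Φ.tangentLifts.φ_natural (Y := mkObj f) (Z := mkObj (unitArr Φ.obj E)) _).trans
    (Category.comp_id _)

end TangentFibration

theorem TangentLifts.law_inv_φ {A : Slice X} {c : StructureMap A} (K : TangentLifts c)
    (Y : Comma (𝟭 X.carrier) A.proj) :
    (algLaw c Y).inv ≫ K.φ ((commaT A.hom).obj Y) = A.dom.str.T.map (K.φ Y) := by
  rw [← K.law_φ, Iso.inv_hom_id_assoc]

/-- The triangle of `c` commutes as tangent morphisms, and the projection of the comma category has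
identity law. -/
theorem proj_law_inv {A : Slice X} (c : StructureMap A) (Y : Comma (𝟭 X.carrier) A.proj) :
    A.proj.map (algLaw c Y).inv ≫ eqToHom (alg_base c ((commaT A.hom).obj Y)) =
      (StrongTangentMorphism.α A.hom ((algFunctor c).obj Y)).hom ≫
        eqToHom (congrArg X.str.T.obj (alg_base c Y)) := by
  have h : A.proj.map (algLaw c Y).hom ≫
      (StrongTangentMorphism.α A.hom ((algFunctor c).obj Y)).hom =
        eqToHom ((alg_base c ((commaT A.hom).obj Y)).trans
          (congrArg X.str.T.obj (alg_base c Y).symm)) :=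
    (StrongTangentMorphism.α_eq c.w Y).trans
      ((congrArg (_ ≫ ·) (Category.id_comp _)).trans (eqToHom_trans _ _))
  rw [← cancel_epi (A.proj.map (algLaw c Y).hom), ← A.proj.map_comp_assoc, Iso.hom_inv_id,
    reassoc_of% h, A.proj.map_id]
  simp

/-- The cleavage given by a pseudoalgebra. -/
noncomputable def pseudoalgebraCleavage {A : Slice X}
    (P : (commaMonad X).PseudoalgebraStructure A) : Cleavage A.proj where
  toLiftChoice := liftChoice P
  cartesian f := by
    rw [liftChoice_lift]
    exact (pseudoalgebraLifts P).isStronglyCartesian (mkObj f)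

theorem pseudoalgebra_law_inv {A : Slice X} (hA : StrongTangentMorphism.IsStrict A.hom)
    (P : (commaMonad X).PseudoalgebraStructure A) {B : X.carrier} {E : A.dom.carrier}
    (f : B ⟶ A.proj.obj E) :
    (algLaw (A := A) P.c (mkObj f)).inv = distributor hA (pseudoalgebraCleavage P) f := by
  refine eq_distributor hA (pseudoalgebraCleavage P) f (proj_law_inv (A := A) P.c (mkObj f)) ?_
  change _ ≫ (liftChoice P).lift _ = A.dom.str.T.map ((liftChoice P).lift f)
  rw [liftChoice_lift, liftChoice_lift]
  exact (pseudoalgebraLifts P).law_inv_φ (mkObj f)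

/-- The tangent fibration given by a pseudoalgebra. -/
noncomputable def fibrationOfPseudoalgebra (A : Slice X)
    (hA : StrongTangentMorphism.IsStrict A.hom) (P : (commaMonad X).PseudoalgebraStructure A) :
    TangentFibration X where
  obj := A
  strict := hA
  cleavage := pseudoalgebraCleavage P
  distributor_iso f := by
    rw [← pseudoalgebra_law_inv]
    exact (algLaw (A := A) P.c (mkObj f)).isIso_inv

/-- Beyond the chosen lifts, a cleavage and the invertibility of its distributors are only
properties. -/
theorem TangentFibration.eq_of_cleavage_eq {A : Slice X}
    {hA : StrongTangentMorphism.IsStrict A.hom} {K K' : Cleavage A.proj} {h h'}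
    (e : K.toLiftChoice = K'.toLiftChoice) :
    (⟨A, hA, K, h⟩ : TangentFibration X) = ⟨A, hA, K', h'⟩ := by
  obtain ⟨K, _⟩ := K
  obtain ⟨K', _⟩ := K'
  obtain rfl : K = K' := e
  rfl

/-- Tangent fibrations are the pseudoalgebras of the comma 2-monad on strict tangent
morphisms. -/
noncomputable def fibrationEquiv : TangentFibration X ≃
    {P : (commaMonad X).Pseudoalgebra // StrongTangentMorphism.IsStrict P.obj.hom} where
  toFun Φ := ⟨⟨Φ.obj, Φ.pseudoalgebra⟩, Φ.strict⟩
  invFun P := fibrationOfPseudoalgebra P.1.obj P.2 P.1.str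
  left_inv Φ := TangentFibration.eq_of_cleavage_eq Φ.liftChoice_pseudoalgebra
  -- The round trip has the same choice of lifts as `P`, which determines the pseudoalgebra
  -- structure.
  right_inv P := Subtype.ext (congrArg (TwoMonad.Pseudoalgebra.mk P.1.obj)
    (pseudoalgebra_ext
      (fibrationOfPseudoalgebra P.1.obj P.2 P.1.str).liftChoice_pseudoalgebra))

end Equivalence

end TangentCat

theorem mainTheorem5 (X : TangentCat.TngCat.{v, max u v}) :
    ∃ e : TangentCat.TangentFibration X ≃
        {P : (TangentCat.commaMonad X).Pseudoalgebra //
          TangentCat.StrongTangentMorphism.IsStrict P.obj.hom},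
      ∀ Φ : TangentCat.TangentFibration X,
        ∃ P : (TangentCat.commaMonad X).PseudoalgebraStructure Φ.obj,
          (e Φ).1 = ⟨Φ.obj, P⟩ ∧
          Φ.cleavage.toLiftChoice = TangentCat.liftChoice P ∧
          ∀ (A : X.carrier) (E : Φ.obj.dom.carrier)
            (f : A ⟶ (TangentCat.StrongTangentMorphism.F Φ.obj.hom).obj E),
            HEq (TangentCat.distributor Φ.strict Φ.cleavage f)
              (TangentCat.StrongTangentMorphism.α P.c.f (TangentCat.mkObj f)).inv :=
  ⟨TangentCat.fibrationEquiv, fun Φ => ⟨Φ.pseudoalgebra, rfl, Φ.liftChoice_pseudoalgebra.symm,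
    -- For the constructed algebra the two hom-types agree by definition, so an honest equality
    -- suffices.
    fun _ _ f => heq_of_eq (Φ.structureMap_law_inv (TangentCat.mkObj f)).symm⟩⟩
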